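/- Call $\phi:\mathbb R\to[-\infty,\infty)$ admissible if it is concave, upper semicontinuous and not identically $-\infty$; let $\mathcal C$ be the set of admissible functions and $\mathcal{SC}_0\subset\mathcal C$ the set of those with $\psi(x)=\psi(-x)$ for all $x$. Let $f_0$ be a bounded probability density on $\mathbb R$ with $\int|x|f_0(x)\,dx<\infty$ that is symmetric about $\theta_0\in\mathbb R$, i.e. $f_0(\theta_0+x)=f_0(\theta_0-x)$ for all $x$, and let $F_0$ be its distribution. Let $\tilde\phi_0$ be the maximizer over $\phi\in\mathcal C$ of $\int\phi\,dF_0-\int e^{\phi(x)}\,dx$, and put $\tilde f_0=e^{\tilde\phi_0}$ and $\tilde g_0=\tilde f_0(\cdot+\theta_0)$. Let $X_1,X_2,\dots$ be i.i.d. with density $f_0$, let $\mathbb F_n$ be the empirical distribution of $X_1,\dots,X_n$, and let $\bar\theta_n$ be real random variables with $\bar\theta_n\to\theta_0$ in probability. Let $\hat f_n$ be the maximum likelihood estimator based on $X_1,\dots,X_n$ over all log-concave densities $e^\phi$, $\phi\in\mathcal C$. Define the following estimators. * Symmetrized: $\hat g_n^{sym}(z)=\tfrac12\{\hat f_n(\bar\theta_n+z)+\hat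 f_n(\bar\theta_n-z)\}$. * Partial MLE: $\hat g_{\bar\theta_n}=e^{\hat\psi}$, where $\hat\psi$ maximizes $\int\psi(x-\bar\theta_n)\,d\mathbb F_n(x)-\int e^{\psi(x-\bar\theta_n)}\,dx$ over $\psi\in\mathcal{SC}_0$. * Geometric mean: $\hat g_n^{geo,sym}(z)=C_n\{\hat f_n(\bar\theta_n+z)\hat f_n(\bar\theta_n-z)\}^{1/2}$ with $C_n^{-1}=\int\{\hat f_n(\bar\theta_n+z)\hat f_n(\bar\theta_n-z)\}^{1/2}dz$. * Smoothed symmetrized: $(\hat g_n^{sym})^{sm}(z)=\hat b_n^{-1}\int\hat g_n^{sym}(z-t)\,\varphi(t/\hat b_n)\,dt$, where $\varphi$ is the standard normal density and $\hat b_n^2=\frac1{n-1}\sum_{i=1}^n(X_i-\bar X_n)^2-\mathrm{Var}(\hat f_n)$, $\hat b_n\ge 0$. Here $\bar X_n$ is the sample mean of $X_1,\dots,X_n$ and $\mathrm{Var}(\hat f_n)=\int z^2\hat f_n(z)\,dz-\left(\int z\hat f_n(z)\,dz\right)^2$. (For degenerate samples, on which these maximizers may fail to exist, the estimators may be defined by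 an arbitrary convention.) Then for each $h_n\in\{\hat g_n^{sym},\ \hat g_{\bar\theta_n},\ \hat g_n^{geo,sym}\}$, $$\int|h_n(z)-\tilde g_0(z)|\,dz\to0\quad\text{in probability.}$$ If in addition $\int z^2f_0(z)\,dz<\infty$, then $\tilde b^2:=\int z^2\{f_0(z)-\tilde f_0(z)\}\,dz\ge0$ and $$\int|(\hat g_n^{sym})^{sm}(z)-\tilde g_0^{sm}(z)|\,dz\to0\quad\text{in probability,}$$ where $\tilde g_0^{sm}$ is the convolution of $\tilde g_0$ with the centred Gaussian distribution of variance $\tilde b^2$ (the point mass at $0$ if $\tilde b^2=0$). If moreover $\bar\theta_n\to\theta_0$ almost surely, then all of these convergences hold almost surely. -/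

import Mathlib

open MeasureTheory ProbabilityTheory Filter Topology
open scoped ENNReal

noncomputable section

namespace LogConcaveLocation

/-- Probability densities on the real line. -/
def densities : Set (ℝ → ℝ) :=
  {f | Measurable f ∧ (∀ x, 0 ≤ f x) ∧ ∫⁻ x, ENNReal.ofReal (f x) = 1}

/-- Densities that are symmetric about `θ`. -/
def symmetricDensities (θ : ℝ) : Set (ℝ → ℝ) :=
  {f | f ∈ densities ∧ ∀ x, f (θ + x) = f (θ - x)}

/-- Bounded symmetric densities with a finite first moment. -/
def modelP1 : Set (ℝ → ℝ) :=
  {f | f ∈ densities ∧ (∃ θ, f ∈ symmetricDensities θ) ∧ BddAbove (Set.range f) ∧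
    Integrable (fun x => |x| * f x)}

/-- The probability measure with Lebesgue density `f`. -/
def lawOf (f : ℝ → ℝ) : Measure ℝ :=
  volume.withDensity fun x => ENNReal.ofReal (f x)

/-- Closed proper concave functions `φ : ℝ → [-∞, ∞)`. For such functions, being closed
means being upper semicontinuous, and being proper means being finite somewhere. -/
def concaveClass : Set (ℝ → EReal) :=
  {φ | (∀ x, φ x ≠ ⊤) ∧ (∃ x, φ x ≠ ⊥) ∧ UpperSemicontinuous φ ∧
    ∀ x y a b : ℝ, 0 < a → 0 < b → a + b = 1 →
      (a : EReal) * φ x + (b : EReal) * φ y ≤ φ (a * x + b * y)}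

/-- The members of `concaveClass` that are symmetric about `θ`. -/
def symmetricConcaveClass (θ : ℝ) : Set (ℝ → EReal) :=
  {φ | φ ∈ concaveClass ∧ ∀ x, φ (θ + x) = φ (θ - x)}

/-- The extended-real integral `∫ φ dμ = ∫ φ⁺ dμ - ∫ φ⁻ dμ`. -/
def extIntegral (φ : ℝ → EReal) (μ : Measure ℝ) : EReal :=
  ((∫⁻ x, (φ x).toENNReal ∂μ : ℝ≥0∞) : EReal) - ((∫⁻ x, (-φ x).toENNReal ∂μ : ℝ≥0∞) : EReal)

/-- The criterion `ω(φ, μ) = ∫ φ dμ - ∫ exp φ(x) dx`. -/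
def omega (φ : ℝ → EReal) (μ : Measure ℝ) : EReal :=
  extIntegral φ μ - ((∫⁻ x, EReal.exp (φ x) : ℝ≥0∞) : EReal)

/-- The criterion `Ψ(θ, ψ, μ) = ∫ ψ(x - θ) dμ(x) - ∫ exp ψ(x - θ) dx`. -/
def Psi (θ : ℝ) (ψ : ℝ → EReal) (μ : Measure ℝ) : EReal :=
  extIntegral (fun x => ψ (x - θ)) μ - ((∫⁻ x, EReal.exp (ψ (x - θ)) : ℝ≥0∞) : EReal)

open Classical in
/-- A maximizer of `J` over `S` (the constant function `-∞` if there is none). -/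
def argmaxOn (S : Set (ℝ → EReal)) (J : (ℝ → EReal) → EReal) : ℝ → EReal :=
  if h : ∃ φ, φ ∈ S ∧ IsMaxOn J S φ then h.choose else fun _ => ⊥

/-- The function `exp φ`, with real values. -/
def expFun (φ : ℝ → EReal) (x : ℝ) : ℝ := (EReal.exp (φ x)).toReal

/-- The log-density of the log-concave projection of `μ`. -/
def logProjection (μ : Measure ℝ) : ℝ → EReal :=
  argmaxOn concaveClass fun φ => omega φ μ

/-- The empirical measure of the first `n` terms of `x`. -/
def empiricalMeasure (n : ℕ) (x : ℕ → ℝ) : Measure ℝ :=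
  (n : ℝ≥0∞)⁻¹ • ∑ i ∈ Finset.range n, Measure.dirac (x i)

/-- Logarithms of log-concave densities. -/
def logDensities : Set (ℝ → EReal) :=
  {φ | φ ∈ concaveClass ∧ ∫⁻ x, EReal.exp (φ x) = 1}

/-- The maximum likelihood estimator over all log-concave densities, based on the first `n`
terms of `x`: the maximized criterion is the log-likelihood divided by `n`. -/
def mle (n : ℕ) (x : ℕ → ℝ) : ℝ → ℝ :=
  expFun (argmaxOn logDensities fun φ => extIntegral φ (empiricalMeasure n x))

/-- The symmetrized estimator. -/
def symEstimator (n : ℕ) (x : ℕ → ℝ) (θ : ℝ) (z : ℝ) : ℝ :=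
  (1 / 2) * (mle n x (θ + z) + mle n x (θ - z))

/-- The partial maximum likelihood estimator. -/
def partialMLE (n : ℕ) (x : ℕ → ℝ) (θ : ℝ) : ℝ → ℝ :=
  expFun (argmaxOn (symmetricConcaveClass 0) fun ψ => Psi θ ψ (empiricalMeasure n x))

/-- The normalizing constant of the geometric-mean estimator. -/
def geoConst (n : ℕ) (x : ℕ → ℝ) (θ : ℝ) : ℝ :=
  (∫ z, √(mle n x (θ + z) * mle n x (θ - z)))⁻¹

/-- The geometric-mean symmetrized estimator. -/
def geoEstimator (n : ℕ) (x : ℕ → ℝ) (θ : ℝ) (z : ℝ) : ℝ :=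
  geoConst n x θ * √(mle n x (θ + z) * mle n x (θ - z))

/-- The sample mean. -/
def sampleMean (n : ℕ) (x : ℕ → ℝ) : ℝ := (∑ i ∈ Finset.range n, x i) / n

/-- The sample variance, with divisor `n - 1`. -/
def sampleVariance (n : ℕ) (x : ℕ → ℝ) : ℝ :=
  (∑ i ∈ Finset.range n, (x i - sampleMean n x) ^ 2) / ((n : ℝ) - 1)

/-- The variance of the distribution with density `f`. -/
def densityVariance (f : ℝ → ℝ) : ℝ := (∫ z, z ^ 2 * f z) - (∫ z, z * f z) ^ 2

/-- The data-driven bandwidth: the square root of the sample variance minus the variance of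
the log-concave maximum likelihood estimator. -/
def bandwidth (n : ℕ) (x : ℕ → ℝ) : ℝ :=
  √(sampleVariance n x - densityVariance (mle n x))

/-- The smoothed symmetrized estimator. -/
def smoothedSymEstimator (n : ℕ) (x : ℕ → ℝ) (θ : ℝ) (z : ℝ) : ℝ :=
  (1 / bandwidth n x) *
    ∫ t, symEstimator n x θ (z - t) * gaussianPDFReal 0 1 (t / bandwidth n x)

/-- The density of the log-concave projection of the distribution with density `f`. -/
def projDensity (f : ℝ → ℝ) : ℝ → ℝ := expFun (logProjection (lawOf f))

/-- The log-concave projection of `f`, recentred at `θ`. -/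
def centredProj (f : ℝ → ℝ) (θ : ℝ) : ℝ → ℝ :=
  expFun fun x => logProjection (lawOf f) (x + θ)

/-- The limiting squared bandwidth. -/
def limitVariance (f : ℝ → ℝ) : ℝ := ∫ z, z ^ 2 * (f z - projDensity f z)

/-- The convolution of `centredProj f θ` with the centred Gaussian distribution of variance
`limitVariance f`; the Gaussian distribution of variance zero is the point mass at zero. -/
def smoothedProj (f : ℝ → ℝ) (θ : ℝ) (z : ℝ) : ℝ :=
  ∫ t, centredProj f θ (z - t) ∂(gaussianReal 0 (limitVariance f).toNNReal)

/-- The `L₁` distance with respect to Lebesgue measure. -/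
def L1dist (f g : ℝ → ℝ) : ℝ≥0∞ := eLpNorm (f - g) 1 volume

/-- Convergence to zero in probability of nonnegative random quantities. -/
def TendsToZeroInProb {Ω : Type*} [MeasurableSpace Ω] (P : Measure Ω) (D : ℕ → Ω → ℝ≥0∞) : Prop :=
  ∀ ε : ℝ≥0∞, 0 < ε → Tendsto (fun n => P {ω | ε ≤ D n ω}) atTop (𝓝 0)

end LogConcaveLocation

end

open LogConcaveLocation

open scoped NNReal

noncomputable section

namespace LogConcaveLocation

/-! The whole theorem rests on one deterministic fact: the log-concave projection depends
continuously on its measure. If the `μ k` converge to `μ₀` in the sense of `W1Conv` (Wasserstein-1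
convergence, tested on Lipschitz functions) and `μ₀` is not a point mass, then any projections of
the `μ k` converge in L¹ to any projection of `μ₀` (`W1Conv.tendsto_integral_abs_sub`), even with
the weight `1 + x ^ 2` (`W1Conv.tendsto_integral_weighted`).

Continuity has two ingredients. The first is compactness: log-densities whose criterion is bounded
below lie under a common exponential envelope (`W1Conv.exists_tight`). Their Lipschitz majorants
`lipReg` converge along a subsequence, and passing to a majorant of slope L adds only O(1/L) of mass
(`lintegral_exp_lipReg_le`). Hence the maximal criterion cannot jump up in the limit
(`W1Conv.exists_omega_ge`), which also gives existence (`exists_isProj`). The second is strong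
concavity: a midpoint beats the average criterion by half the squared Hellinger distance
(`IsRegular.midpt`), so near-maximizers are close to the maximizer. The Lipschitz majorant of the
limiting projection is such a near-maximizer for `μ k`, because its criterion can be tested by
`W1Conv`.

Projections commute with isometries of the line (`IsProj.comp_affine`). Recentring at an estimated
location, or reflecting about it, therefore amounts to moving the empirical measure, and both
versions converge to the same law because the true density is symmetric. The partial MLE is the
projection of the symmetrized empirical measure (`isProj_argmaxOn_symmetricConcaveClass`). For the
smoothed estimator, weighted convergence controls the bandwidth, `IsProj.integral_sq_le` gives its
sign, and Gaussian convolution is jointly continuous in density and bandwidth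
(`tendsto_L1dist_gaussConv`).

Chance enters only through the empirical integrals of countably many test functions and through the
location estimate. Almost sure convergence intersects countably many strong laws. For convergence in
probability, `ContinuousInTests.exists_uniform` shows that finitely many tests within some δ already
force a small error, so the bad event sits in a finite union of events of vanishing probability. -/

/-! ### The class of closed proper concave functions and its stability properties. -/

/-- The effective domain of an extended-real function. -/
def effDom (φ : ℝ → EReal) : Set ℝ := {x | φ x ≠ ⊥}

theorem coe_toReal_of_mem {φ : ℝ → EReal} (hφ : φ ∈ concaveClass) {x : ℝ} (hx : x ∈ effDom φ) :
    (((φ x).toReal : ℝ) : EReal) = φ x :=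
  EReal.coe_toReal (hφ.1 x) hx

theorem concaveOn_toReal {φ : ℝ → EReal} (hφ : φ ∈ concaveClass) :
    ConcaveOn ℝ (effDom φ) (fun x => (φ x).toReal) := by
  have key : ∀ x ∈ effDom φ, ∀ y ∈ effDom φ, ∀ a b : ℝ, 0 < a → 0 < b → a + b = 1 →
      ((a * (φ x).toReal + b * (φ y).toReal : ℝ) : EReal) ≤ φ (a * x + b * y) := by
    intro x hx y hy a b ha hb hab
    have := hφ.2.2.2 x y a b ha hb hab
    rwa [← coe_toReal_of_mem hφ hx, ← coe_toReal_of_mem hφ hy, ← EReal.coe_mul, ← EReal.coe_mul,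
      ← EReal.coe_add] at this
  refine concaveOn_iff_forall_pos.2 ⟨convex_iff_forall_pos.2 ?_, ?_⟩
  · intro x hx y hy a b ha hb hab
    exact ((EReal.bot_lt_coe _).trans_le (key x hx y hy a b ha hb hab)).ne'
  · intro x hx y hy a b ha hb hab
    have h := key x hx y hy a b ha hb hab
    have hmem : a * x + b * y ∈ effDom φ := ((EReal.bot_lt_coe _).trans_le h).ne'
    rw [← coe_toReal_of_mem hφ hmem, EReal.coe_le_coe_iff] at h
    simpa using h

theorem mem_concaveClass_of_concaveOn {φ : ℝ → EReal} (htop : ∀ x, φ x ≠ ⊤)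
    (hne : (effDom φ).Nonempty) (husc : UpperSemicontinuous φ)
    (hc : ConcaveOn ℝ (effDom φ) (fun x => (φ x).toReal)) : φ ∈ concaveClass := by
  refine ⟨htop, hne, husc, fun x y a b ha hb hab => ?_⟩
  by_cases hx : φ x = ⊥
  · simp [hx, EReal.coe_mul_bot_of_pos ha]
  by_cases hy : φ y = ⊥
  · simp [hy, EReal.coe_mul_bot_of_pos hb]
  have h := hc.2 hx hy ha.le hb.le hab
  have hm : a * x + b * y ∈ effDom φ := by
    have := hc.1 hx hy ha.le hb.le hab
    simpa using this
  rw [← EReal.coe_toReal (htop x) hx, ← EReal.coe_toReal (htop y) hy,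
    ← EReal.coe_toReal (htop _) hm, ← EReal.coe_mul, ← EReal.coe_mul, ← EReal.coe_add,
    EReal.coe_le_coe_iff]
  simpa using h

theorem measurable_of_mem {φ : ℝ → EReal} (hφ : φ ∈ concaveClass) : Measurable φ :=
  hφ.2.2.1.measurable

theorem expFun_nonneg (φ : ℝ → EReal) (x : ℝ) : 0 ≤ expFun φ x := ENNReal.toReal_nonneg

theorem expFun_of_bot {φ : ℝ → EReal} {x : ℝ} (hx : φ x = ⊥) : expFun φ x = 0 := by
  simp [expFun, hx]

theorem expFun_of_mem {φ : ℝ → EReal} (hφ : φ ∈ concaveClass) {x : ℝ} (hx : x ∈ effDom φ) :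
    expFun φ x = Real.exp (φ x).toReal := by
  unfold expFun
  conv_lhs => rw [← coe_toReal_of_mem hφ hx]
  rw [EReal.exp_coe, ENNReal.toReal_ofReal (Real.exp_pos _).le]

theorem expFun_coe (g : ℝ → ℝ) (x : ℝ) : expFun (fun y => (g y : EReal)) x = Real.exp (g x) := by
  simp [expFun, (Real.exp_pos _).le]

theorem ofReal_expFun {φ : ℝ → EReal} (hφ : φ ∈ concaveClass) (x : ℝ) :
    ENNReal.ofReal (expFun φ x) = EReal.exp (φ x) :=
  ENNReal.ofReal_toReal (by simpa using hφ.1 x)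

theorem measurable_expFun {φ : ℝ → EReal} (hφ : φ ∈ concaveClass) : Measurable (expFun φ) :=
  (EReal.exp_monotone.measurable.comp (measurable_of_mem hφ)).ennreal_toReal

theorem integrable_expFun {φ : ℝ → EReal} (hφ : φ ∈ concaveClass)
    (h : ∫⁻ x, EReal.exp (φ x) ≠ ⊤) : Integrable (expFun φ) := by
  refine ⟨(measurable_expFun hφ).aestronglyMeasurable, ?_⟩
  rw [hasFiniteIntegral_iff_ofReal (Eventually.of_forall (expFun_nonneg φ))]
  simpa only [ofReal_expFun hφ] using h.lt_top

theorem ofReal_integral_expFun {φ : ℝ → EReal} (hφ : φ ∈ concaveClass)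
    (h : ∫⁻ x, EReal.exp (φ x) ≠ ⊤) :
    ENNReal.ofReal (∫ x, expFun φ x) = ∫⁻ x, EReal.exp (φ x) := by
  rw [ofReal_integral_eq_lintegral_ofReal (integrable_expFun hφ h)
    (Eventually.of_forall (expFun_nonneg φ))]
  simp only [ofReal_expFun hφ]

theorem coe_mem_concaveClass {g : ℝ → ℝ} (hg : Continuous g) (hc : ConcaveOn ℝ Set.univ g) :
    (fun x => (g x : EReal)) ∈ concaveClass := by
  have h : effDom (fun x => (g x : EReal)) = Set.univ := by ext; simp [effDom]
  refine mem_concaveClass_of_concaveOn (by simp) ⟨0, by simp [effDom]⟩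
    (continuous_coe_real_ereal.comp hg).upperSemicontinuous ?_
  simpa [h] using hc

theorem effDom_add (φ ψ : ℝ → EReal) :
    effDom (fun x => φ x + ψ x) = effDom φ ∩ effDom ψ := by
  ext x; simp [effDom, EReal.add_eq_bot_iff]

/-- Neither summand takes the value `⊤`, so addition is continuous at every pair of values met and
upper semicontinuity survives. The common point of the domains is what keeps the sum proper. -/
theorem add_mem_concaveClass {φ ψ : ℝ → EReal} (hφ : φ ∈ concaveClass) (hψ : ψ ∈ concaveClass)
    (h : (effDom φ ∩ effDom ψ).Nonempty) : (fun x => φ x + ψ x) ∈ concaveClass := by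
  refine mem_concaveClass_of_concaveOn (fun x => EReal.add_ne_top (hφ.1 x) (hψ.1 x))
    (by rwa [effDom_add]) (hφ.2.2.1.add' hψ.2.2.1 fun x =>
      EReal.continuousAt_add (Or.inl (hφ.1 x)) (Or.inr (hψ.1 x))) ?_
  rw [effDom_add]
  have hc := (concaveOn_toReal hφ).1.inter (concaveOn_toReal hψ).1
  refine (((concaveOn_toReal hφ).subset Set.inter_subset_left hc).add
    ((concaveOn_toReal hψ).subset Set.inter_subset_right hc)).congr ?_
  intro x hx
  exact (EReal.toReal_add (hφ.1 x) hx.1 (hψ.1 x) hx.2).symm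

theorem effDom_half (φ : ℝ → EReal) :
    effDom (fun x => ((1 / 2 : ℝ) : EReal) * φ x) = effDom φ := by
  ext x
  have h0 : (0 : ℝ) < 1 / 2 := by norm_num
  change ((1 / 2 : ℝ) : EReal) * φ x ≠ ⊥ ↔ φ x ≠ ⊥
  induction φ x with
  | bot => rw [EReal.coe_mul_bot_of_pos h0]
  | top => rw [EReal.coe_mul_top_of_pos h0]
  | coe r => simp [← EReal.coe_mul]

theorem half_mem_concaveClass {φ : ℝ → EReal} (hφ : φ ∈ concaveClass) :
    (fun x => ((1 / 2 : ℝ) : EReal) * φ x) ∈ concaveClass := by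
  have h0 : (0 : ℝ) < 1 / 2 := by norm_num
  have hcont : Continuous fun z : EReal => ((1 / 2 : ℝ) : EReal) * z := by
    refine continuous_iff_continuousAt.2 fun z => ?_
    refine (EReal.continuousAt_mul (p := (((1 / 2 : ℝ) : EReal), z)) ?_ ?_ ?_ ?_).comp
      (f := fun z : EReal => (((1 / 2 : ℝ) : EReal), z)) (by fun_prop) <;> left <;>
      exact_mod_cast (by norm_num)
  have hmono : Monotone fun z : EReal => ((1 / 2 : ℝ) : EReal) * z := fun z w hzw =>
    mul_le_mul_of_nonneg_left hzw (by exact_mod_cast h0.le)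
  refine mem_concaveClass_of_concaveOn (fun x => ?_) (by rw [effDom_half]; exact hφ.2.1)
    (hcont.comp_upperSemicontinuous hφ.2.2.1 hmono) ?_
  · have := hφ.1 x
    revert this
    induction φ x with
    | bot => rw [EReal.coe_mul_bot_of_pos h0]; simp
    | top => simp
    | coe r => simp [← EReal.coe_mul]
  · rw [effDom_half]
    refine ((concaveOn_toReal hφ).smul h0.le).congr fun x _ => ?_
    simp [EReal.toReal_mul]

theorem comp_affine_mem_concaveClass {φ : ℝ → EReal} (hφ : φ ∈ concaveClass) {s : ℝ} (hs : s ≠ 0)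
    (t : ℝ) : (fun x => φ (s * x + t)) ∈ concaveClass := by
  obtain ⟨x, hx⟩ := hφ.2.1
  refine ⟨fun x => hφ.1 _, ⟨(x - t) / s, ?_⟩, ?_, fun x y a b ha hb hab => ?_⟩
  · have : s * ((x - t) / s) + t = x := by field_simp; ring
    simpa only [this] using hx
  · intro x y hy
    have hc : Continuous fun x : ℝ => s * x + t := by fun_prop
    exact hc.continuousAt.eventually (hφ.2.2.1 (s * x + t) y hy)
  · have := hφ.2.2.2 (s * x + t) (s * y + t) a b ha hb hab
    have e : a * (s * x + t) + b * (s * y + t) = s * (a * x + b * y) + t := by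
      linear_combination t * hab
    rwa [e] at this

/-! ### Finiteness of the criterion and pointwise bounds from bounded mass. -/

/-- The criterion `ω(φ, μ)` is finite: all the integrals involved are. -/
structure IsRegular (φ : ℝ → EReal) (μ : Measure ℝ) : Prop where
  ae_ne_bot : ∀ᵐ x ∂μ, φ x ≠ ⊥
  integrable : Integrable (fun x => (φ x).toReal) μ
  lintegral_ne_top : ∫⁻ x, EReal.exp (φ x) ≠ ⊤

/-- The real-valued criterion. -/
def realOmega (φ : ℝ → EReal) (μ : Measure ℝ) : ℝ :=
  ∫ x, (φ x).toReal ∂μ - ∫ x, expFun φ x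

theorem omega_eq_coe {φ : ℝ → EReal} (hφ : φ ∈ concaveClass) {μ : Measure ℝ}
    (h : IsRegular φ μ) : omega φ μ = (realOmega φ μ : EReal) := by
  have h1 : ∫⁻ x, (φ x).toENNReal ∂μ = ∫⁻ x, ENNReal.ofReal (φ x).toReal ∂μ :=
    lintegral_congr fun x => EReal.toENNReal_of_ne_top (hφ.1 x)
  have h2 : ∫⁻ x, (-φ x).toENNReal ∂μ = ∫⁻ x, ENNReal.ofReal (-(φ x).toReal) ∂μ := by
    refine lintegral_congr_ae ?_
    filter_upwards [h.ae_ne_bot] with x hx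
    rw [EReal.toENNReal_of_ne_top (by simpa using hx), EReal.toReal_neg_eq]
  have e1 : ∫⁻ x, ENNReal.ofReal (φ x).toReal ∂μ ≠ ⊤ := h.integrable.lintegral_lt_top.ne
  have e2 : ∫⁻ x, ENNReal.ofReal (-(φ x).toReal) ∂μ ≠ ⊤ := h.integrable.neg.lintegral_lt_top.ne
  unfold omega extIntegral realOmega
  rw [integral_eq_lintegral_pos_part_sub_lintegral_neg_part h.integrable, h1, h2,
    ← ofReal_integral_expFun hφ h.lintegral_ne_top, EReal.coe_sub, EReal.coe_sub,
    EReal.coe_ennreal_ofReal, max_eq_left (integral_nonneg (expFun_nonneg φ)),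
    EReal.coe_ennreal_toReal e1, EReal.coe_ennreal_toReal e2]

/-- A concave function on a segment is at least `exp (u m - 1)` near its larger end `m`. -/
theorem dist_mul_exp_le {φ : ℝ → EReal} (hφ : φ ∈ concaveClass) {c : ℝ} (hc0 : 0 ≤ c)
    (hc : ∫⁻ x, EReal.exp (φ x) ≤ ENNReal.ofReal c) {x m : ℝ} (hx : x ∈ effDom φ)
    (hm : m ∈ effDom φ) (h : (φ x).toReal ≤ (φ m).toReal) :
    |x - m| * Real.exp ((φ m).toReal - 1) ≤ c * (1 + ((φ m).toReal - (φ x).toReal)) := by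
  set D := (φ m).toReal - (φ x).toReal with hD
  have hD0 : 0 ≤ D := by simp only [hD]; linarith
  -- Moving from `m` towards `x` by the fraction `s₀` costs at most `s₀ * D ≤ 1` in height, so `exp
  -- φ` stays above `exp (φ m - 1)` on a segment of length `s₀ * |x - m|`.
  set s₀ := 1 / (1 + D)
  have hs0 : 0 < s₀ := by positivity
  have hs1 : s₀ ≤ 1 := by rw [div_le_one (by positivity)]; linarith
  have hsD : s₀ * D ≤ 1 := by
    rw [div_mul_eq_mul_div, one_mul, div_le_one (by positivity)]; linarith
  set y := m + s₀ * (x - m)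
  have hz : ∀ z ∈ Set.uIcc m y, ENNReal.ofReal (Real.exp ((φ m).toReal - 1)) ≤ EReal.exp (φ z) := by
    intro z hz
    rw [← segment_eq_uIcc] at hz
    obtain ⟨a, b, ha, hb, hab, rfl⟩ := hz
    have hbs : b * s₀ ≤ s₀ := by nlinarith
    have hbs0 : 0 ≤ b * s₀ := by positivity
    have e : a • m + b • y = (1 - b * s₀) • m + (b * s₀) • x := by
      simp only [smul_eq_mul, y]; linear_combination m * hab
    have hmem := (concaveOn_toReal hφ).1 hm hx (show 0 ≤ 1 - b * s₀ by linarith) hbs0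
      (by ring)
    have h2 := (concaveOn_toReal hφ).2 hm hx (show 0 ≤ 1 - b * s₀ by linarith) hbs0
      (by ring)
    rw [e, ← ofReal_expFun hφ, expFun_of_mem hφ hmem]
    refine ENNReal.ofReal_le_ofReal (Real.exp_le_exp.2 (le_trans ?_ h2))
    simp only [smul_eq_mul]
    nlinarith
  have hI : ENNReal.ofReal (Real.exp ((φ m).toReal - 1)) * volume (Set.uIcc m y) ≤
      ENNReal.ofReal c := by
    refine le_trans ?_ hc
    rw [← setLIntegral_const]
    exact (setLIntegral_mono' measurableSet_uIcc hz).trans (setLIntegral_le_lintegral _ _)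
  rw [Real.volume_interval, ← ENNReal.ofReal_mul (Real.exp_pos _).le,
    ENNReal.ofReal_le_ofReal_iff hc0]
    at hI
  have e : |y - m| = s₀ * |x - m| := by
    simp only [y, add_sub_cancel_left, abs_mul, abs_of_pos hs0]
  rw [e] at hI
  have e2 : s₀ * (1 + D) = 1 := by simp only [s₀]; field_simp
  calc |x - m| * Real.exp ((φ m).toReal - 1)
      = (Real.exp ((φ m).toReal - 1) * (s₀ * |x - m|)) * (1 + D) := by
        linear_combination (-(|x - m| * Real.exp ((φ m).toReal - 1))) * e2
    _ ≤ c * (1 + D) := by gcongr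

/-- A very high value at `x` forces much mass between `x` and any other point of the domain. Given
two fixed points at positive distance, `x` is far from one of them, and the mass grows exponentially
in the height while `dist_mul_exp_le` allows only linear growth. -/
theorem exists_upper_bound {φ : ℝ → EReal} (hφ : φ ∈ concaveClass)
    (h : ∫⁻ x, EReal.exp (φ x) ≠ ⊤) : ∃ H : ℝ, ∀ x ∈ effDom φ, (φ x).toReal ≤ H := by
  set c := (∫⁻ x, EReal.exp (φ x)).toReal
  have hc0 : 0 ≤ c := ENNReal.toReal_nonneg
  have hc : ∫⁻ x, EReal.exp (φ x) ≤ ENNReal.ofReal c := (ENNReal.ofReal_toReal h).ge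
  rcases Set.subsingleton_or_nontrivial (effDom φ) with hs | ⟨p, hp, q, hq, hpq⟩
  · obtain ⟨p, hp⟩ := hφ.2.1
    exact ⟨(φ p).toReal, fun x hx => by rw [hs hx hp]⟩
  have hd : 0 < |p - q| := abs_pos.2 (sub_ne_zero.2 hpq)
  set l := min (φ p).toReal (φ q).toReal
  refine ⟨max (max (φ p).toReal (φ q).toReal) (max 2 (1 + 4 * c * (1 + |2 - l|) / |p - q|)),
    fun x hx => ?_⟩
  by_contra! hcon
  simp only [max_lt_iff] at hcon
  obtain ⟨⟨h1, h2⟩, h3, h4⟩ := hcon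
  set t := (φ x).toReal
  have k1 := dist_mul_exp_le hφ hc0 hc hp hx h1.le
  have k2 := dist_mul_exp_le hφ hc0 hc hq hx h2.le
  have hl1 : l ≤ (φ p).toReal := min_le_left _ _
  have hl2 : l ≤ (φ q).toReal := min_le_right _ _
  have k3 : |p - q| * Real.exp (t - 1) ≤ 2 * c * (1 + (t - l)) := by
    have : |p - q| ≤ |p - x| + |q - x| := by
      rw [abs_sub_comm q x]; exact abs_sub_le p x q
    have : |p - q| * Real.exp (t - 1) ≤ (|p - x| + |q - x|) * Real.exp (t - 1) := by gcongr
    nlinarith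
  have k4 := Real.quadratic_le_exp_of_nonneg (x := t - 1) (by linarith)
  set s := t - 1
  have hs1 : 1 < s := by simp only [s]; linarith
  have k5 : |p - q| * (s ^ 2 / 2) ≤ 2 * c * (s * (1 + |2 - l|)) := by
    have a1 : |p - q| * (s ^ 2 / 2) ≤ |p - q| * Real.exp s := by gcongr; linarith
    have a2 : 1 + (t - l) ≤ s * (1 + |2 - l|) := by
      have : 1 + (t - l) = s + (2 - l) := by simp only [s]; ring
      have := le_abs_self (2 - l)
      nlinarith [abs_nonneg (2 - l)]
    have a3 : 2 * c * (1 + (t - l)) ≤ 2 * c * (s * (1 + |2 - l|)) := by gcongr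
    linarith
  have k6 : 4 * c * (1 + |2 - l|) / |p - q| < s := by simp only [s]; linarith
  rw [div_lt_iff₀ hd] at k6
  nlinarith

/-- Each of the two subtracted integrals would turn the criterion into `⊥` if it were infinite. The
positive part needs no hypothesis, since finite mass bounds `φ` from above. -/
theorem IsRegular.of_omega_ne_bot {φ : ℝ → EReal} (hφ : φ ∈ concaveClass) {μ : Measure ℝ}
    [IsFiniteMeasure μ] (h : omega φ μ ≠ ⊥) : IsRegular φ μ := by
  have h1 : ∫⁻ x, EReal.exp (φ x) ≠ ⊤ := by
    intro h1
    rw [omega, h1, EReal.coe_ennreal_top, EReal.sub_top] at h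
    exact h rfl
  have h2 : ∫⁻ x, (-φ x).toENNReal ∂μ ≠ ⊤ := by
    intro h2
    rw [omega, extIntegral, h2, EReal.coe_ennreal_top, EReal.sub_top] at h
    exact h (EReal.bot_sub _)
  have hm := measurable_of_mem hφ
  have h3 : ∀ᵐ x ∂μ, φ x ≠ ⊥ := by
    filter_upwards [ae_lt_top (hm.neg.ereal_toENNReal) h2] with x hx hb
    simp [hb] at hx
  refine ⟨h3, ?_, h1⟩
  obtain ⟨H, hH⟩ := exists_upper_bound hφ h1
  have hi : Integrable (fun x => H - (φ x).toReal) μ := by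
    refine ⟨(measurable_const.sub hm.ereal_toReal).aestronglyMeasurable, ?_⟩
    rw [hasFiniteIntegral_iff_ofReal]
    · calc ∫⁻ x, ENNReal.ofReal (H - (φ x).toReal) ∂μ
          ≤ ∫⁻ x, (ENNReal.ofReal H + (-φ x).toENNReal) ∂μ := by
            refine lintegral_mono_ae ?_
            filter_upwards [h3] with x hx
            rw [EReal.toENNReal_of_ne_top (by simpa using hx), EReal.toReal_neg_eq, sub_eq_add_neg]
            exact ENNReal.ofReal_add_le
        _ = ENNReal.ofReal H * μ Set.univ + ∫⁻ x, (-φ x).toENNReal ∂μ := by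
            rw [lintegral_add_left measurable_const, lintegral_const]
        _ < ⊤ := by
            refine ENNReal.add_lt_top.2 ⟨ENNReal.mul_lt_top ENNReal.ofReal_lt_top
              (measure_lt_top _ _), h2.lt_top⟩
    · filter_upwards [h3] with x hx
      exact sub_nonneg.2 (hH x hx)
  have := (integrable_const H).sub hi
  exact this.congr (Eventually.of_forall fun x => by simp)

/-- Exponential envelope of a log-concave density. -/
theorem toReal_le_envelope {φ : ℝ → EReal} (hφ : φ ∈ concaveClass)
    (hc : ∫⁻ x, EReal.exp (φ x) = 1) {H : ℝ} (hH : ∀ x ∈ effDom φ, (φ x).toReal ≤ H)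
    {m : ℝ} (hm : m ∈ effDom φ) (hm1 : H - 1 ≤ (φ m).toReal) {x : ℝ} (hx : x ∈ effDom φ) :
    (φ x).toReal ≤ H + 2 - |x - m| * Real.exp (H - 2) := by
  have hc' : ∫⁻ x, EReal.exp (φ x) ≤ ENNReal.ofReal 1 := by simp [hc]
  have hmH := hH m hm
  rcases le_total (φ x).toReal (φ m).toReal with h | h
  · have := dist_mul_exp_le hφ zero_le_one hc' hx hm h
    have e : |x - m| * Real.exp (H - 2) ≤ |x - m| * Real.exp ((φ m).toReal - 1) :=
      mul_le_mul_of_nonneg_left (Real.exp_le_exp.2 (by linarith)) (abs_nonneg _)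
    linarith
  · have := dist_mul_exp_le hφ zero_le_one hc' hm hx h
    have hxH := hH x hx
    have e : |x - m| * Real.exp (H - 2) ≤ |m - x| * Real.exp ((φ x).toReal - 1) := by
      rw [abs_sub_comm]
      exact mul_le_mul_of_nonneg_left (Real.exp_le_exp.2 (by linarith)) (abs_nonneg _)
    linarith

theorem lintegral_exp_pos {φ : ℝ → EReal} (hφ : φ ∈ concaveClass) {p q : ℝ}
    (hp : p ∈ effDom φ) (hq : q ∈ effDom φ) (hpq : p < q) : ∫⁻ x, EReal.exp (φ x) ≠ 0 := by
  intro h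
  have hexp : Measurable fun x => EReal.exp (φ x) :=
    EReal.exp_monotone.measurable.comp (measurable_of_mem hφ)
  rw [lintegral_eq_zero_iff hexp] at h
  have hsub : Set.Icc p q ⊆ {x | ¬ EReal.exp (φ x) = 0} := fun x hx => by
    have : x ∈ effDom φ := (concaveOn_toReal hφ).1.ordConnected.out hp hq hx
    simpa [effDom] using this
  have := measure_mono_null hsub (ae_iff.1 h)
  rw [Real.volume_Icc, ENNReal.ofReal_eq_zero] at this
  linarith

/-! ### Lipschitz majorants and the mass they add. -/

/-- The smallest `L`-Lipschitz majorant of an extended-real function. -/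
def lipReg (L : ℝ≥0) (φ : ℝ → EReal) (x : ℝ) : ℝ :=
  ⨆ y : effDom φ, ((φ y).toReal - L * |x - y|)

section lipReg

variable {φ : ℝ → EReal} {L : ℝ≥0} {H : ℝ}

theorem lipReg_le_of (hφ : φ ∈ concaveClass) {x c : ℝ}
    (h : ∀ y ∈ effDom φ, (φ y).toReal - L * |x - y| ≤ c) : lipReg L φ x ≤ c := by
  obtain ⟨p, hp⟩ := hφ.2.1
  have : Nonempty (effDom φ) := ⟨⟨p, hp⟩⟩
  exact ciSup_le fun y => h y y.2

theorem le_lipReg (hH : ∀ x ∈ effDom φ, (φ x).toReal ≤ H) {x y : ℝ} (hy : y ∈ effDom φ) :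
    (φ y).toReal - L * |x - y| ≤ lipReg L φ x := by
  refine le_ciSup (f := fun y : effDom φ => (φ y).toReal - L * |x - y|) ?_ ⟨y, hy⟩
  refine ⟨H, ?_⟩
  rintro _ ⟨z, rfl⟩
  have := hH z z.2
  have : 0 ≤ L * |x - z| := by positivity
  simp only
  linarith

theorem le_lipReg_self (hH : ∀ x ∈ effDom φ, (φ x).toReal ≤ H) {x : ℝ} (hx : x ∈ effDom φ) :
    (φ x).toReal ≤ lipReg L φ x := by
  simpa using le_lipReg (L := L) (x := x) hH hx

theorem lipReg_le (hφ : φ ∈ concaveClass) (hH : ∀ x ∈ effDom φ, (φ x).toReal ≤ H) (x : ℝ) :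
    lipReg L φ x ≤ H := by
  refine lipReg_le_of hφ fun y hy => ?_
  have := hH y hy
  have : 0 ≤ L * |x - y| := by positivity
  linarith

theorem lipReg_anti (hφ : φ ∈ concaveClass) (hH : ∀ x ∈ effDom φ, (φ x).toReal ≤ H)
    {L' : ℝ≥0} (hL : L ≤ L') (x : ℝ) : lipReg L' φ x ≤ lipReg L φ x := by
  refine lipReg_le_of hφ fun y hy => le_trans ?_ (le_lipReg hH hy)
  gcongr

theorem lipschitzWith_lipReg (hφ : φ ∈ concaveClass) (hH : ∀ x ∈ effDom φ, (φ x).toReal ≤ H) :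
    LipschitzWith L (lipReg L φ) := by
  refine LipschitzWith.of_le_add_mul _ fun x y => lipReg_le_of hφ fun z hz => ?_
  have h1 := le_lipReg (L := L) (x := y) hH hz
  have h2 : (L : ℝ) * |y - z| ≤ L * |x - z| + L * dist x y := by
    rw [← mul_add, Real.dist_eq]
    gcongr
    rw [abs_sub_comm x y, add_comm]
    exact abs_sub_le y x z
  linarith

/-- The map `(x, y) ↦ φ y - L * |x - y|` is jointly concave, and a partial supremum of a jointly
concave function is concave. -/
theorem concaveOn_lipReg (hφ : φ ∈ concaveClass) (hH : ∀ x ∈ effDom φ, (φ x).toReal ≤ H) :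
    ConcaveOn ℝ Set.univ (lipReg L φ) := by
  refine concaveOn_iff_forall_pos.2 ⟨convex_univ, fun x _ y _ a b ha hb hab => ?_⟩
  simp only [smul_eq_mul]
  set G := lipReg L φ (a * x + b * y)
  have key : ∀ p ∈ effDom φ, ∀ q ∈ effDom φ,
      a * ((φ p).toReal - L * |x - p|) + b * ((φ q).toReal - L * |y - q|) ≤ G := by
    intro p hp q hq
    have hm := (concaveOn_toReal hφ).1 hp hq ha.le hb.le hab
    have hc := (concaveOn_toReal hφ).2 hp hq ha.le hb.le hab
    simp only [smul_eq_mul] at hm hc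
    have h1 := le_lipReg (L := L) (x := a * x + b * y) hH hm
    have h2 : |a * x + b * y - (a * p + b * q)| ≤ a * |x - p| + b * |y - q| := by
      calc |a * x + b * y - (a * p + b * q)| = |a * (x - p) + b * (y - q)| := by ring_nf
        _ ≤ |a * (x - p)| + |b * (y - q)| := abs_add_le _ _
        _ = _ := by rw [abs_mul, abs_mul, abs_of_pos ha, abs_of_pos hb]
    have h3 := mul_le_mul_of_nonneg_left h2 L.coe_nonneg
    linarith
  have step : ∀ q ∈ effDom φ, a * lipReg L φ x + b * ((φ q).toReal - L * |y - q|) ≤ G := by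
    intro q hq
    have : lipReg L φ x ≤ (G - b * ((φ q).toReal - L * |y - q|)) / a :=
      lipReg_le_of hφ fun p hp => by rw [le_div_iff₀ ha]; linarith [key p hp q hq]
    rw [le_div_iff₀ ha] at this
    linarith
  have : lipReg L φ y ≤ (G - a * lipReg L φ x) / b :=
    lipReg_le_of hφ fun q hq => by rw [le_div_iff₀ hb]; linarith [step q hq]
  rw [le_div_iff₀ hb] at this
  linarith

/-- Points to the right of a point from which `φ` falls faster than with slope `-L`. -/
def steepRight (L : ℝ≥0) (φ : ℝ → EReal) : Set ℝ :=
  {x | ∃ y ∈ effDom φ, y < x ∧ φ x < (((φ y).toReal - L * (x - y) : ℝ) : EReal)}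

/-- By concavity a slope below `-L` ahead of `x₀` persists beyond it. Points to the right of `x₀`
thus contribute no more to the supremum at `x₁` than `x₀` itself, while points to the left lose
exactly `L * (x₁ - x₀)`. -/
theorem lipReg_le_of_mem_steepRight (hφ : φ ∈ concaveClass)
    (hH : ∀ x ∈ effDom φ, (φ x).toReal ≤ H) {x₀ x₁ : ℝ} (h₀ : x₀ ∈ steepRight L φ)
    (h : x₀ < x₁) : lipReg L φ x₁ ≤ lipReg L φ x₀ - L * (x₁ - x₀) := by
  obtain ⟨y₀, hy₀, hlt, hφ₀⟩ := h₀
  refine lipReg_le_of hφ fun y hy => ?_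
  rcases le_or_gt y x₀ with hyx | hyx
  · have := le_lipReg (L := L) (x := x₀) hH hy
    rw [abs_of_nonneg (sub_nonneg.2 hyx)] at this
    rw [abs_of_nonneg (by linarith)]
    linarith
  · have hd : 0 < y - y₀ := by linarith
    set a := (y - x₀) / (y - y₀)
    set b := (x₀ - y₀) / (y - y₀)
    have ha : 0 < a := div_pos (by linarith) hd
    have hb : 0 < b := div_pos (by linarith) hd
    have hab : a + b = 1 := by simp only [a, b]; field_simp; ring
    have e : a * y₀ + b * y = x₀ := by simp only [a, b]; field_simp; ring
    have hm := (concaveOn_toReal hφ).1 hy₀ hy ha.le hb.le hab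
    have hc := (concaveOn_toReal hφ).2 hy₀ hy ha.le hb.le hab
    simp only [smul_eq_mul, e] at hm hc
    rw [← coe_toReal_of_mem hφ hm, EReal.coe_lt_coe_iff] at hφ₀
    have h1 : (φ y).toReal ≤ (φ x₀).toReal - L * (y - x₀) := by
      have e1 : x₀ - y₀ = b * (y - y₀) := by simp only [b]; field_simp
      have e2 : y - x₀ = a * (y - y₀) := by simp only [a]; field_simp
      rw [e1] at hφ₀
      rw [e2]
      have : b * (φ y).toReal ≤ b * ((φ x₀).toReal - L * (a * (y - y₀))) := by
        have := mul_lt_mul_of_pos_left hφ₀ ha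
        have e3 : a * (φ x₀).toReal = (φ x₀).toReal - b * (φ x₀).toReal := by
          linear_combination (φ x₀).toReal * hab
        linarith
      exact le_of_mul_le_mul_left this hb
    have h2 := le_lipReg_self (L := L) hH hm
    have h3 : (L : ℝ) * (x₁ - y) ≤ L * |x₁ - y| := by gcongr; exact le_abs_self _
    linarith

/-- Take `a` to be the infimum of the steep set: the linear decay starts at each of its points,
hence in the limit at `a`. For an empty set the claim is vacuous, whatever default value the infimum
has. -/
theorem exists_bound_on_steepRight (hφ : φ ∈ concaveClass)
    (hH : ∀ x ∈ effDom φ, (φ x).toReal ≤ H) (hL : 0 < L) :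
    ∃ a : ℝ, ∀ x ∈ steepRight L φ, lipReg L φ x ≤ H - L * |x - a| := by
  have hL' : (0 : ℝ) < L := hL
  have key : ∀ x₀ ∈ steepRight L φ, ∀ x, x₀ < x → lipReg L φ x ≤ H - L * (x - x₀) :=
    fun x₀ h₀ x hx => (lipReg_le_of_mem_steepRight hφ hH h₀ hx).trans
      (by linarith [lipReg_le (L := L) hφ hH x₀])
  refine ⟨sInf (steepRight L φ), fun x hx => ?_⟩
  have hbdd : BddBelow (steepRight L φ) := by
    -- A steep point far to the left of `x` would push the finite number `lipReg L φ x` below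
    -- itself; solving `key` for `x₀` gives this lower bound.
    refine ⟨min x (x - (H - lipReg L φ x) / L), fun x₀ h₀ => ?_⟩
    rcases le_or_gt x x₀ with h | h
    · exact (min_le_left _ _).trans h
    · refine (min_le_right _ _).trans ?_
      have := key x₀ h₀ x h
      rw [sub_le_comm, le_div_iff₀ hL']
      linarith
  have hax : sInf (steepRight L φ) ≤ x := csInf_le hbdd hx
  rw [abs_of_nonneg (sub_nonneg.2 hax)]
  rcases hax.eq_or_lt with h | h
  · rw [h]; simpa using lipReg_le hφ hH x
  · have hlim : ∀ t, sInf (steepRight L φ) < t → lipReg L φ x ≤ H - L * (x - t) := by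
      intro t ht
      obtain ⟨x₀, h₀, hx₀⟩ := exists_lt_of_csInf_lt ⟨x, hx⟩ (lt_min ht h)
      refine (key x₀ h₀ x (hx₀.trans_le (min_le_right _ _))).trans ?_
      have := (hx₀.trans_le (min_le_left _ _)).le
      gcongr
    have hc : Tendsto (fun t => H - L * (x - t)) (𝓝[>] sInf (steepRight L φ))
        (𝓝 (H - L * (x - sInf (steepRight L φ)))) := by
      have : Continuous fun t => H - L * (x - t) := by fun_prop
      exact this.continuousAt.tendsto.mono_left nhdsWithin_le_nhds
    exact ge_of_tendsto hc (eventually_nhdsWithin_of_forall hlim)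

theorem neg_mem_concaveClass (hφ : φ ∈ concaveClass) : (fun x => φ (-x)) ∈ concaveClass := by
  have := comp_affine_mem_concaveClass hφ (s := -1) (by norm_num) 0
  simpa using this

theorem lipReg_comp_neg (hφ : φ ∈ concaveClass) (hH : ∀ x ∈ effDom φ, (φ x).toReal ≤ H) (x : ℝ) :
    lipReg L (fun x => φ (-x)) x = lipReg L φ (-x) := by
  have e : ∀ x y : ℝ, |x - -y| = |-x - y| := fun x y => by rw [← abs_neg]; congr 1; ring
  refine le_antisymm (lipReg_le_of (neg_mem_concaveClass hφ) fun y hy => ?_)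
    (lipReg_le_of hφ fun y hy => ?_)
  · have := le_lipReg (L := L) (x := -x) (y := -y) hH hy
    rwa [← e, neg_neg] at this
  · have hH' : ∀ x ∈ effDom (fun x => φ (-x)), (φ (-x)).toReal ≤ H := fun x hx => hH _ hx
    have := le_lipReg (φ := fun x => φ (-x)) (L := L) (x := x) (y := -y) hH'
      (by simpa [effDom] using hy)
    rwa [e, neg_neg] at this

/-- At a point that is steep neither from the left nor from the right, no other point wins the
supremum and the majorant equals `φ`. On the two steep sets it decays linearly, which accounts for
the two exponential terms. -/
theorem exists_exp_lipReg_le (hφ : φ ∈ concaveClass) (hH : ∀ x ∈ effDom φ, (φ x).toReal ≤ H)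
    (hL : 0 < L) : ∃ a b : ℝ, ∀ x, Real.exp (lipReg L φ x) ≤
      expFun φ x + (Real.exp (H - L * |x - a|) + Real.exp (H - L * |x - b|)) := by
  obtain ⟨a, ha⟩ := exists_bound_on_steepRight hφ hH hL
  obtain ⟨b, hb⟩ := exists_bound_on_steepRight (φ := fun x => φ (-x)) (H := H)
    (neg_mem_concaveClass hφ) (fun x hx => hH _ hx) hL
  refine ⟨a, -b, fun x => ?_⟩
  have h0 := expFun_nonneg φ x
  have h1 := (Real.exp_pos (H - L * |x - a|)).le
  have h2 := (Real.exp_pos (H - L * |x - -b|)).le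
  by_cases hxa : x ∈ steepRight L φ
  · have := Real.exp_le_exp.2 (ha x hxa)
    linarith
  by_cases hxb : -x ∈ steepRight L (fun x => φ (-x))
  · have h := hb (-x) hxb
    rw [lipReg_comp_neg hφ hH, neg_neg, show |-x - b| = |x - -b| by rw [← abs_neg]; congr 1; ring]
      at h
    have := Real.exp_le_exp.2 h
    linarith
  have hle : ∀ y ∈ effDom φ, y ≠ x → (((φ y).toReal - L * |x - y| : ℝ) : EReal) ≤ φ x := by
    intro y hy hyx
    by_contra! hcon
    rcases lt_or_gt_of_ne hyx with h | h
    · rw [abs_of_pos (sub_pos.2 h)] at hcon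
      exact hxa ⟨y, hy, h, hcon⟩
    · refine hxb ⟨-y, by simpa [effDom] using hy, neg_lt_neg h, ?_⟩
      rw [abs_of_neg (sub_neg.2 h)] at hcon
      simp only [neg_neg]
      convert hcon using 3
      ring
  have hx : x ∈ effDom φ := by
    obtain ⟨y, hy⟩ := hφ.2.1
    by_cases hyx : y = x
    · exact hyx ▸ hy
    · exact ((EReal.bot_lt_coe _).trans_le (hle y hy hyx)).ne'
  have : lipReg L φ x ≤ (φ x).toReal := by
    refine lipReg_le_of hφ fun y hy => ?_
    by_cases hyx : y = x
    · simp [hyx]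
    · have := hle y hy hyx
      rwa [← coe_toReal_of_mem hφ hx, EReal.coe_le_coe_iff] at this
  rw [expFun_of_mem hφ hx]
  have := Real.exp_le_exp.2 this
  linarith

/-- Comparison with `(1 + x ^ 2)⁻¹`: the cube of `1 + x ^ 2` is at most `4 + 4 * x ^ 6`, and the
sixth term of the exponential series, with `6! = 720`, absorbs `x ^ 6`. The square of the quadratic
weight leaves room for fourth moments later. -/
theorem integrable_sq_one_add_sq_mul_exp {β : ℝ} (hβ : 0 < β) :
    Integrable fun x : ℝ => (1 + x ^ 2) ^ 2 * Real.exp (-β * |x|) := by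
  refine (integrable_inv_one_add_sq.const_mul (4 + 4 * (720 / β ^ 6))).mono'
    (by fun_prop) (Eventually.of_forall fun x => ?_)
  have h1 : (1 : ℝ) ≤ Real.exp (β * |x|) := Real.one_le_exp (by positivity)
  have h2 := Real.pow_div_factorial_le_exp (β * |x|) (by positivity) 6
  have h3 : x ^ 6 ≤ 720 / β ^ 6 * Real.exp (β * |x|) := by
    have e : (β * |x|) ^ 6 = β ^ 6 * x ^ 6 := by
      rw [mul_pow]; congr 1; exact Even.pow_abs (by decide) x
    rw [e] at h2
    rw [div_mul_eq_mul_div, le_div_iff₀ (by positivity)]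
    norm_num [Nat.factorial] at h2
    linarith
  rw [Real.norm_of_nonneg (by positivity), ← div_eq_mul_inv, le_div_iff₀ (by positivity),
    neg_mul, Real.exp_neg, mul_right_comm, ← div_eq_mul_inv, div_le_iff₀ (Real.exp_pos _)]
  have h4 : (1 + x ^ 2) ^ 2 * (1 + x ^ 2) ≤ 4 + 4 * x ^ 6 := by
    nlinarith [mul_nonneg (sq_nonneg (x ^ 2 - 1)) (add_nonneg zero_le_one (sq_nonneg x))]
  have h5 : (4 + 4 * (720 / β ^ 6)) * Real.exp (β * |x|) =
    4 * Real.exp (β * |x|) + 4 * (720 / β ^ 6 * Real.exp (β * |x|)) := by ring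
  linarith

theorem integrable_exp_neg_mul_abs {β : ℝ} (hβ : 0 < β) :
    Integrable fun x : ℝ => Real.exp (-β * |x|) := by
  refine (integrable_sq_one_add_sq_mul_exp hβ).mono' (by fun_prop)
    (Eventually.of_forall fun x => ?_)
  rw [Real.norm_of_nonneg (Real.exp_pos _).le]
  refine le_mul_of_one_le_left (Real.exp_pos _).le ?_
  nlinarith [sq_nonneg x, sq_nonneg (x ^ 2)]

/-- The integral of `exp (-|x|)`. -/
def expAbsConst : ℝ := ∫ x : ℝ, Real.exp (-1 * |x|)

theorem expAbsConst_nonneg : 0 ≤ expAbsConst := integral_nonneg fun _ => (Real.exp_pos _).le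

theorem lintegral_exp_sub_mul_abs (H a : ℝ) (hL : 0 < L) :
    ∫⁻ x : ℝ, ENNReal.ofReal (Real.exp (H - L * |x - a|)) =
      ENNReal.ofReal (Real.exp H * expAbsConst / L) := by
  have hL' : (0 : ℝ) < L := hL
  have e : ∀ x : ℝ, Real.exp (H - L * |x - a|) = Real.exp H * Real.exp (-L * |x - a|) := fun x => by
    rw [← Real.exp_add]; congr 1; ring
  have hi : Integrable fun x : ℝ => Real.exp (H - L * |x - a|) := by
    simp only [e]
    exact ((integrable_exp_neg_mul_abs hL').comp_sub_right a).const_mul _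
  rw [← ofReal_integral_eq_lintegral_ofReal hi (Eventually.of_forall fun x => (Real.exp_pos _).le)]
  congr 1
  simp only [e]
  rw [integral_const_mul, integral_sub_right_eq_self (fun x : ℝ => Real.exp (-L * |x|)) a]
  have := Measure.integral_comp_mul_left (fun x : ℝ => Real.exp (-1 * |x|)) (L : ℝ)
  simp only [abs_mul, NNReal.abs_eq, abs_inv, smul_eq_mul] at this
  rw [expAbsConst, mul_div_assoc, div_eq_inv_mul, ← this]
  congr 2
  ext x
  congr 1
  ring

theorem lintegral_exp_lipReg_le (hφ : φ ∈ concaveClass) (hH : ∀ x ∈ effDom φ, (φ x).toReal ≤ H)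
    (hL : 0 < L) : ∫⁻ x, ENNReal.ofReal (Real.exp (lipReg L φ x)) ≤
      (∫⁻ x, EReal.exp (φ x)) + ENNReal.ofReal (2 * (Real.exp H * expAbsConst / L)) := by
  obtain ⟨a, b, hab⟩ := exists_exp_lipReg_le hφ hH hL
  calc ∫⁻ x, ENNReal.ofReal (Real.exp (lipReg L φ x))
      ≤ ∫⁻ x, (EReal.exp (φ x) + (ENNReal.ofReal (Real.exp (H - L * |x - a|)) +
          ENNReal.ofReal (Real.exp (H - L * |x - b|)))) := by
        refine lintegral_mono fun x => ?_
        rw [← ofReal_expFun hφ, ← ENNReal.ofReal_add (Real.exp_pos _).le (Real.exp_pos _).le,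
          ← ENNReal.ofReal_add (expFun_nonneg φ x) (by positivity)]
        exact ENNReal.ofReal_le_ofReal (hab x)
    _ = _ := by
        have := expAbsConst_nonneg
        rw [lintegral_add_right _ (by fun_prop), lintegral_add_left (by fun_prop),
          lintegral_exp_sub_mul_abs _ _ hL, lintegral_exp_sub_mul_abs _ _ hL,
          ← ENNReal.ofReal_add (by positivity) (by positivity), two_mul]

end lipReg

/-! ### Wasserstein-type convergence and nondegeneracy. -/

/-- Convergence of probability measures with finite first moments, tested on Lipschitz
functions. -/
structure W1Conv (μ : ℕ → Measure ℝ) (μ₀ : Measure ℝ) : Prop where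
  prob : ∀ k, IsProbabilityMeasure (μ k)
  prob_lim : IsProbabilityMeasure μ₀
  integrable_id : ∀ k, Integrable (fun x : ℝ => x) (μ k)
  integrable_id_lim : Integrable (fun x : ℝ => x) μ₀
  tendsto : ∀ (K : ℝ≥0) (g : ℝ → ℝ), LipschitzWith K g →
    Tendsto (fun k => ∫ x, g x ∂μ k) atTop (𝓝 (∫ x, g x ∂μ₀))

theorem lipschitz_abs_le {g : ℝ → ℝ} {K : ℝ≥0} (hg : LipschitzWith K g) (x : ℝ) :
    |g x| ≤ |g 0| + K * |x| := by
  have := hg.dist_le_mul x 0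
  rw [Real.dist_eq, Real.dist_eq, sub_zero] at this
  have h2 := abs_sub_abs_le_abs_sub (g x) (g 0)
  linarith

theorem integrable_of_lipschitz {μ : Measure ℝ} [IsFiniteMeasure μ]
    (hμ : Integrable (fun x : ℝ => x) μ) {g : ℝ → ℝ} {K : ℝ≥0} (hg : LipschitzWith K g) :
    Integrable g μ :=
  ((integrable_const |g 0|).add (hμ.abs.const_mul (K : ℝ))).mono'
    hg.continuous.aestronglyMeasurable (Eventually.of_forall fun x => lipschitz_abs_le hg x)

theorem W1Conv.comp {μ : ℕ → Measure ℝ} {μ₀ : Measure ℝ} (h : W1Conv μ μ₀) {σ : ℕ → ℕ}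
    (hσ : Tendsto σ atTop atTop) : W1Conv (fun k => μ (σ k)) μ₀ :=
  ⟨fun _ => h.prob _, h.prob_lim, fun _ => h.integrable_id _, h.integrable_id_lim,
    fun K g hg => (h.tendsto K g hg).comp hσ⟩

theorem W1Conv.const {μ : Measure ℝ} [hp : IsProbabilityMeasure μ]
    (h : Integrable (fun x : ℝ => x) μ) : W1Conv (fun _ => μ) μ :=
  ⟨fun _ => hp, hp, fun _ => h, h, fun _ _ _ => tendsto_const_nhds⟩

theorem lipschitzWith_of_tendsto {g : ℕ → ℝ → ℝ} {χ : ℝ → ℝ} {K : ℝ≥0}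
    (hg : ∀ k, LipschitzWith K (g k)) (hlim : ∀ x, Tendsto (fun k => g k x) atTop (𝓝 (χ x))) :
    LipschitzWith K χ :=
  LipschitzWith.of_dist_le_mul fun x y =>
    le_of_tendsto ((hlim x).dist (hlim y)) (Eventually.of_forall fun k => (hg k).dist_le_mul x y)

/-- Joint convergence of equi-Lipschitz integrands and of measures. -/
theorem W1Conv.tendsto_integral {μ : ℕ → Measure ℝ} {μ₀ : Measure ℝ} (h : W1Conv μ μ₀)
    {g : ℕ → ℝ → ℝ} {χ : ℝ → ℝ} {K : ℝ≥0} (hg : ∀ k, LipschitzWith K (g k))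
    (hlim : ∀ x, Tendsto (fun k => g k x) atTop (𝓝 (χ x))) :
    Tendsto (fun k => ∫ x, g k x ∂μ k) atTop (𝓝 (∫ x, χ x ∂μ₀)) := by
  have := h.prob
  have := h.prob_lim
  have hχ := lipschitzWith_of_tendsto hg hlim
  obtain ⟨C, hC⟩ := ((hlim 0).sub_const (χ 0)).norm.bddAbove_range
  have hd : ∀ k, LipschitzWith (K + K) fun x => g k x - χ x := fun k => (hg k).sub hχ
  have hb : ∀ k x, |g k x - χ x| ≤ C + (K + K : ℝ≥0) * |x| := fun k x =>
    (lipschitz_abs_le (hd k) x).trans (by gcongr; exact hC ⟨k, rfl⟩)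
  -- The tail supremum is again Lipschitz and tends to zero pointwise. It dominates the error for
  -- every `k ≥ j`, so the varying integrand is replaced by one fixed test function.
  set D : ℕ → ℝ → ℝ := fun j x => ⨆ i, |g (j + i) x - χ x|
  have hbdd : ∀ j x, BddAbove (Set.range fun i => |g (j + i) x - χ x|) := fun j x =>
    ⟨_, by rintro _ ⟨i, rfl⟩; exact hb (j + i) x⟩
  have hle : ∀ j k x, j ≤ k → |g k x - χ x| ≤ D j x := fun j k x hjk => by
    obtain ⟨i, rfl⟩ := Nat.exists_eq_add_of_le hjk
    exact le_ciSup (hbdd j x) i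
  have hD0 : ∀ j x, 0 ≤ D j x := fun j x => (abs_nonneg _).trans (hle j j x le_rfl)
  have hDb : ∀ j x, D j x ≤ C + (K + K : ℝ≥0) * |x| := fun j x => ciSup_le fun i => hb _ _
  have hDL : ∀ j, LipschitzWith (K + K) (D j) := fun j =>
    LipschitzWith.of_le_add_mul _ fun x y => ciSup_le fun i => by
      have h1 := (hd (j + i)).dist_le_mul x y
      rw [Real.dist_eq] at h1
      have h2 := abs_sub_abs_le_abs_sub (g (j + i) x - χ x) (g (j + i) y - χ y)
      have h3 := le_ciSup (hbdd j y) i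
      linarith
  have hDlim : ∀ x, Tendsto (fun j => D j x) atTop (𝓝 0) := fun x => by
    rw [Metric.tendsto_atTop]
    intro ε hε
    obtain ⟨N, hN⟩ := (Metric.tendsto_atTop.1 (hlim x)) (ε / 2) (by positivity)
    refine ⟨N, fun j hj => ?_⟩
    rw [Real.dist_eq, sub_zero, abs_of_nonneg (hD0 j x)]
    have : D j x ≤ ε / 2 := ciSup_le fun i => (hN (j + i) (by omega)).le
    linarith
  have hint : Tendsto (fun j => ∫ x, D j x ∂μ₀) atTop (𝓝 0) := by
    have := tendsto_integral_of_dominated_convergence (μ := μ₀) (F := D) (f := fun _ => 0)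
      (fun x => C + (K + K : ℝ≥0) * |x|) (fun j => (hDL j).continuous.aestronglyMeasurable)
      ((integrable_const C).add (h.integrable_id_lim.abs.const_mul _))
      (fun j => Eventually.of_forall fun x => by
        rw [Real.norm_of_nonneg (hD0 j x)]; exact hDb j x)
      (Eventually.of_forall hDlim)
    simpa using this
  have hdiff : Tendsto (fun k => ∫ x, g k x ∂μ k - ∫ x, χ x ∂μ k) atTop (𝓝 0) := by
    rw [Metric.tendsto_atTop]
    intro ε hε
    obtain ⟨j, hj⟩ := (hint.eventually (gt_mem_nhds hε)).exists
    obtain ⟨N, hN⟩ := eventually_atTop.1 ((h.tendsto _ _ (hDL j)).eventually (gt_mem_nhds hj))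
    refine ⟨max N j, fun k hk => ?_⟩
    have hi1 := integrable_of_lipschitz (h.integrable_id k) (hg k)
    have hi2 := integrable_of_lipschitz (h.integrable_id k) hχ
    rw [Real.dist_eq, sub_zero, ← integral_sub hi1 hi2]
    calc |∫ x, (g k x - χ x) ∂μ k| ≤ ∫ x, |g k x - χ x| ∂μ k := abs_integral_le_integral_abs
      _ ≤ ∫ x, D j x ∂μ k := integral_mono (hi1.sub hi2).abs
          (integrable_of_lipschitz (h.integrable_id k) (hDL j))
          fun x => hle j k x ((le_max_right _ _).trans hk)
      _ < ε := hN k ((le_max_left _ _).trans hk)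
  simpa using hdiff.add (h.tendsto _ _ hχ)

/-- The measure is not concentrated at one point: it charges both sides of some point. -/
def Nondeg (μ : Measure ℝ) : Prop :=
  ∃ c : ℝ, 0 < ∫ x, max (x - c) 0 ∂μ ∧ 0 < ∫ x, max (c - x) 0 ∂μ

theorem lipschitzWith_posPart_sub (c : ℝ) : LipschitzWith 1 fun x : ℝ => max (x - c) 0 := by
  refine LipschitzWith.of_le_add_mul _ fun x y => ?_
  have := le_abs_self (x - y)
  simp only [NNReal.coe_one, one_mul, Real.dist_eq]
  refine max_le ?_ ?_
  · linarith [le_max_left (y - c) 0]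
  · linarith [le_max_right (y - c) 0, abs_nonneg (x - y)]

theorem lipschitzWith_posPart_sub' (c : ℝ) : LipschitzWith 1 fun x : ℝ => max (c - x) 0 := by
  refine LipschitzWith.of_le_add_mul _ fun x y => ?_
  have := neg_abs_le (x - y)
  simp only [NNReal.coe_one, one_mul, Real.dist_eq]
  refine max_le ?_ ?_
  · linarith [le_max_left (c - y) 0]
  · linarith [le_max_right (c - y) 0, abs_nonneg (x - y)]

theorem lipschitzWith_abs_sub (c : ℝ) : LipschitzWith 1 fun x : ℝ => |x - c| := by
  refine LipschitzWith.of_le_add_mul _ fun x y => ?_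
  simp only [NNReal.coe_one, one_mul, Real.dist_eq]
  rw [add_comm]
  exact abs_sub_le x y c

/-- Nondegeneracy is phrased through two hinge integrals precisely because hinges are Lipschitz,
which makes it an open condition. -/
theorem W1Conv.eventually_nondeg {μ : ℕ → Measure ℝ} {μ₀ : Measure ℝ} (h : W1Conv μ μ₀)
    (hN : Nondeg μ₀) : ∀ᶠ k in atTop, Nondeg (μ k) := by
  obtain ⟨c, h1, h2⟩ := hN
  filter_upwards [(h.tendsto _ _ (lipschitzWith_posPart_sub c)).eventually (lt_mem_nhds h1),
    (h.tendsto _ _ (lipschitzWith_posPart_sub' c)).eventually (lt_mem_nhds h2)] with k a b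
  exact ⟨c, a, b⟩

/-! ### Uniform tightness of log-densities with criterion bounded below. -/

/-- Uniform control of the position and the tails of a concave function. -/
structure Tight (B : ℝ) (φ : ℝ → EReal) : Prop where
  exists_mem : ∃ m ∈ effDom φ, |m| ≤ B ∧ -B ≤ (φ m).toReal
  le_envelope : ∀ x ∈ effDom φ, (φ x).toReal ≤ B - |x| / B

theorem integral_expFun_eq_one {φ : ℝ → EReal} (hφ : φ ∈ concaveClass)
    (h : ∫⁻ x, EReal.exp (φ x) = 1) : ∫ x, expFun φ x = 1 := by
  have := ofReal_integral_expFun hφ (by simp [h])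
  rw [h] at this
  exact ENNReal.ofReal_eq_one.1 this

/-- Let `H` be the supremum of `φ` and `m` a near-maximum point. Integrating the exponential
envelope gives `exp (H - 2) * ∫ |x - m| ≤ H + 1 + M`. The integral is at least `δ` by nondegeneracy,
so `H` is bounded above; its nonnegativity bounds `H` below; and the first moments then bound `|m|`.
-/
theorem W1Conv.exists_tight {μ : ℕ → Measure ℝ} {μ₀ : Measure ℝ} (h : W1Conv μ μ₀)
    (hN : Nondeg μ₀) {M : ℝ} (hM : 0 ≤ M) : ∃ B : ℝ, 0 < B ∧ ∀ᶠ k in atTop,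
      ∀ φ ∈ concaveClass, ∫⁻ x, EReal.exp (φ x) = 1 →
        ((-M : ℝ) : EReal) ≤ omega φ (μ k) → Tight B φ := by
  have := h.prob
  have := h.prob_lim
  obtain ⟨c, h1, h2⟩ := hN
  obtain ⟨δ, hδ, hδ'⟩ := exists_between (lt_min h1 h2)
  rw [lt_min_iff] at hδ'
  have hlim3 := h.tendsto _ _ (lipschitzWith_abs_sub 0)
  set A := (∫ x, |x - 0| ∂μ₀) + 1
  have hA : 0 ≤ A := add_nonneg (integral_nonneg fun _ => abs_nonneg _) zero_le_one
  set H₁ := 3 + 2 * (4 + M) / δ with hH₁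
  set E₀ := Real.exp (-3 - M)
  have hE₀ : 0 < E₀ := Real.exp_pos _
  set R := (H₁ + 1 + M) / E₀ + A
  have hH₁0 : 0 ≤ H₁ := by positivity
  have hR : 0 ≤ R := by positivity
  -- One constant serves all purposes: the summands cover the envelope height after recentring at
  -- zero, the position of `m`, the lower bound at `m`, and the slope `1 / B ≤ E₀`.
  set B := (H₁ + 2 + R * E₀) + R + (2 + M) + 1 / E₀ with hB
  have hRE : 0 ≤ R * E₀ := by positivity
  have hE₀' : 0 < 1 / E₀ := by positivity
  have hBpos : 0 < B := by linarith
  refine ⟨B, hBpos, ?_⟩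
  filter_upwards [(h.tendsto _ _ (lipschitzWith_posPart_sub c)).eventually (lt_mem_nhds hδ'.1),
    (h.tendsto _ _ (lipschitzWith_posPart_sub' c)).eventually (lt_mem_nhds hδ'.2),
    hlim3.eventually (gt_mem_nhds (lt_add_one _))] with k k1 k2 k3 φ hφ hφ1 hω
  have hreg : IsRegular φ (μ k) :=
    IsRegular.of_omega_ne_bot hφ ((EReal.bot_lt_coe _).trans_le hω).ne'
  rw [omega_eq_coe hφ hreg, EReal.coe_le_coe_iff, realOmega, integral_expFun_eq_one hφ hφ1] at hω
  obtain ⟨H₀, hH₀⟩ := exists_upper_bound hφ hreg.lintegral_ne_top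
  obtain ⟨p, hp⟩ := hφ.2.1
  have hne : ((fun x => (φ x).toReal) '' effDom φ).Nonempty := ⟨_, p, hp, rfl⟩
  have hbd : BddAbove ((fun x => (φ x).toReal) '' effDom φ) :=
    ⟨H₀, by rintro _ ⟨x, hx, rfl⟩; exact hH₀ x hx⟩
  set H := sSup ((fun x => (φ x).toReal) '' effDom φ)
  have hH : ∀ x ∈ effDom φ, (φ x).toReal ≤ H := fun x hx => le_csSup hbd ⟨x, hx, rfl⟩
  obtain ⟨_, ⟨m, hm, rfl⟩, hmH⟩ := exists_lt_of_lt_csSup hne (sub_one_lt H)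
  simp only at hmH
  have henv := fun x (hx : x ∈ effDom φ) => toReal_le_envelope hφ hφ1 hH hm hmH.le hx
  set E := Real.exp (H - 2)
  have hE : 0 < E := Real.exp_pos _
  have hLint : ∀ {g : ℝ → ℝ} {K : ℝ≥0}, LipschitzWith K g → Integrable g (μ k) := fun hg =>
    integrable_of_lipschitz (h.integrable_id k) hg
  have hi := hLint (lipschitzWith_abs_sub m)
  have hu : ∫ x, (φ x).toReal ∂μ k ≤ H + 2 - E * ∫ x, |x - m| ∂μ k := by
    have e : ∫ x, (H + 2 - |x - m| * E) ∂μ k = H + 2 - E * ∫ x, |x - m| ∂μ k := by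
      rw [integral_sub (integrable_const _) (hi.mul_const E), integral_mul_const]
      simp [mul_comm]
    rw [← e]
    refine integral_mono_ae hreg.integrable ((integrable_const _).sub (hi.mul_const E)) ?_
    filter_upwards [hreg.ae_ne_bot] with x hx using henv x hx
  set T := ∫ x, |x - m| ∂μ k
  -- Whichever side of `c` the point `m` lies on, the hinge on the opposite side is below `|x - m|`.
  have hT : δ ≤ T := by
    rcases le_total c m with hcm | hcm
    · refine k2.le.trans (integral_mono (hLint (lipschitzWith_posPart_sub' c)) hi fun x => ?_)
      simp only
      refine max_le ?_ (abs_nonneg _)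
      rw [abs_sub_comm]; linarith [le_abs_self (m - x)]
    · refine k1.le.trans (integral_mono (hLint (lipschitzWith_posPart_sub c)) hi fun x => ?_)
      simp only
      refine max_le ?_ (abs_nonneg _)
      linarith [le_abs_self (x - m)]
  have hET : E * T ≤ H + 1 + M := by linarith
  have hHlow : -1 - M ≤ H := by
    have : 0 ≤ E * T := by positivity
    linarith
  have hHup : H ≤ H₁ := by
    by_contra! hcon
    set s := H - 2
    have hs : 1 + 2 * (4 + M) / δ < s := by simp only [s]; linarith
    have hs0 : 0 ≤ 2 * (4 + M) / δ := by positivity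
    have hs1 : 1 < s := by linarith
    have hq := Real.quadratic_le_exp_of_nonneg (x := s) (by linarith)
    have k4 : δ * (s ^ 2 / 2) ≤ s + (3 + M) := by
      have a1 : E * δ ≤ E * T := by gcongr
      have a2 : (s ^ 2 / 2) * δ ≤ E * δ := by gcongr; simp only [E]; linarith
      simp only [s] at *
      linarith
    have k5 : 2 * (4 + M) / δ < s := by linarith
    rw [div_lt_iff₀ hδ] at k5
    nlinarith
  have hEE : E₀ ≤ E := Real.exp_le_exp.2 (by linarith)
  have hTup : T ≤ (H₁ + 1 + M) / E₀ := by
    rw [le_div_iff₀ hE₀]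
    have : E₀ * T ≤ E * T := by gcongr
    linarith
  have hmR : |m| ≤ R := by
    have h0 := hLint (lipschitzWith_abs_sub 0)
    have : |m| ≤ T + ∫ x, |x - 0| ∂μ k := by
      rw [← integral_add hi h0]
      have e : |m| = ∫ _, |m| ∂μ k := by simp
      rw [e]
      refine integral_mono (integrable_const _) (hi.add h0) fun x => ?_
      simp only
      rw [abs_sub_comm x m, sub_zero]
      have := abs_sub_abs_le_abs_sub m x
      linarith
    linarith
  refine ⟨⟨m, hm, by linarith, by linarith⟩, fun x hx => ?_⟩
  have h5 := henv x hx
  have h6 : |x - m| * E₀ ≤ |x - m| * E := by gcongr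
  have h7 : |x| * E₀ ≤ (|x - m| + |m|) * E₀ := by
    gcongr
    simpa using abs_sub_le x m 0
  have h8 : |m| * E₀ ≤ R * E₀ := by gcongr
  have h9 : |x| / B ≤ |x| * E₀ := by
    rw [div_le_iff₀ hBpos, mul_assoc]
    have : 1 ≤ E₀ * B := by
      have : E₀ * (1 / E₀) ≤ E₀ * B := by gcongr; linarith
      rwa [mul_one_div_cancel hE₀.ne'] at this
    nlinarith [abs_nonneg x]
  linarith

/-! ### Compactness and upper semicontinuity of the criterion. -/

theorem exists_tendsto_of_lipschitz {g : ℕ → ℝ → ℝ} {K : ℝ≥0} (hg : ∀ k, LipschitzWith K (g k))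
    (h : ∀ q : ℚ, ∃ l, Tendsto (fun k => g k q) atTop (𝓝 l)) (x : ℝ) :
    ∃ l, Tendsto (fun k => g k x) atTop (𝓝 l) := by
  refine cauchySeq_tendsto_of_complete (Metric.cauchySeq_iff.2 fun ε hε => ?_)
  obtain ⟨q, hq1, hq2⟩ := exists_rat_btwn (show x < x + ε / (4 * (K + 1)) by
    have : 0 < ε / (4 * (K + 1)) := by positivity
    linarith)
  have hxq : K * dist x q ≤ ε / 4 := by
    rw [Real.dist_eq, abs_sub_comm, abs_of_pos (sub_pos.2 hq1)]
    have : (q : ℝ) - x ≤ ε / (4 * (K + 1)) := by linarith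
    calc K * ((q : ℝ) - x) ≤ (K + 1) * (ε / (4 * (K + 1))) := by (gcongr; linarith)
      _ = ε / 4 := by field_simp
  obtain ⟨l, hl⟩ := h q
  obtain ⟨N, hN⟩ := Metric.cauchySeq_iff.1 hl.cauchySeq (ε / 4) (by positivity)
  refine ⟨N, fun m hm n hn => ?_⟩
  have h1 := (hg m).dist_le_mul x q
  have h2 := (hg n).dist_le_mul x q
  rw [dist_comm] at h2
  have h3 := hN m hm n hn
  have := dist_triangle4 (g m x) (g m q) (g n q) (g n x)
  linarith

theorem abs_lipReg_bounds {φ : ℝ → EReal} {B : ℝ} (hB : 0 < B) (hφ : φ ∈ concaveClass)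
    (hT : Tight B φ) (L : ℝ≥0) (x : ℝ) :
    lipReg L φ x ∈ Set.Icc (-B - L * (|x| + B)) B := by
  have hH : ∀ x ∈ effDom φ, (φ x).toReal ≤ B := fun x hx => by
    have := hT.le_envelope x hx
    have : 0 ≤ |x| / B := by positivity
    linarith
  refine ⟨?_, lipReg_le hφ hH x⟩
  obtain ⟨m, hm, hmB, hum⟩ := hT.exists_mem
  have h1 := le_lipReg (L := L) (x := x) hH hm
  have h2 : (L : ℝ) * |x - m| ≤ L * (|x| + B) := by
    gcongr
    exact (abs_sub _ _).trans (by gcongr)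
  linarith

theorem Tight.toReal_le {φ : ℝ → EReal} {B : ℝ} (hB : 0 < B) (hT : Tight B φ) :
    ∀ x ∈ effDom φ, (φ x).toReal ≤ B := fun x hx => by
  have := hT.le_envelope x hx
  have : 0 ≤ |x| / B := by positivity
  linarith

/-- The infimum of a decreasing sequence of concave Lipschitz functions with integrals bounded
below belongs to the class, and its criterion is controlled. -/
theorem iInf_lipschitz_mem {μ : Measure ℝ} [IsProbabilityMeasure μ]
    (hμ : Integrable (fun x : ℝ => x) μ) {χ : ℕ → ℝ → ℝ} {K : ℕ → ℝ≥0}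
    (hL : ∀ n, LipschitzWith (K n) (χ n)) (hcon : ∀ n, ConcaveOn ℝ Set.univ (χ n))
    (hanti : ∀ x, Antitone fun n => χ n x) {c : ℝ} (hc : ∀ n, c ≤ ∫ x, χ n x ∂μ)
    (hexp : ∀ δ > 0, ∃ n, ∫⁻ x, ENNReal.ofReal (Real.exp (χ n x)) ≤ ENNReal.ofReal (1 + δ)) :
    ∃ φ ∈ concaveClass, ((c - 1 : ℝ) : EReal) ≤ omega φ μ := by
  have hi : ∀ n, Integrable (χ n) μ := fun n => integrable_of_lipschitz hμ (hL n)
  set φ : ℝ → EReal := fun x => ⨅ n, (χ n x : EReal) with hφdef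
  have hle : ∀ n x, φ x ≤ χ n x := fun n x => iInf_le _ n
  set f : ℕ → ℝ → ℝ≥0∞ := fun n x => ENNReal.ofReal (χ 0 x - χ n x)
  have hfm : ∀ n, Measurable (f n) := fun n =>
    ((hL 0).continuous.measurable.sub (hL n).continuous.measurable).ennreal_ofReal
  have hS : ∫⁻ x, ⨆ n, f n x ∂μ ≤ ENNReal.ofReal (∫ x, χ 0 x ∂μ - c) := by
    rw [lintegral_iSup hfm fun n m hnm x => ENNReal.ofReal_le_ofReal
      (sub_le_sub_left (hanti x hnm) _)]
    refine iSup_le fun n => ?_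
    change ∫⁻ x, ENNReal.ofReal ((χ 0 - χ n) x) ∂μ ≤ _
    rw [← ofReal_integral_eq_lintegral_ofReal ((hi 0).sub (hi n))
      (Eventually.of_forall fun x => sub_nonneg.2 (hanti x (Nat.zero_le n)))]
    refine ENNReal.ofReal_le_ofReal ?_
    have := integral_sub (hi 0) (hi n)
    simp only [Pi.sub_apply] at this ⊢
    rw [this]
    linarith [hc n]
  have hSm : Measurable fun x => ⨆ n, f n x := Measurable.iSup hfm
  have hSfin : ∫⁻ x, ⨆ n, f n x ∂μ ≠ ⊤ := (hS.trans_lt ENNReal.ofReal_lt_top).ne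
  -- Monotone convergence keeps the total drop below `χ 0` integrable. Hence the infimum is finite
  -- almost everywhere, which gives both properness and integrability.
  have hlow : ∀ᵐ x ∂μ, ((χ 0 x - (⨆ n, f n x).toReal : ℝ) : EReal) ≤ φ x := by
    filter_upwards [ae_lt_top hSm hSfin] with x hx
    refine le_iInf fun n => EReal.coe_le_coe_iff.2 ?_
    have h1 : f n x ≤ ⨆ n, f n x := le_iSup (fun n => f n x) n
    have h2 : χ 0 x - χ n x ≤ (f n x).toReal := by
      simp only [f, ENNReal.toReal_ofReal']
      exact le_max_left _ _
    have h3 := ENNReal.toReal_mono hx.ne h1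
    linarith
  have hae : ∀ᵐ x ∂μ, φ x ≠ ⊥ := by
    filter_upwards [hlow] with x hx using ((EReal.bot_lt_coe _).trans_le hx).ne'
  have htop : ∀ x, φ x ≠ ⊤ := fun x => ((hle 0 x).trans_lt (EReal.coe_lt_top _)).ne
  have hφ : φ ∈ concaveClass := by
    refine ⟨htop, hae.exists, upperSemicontinuous_iInf fun n =>
      (continuous_coe_real_ereal.comp (hL n).continuous).upperSemicontinuous,
      fun x y a b ha hb hab => le_iInf fun n => ?_⟩
    have h1 := (hcon n).2 (Set.mem_univ x) (Set.mem_univ y) ha.le hb.le hab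
    calc (a : EReal) * φ x + b * φ y ≤ a * (χ n x : EReal) + b * (χ n y : EReal) :=
          add_le_add (mul_le_mul_of_nonneg_left (hle n x) (by exact_mod_cast ha.le))
            (mul_le_mul_of_nonneg_left (hle n y) (by exact_mod_cast hb.le))
      _ ≤ _ := by exact_mod_cast h1
  have hSi : Integrable (fun x => (⨆ n, f n x).toReal) μ :=
    integrable_toReal_of_lintegral_ne_top hSm.aemeasurable hSfin
  have hbounds : ∀ᵐ x ∂μ, 0 ≤ χ 0 x - (φ x).toReal ∧
      χ 0 x - (φ x).toReal ≤ (⨆ n, f n x).toReal := by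
    filter_upwards [hlow, hae] with x h1 h2
    have h3 := hle 0 x
    rw [← EReal.coe_toReal (htop x) h2, EReal.coe_le_coe_iff] at h1 h3
    constructor <;> linarith
  have hdi : Integrable (fun x => χ 0 x - (φ x).toReal) μ := by
    refine hSi.mono' ((hL 0).continuous.measurable.sub
      (measurable_of_mem hφ).ereal_toReal).aestronglyMeasurable ?_
    filter_upwards [hbounds] with x hx
    rw [Real.norm_of_nonneg hx.1]
    exact hx.2
  have hui : Integrable (fun x => (φ x).toReal) μ :=
    ((hi 0).sub hdi).congr (Eventually.of_forall fun x => by simp)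
  have hexp1 : ∫⁻ x, EReal.exp (φ x) ≤ 1 := by
    refine ENNReal.le_of_forall_pos_le_add fun δ hδ _ => ?_
    obtain ⟨n, hn⟩ := hexp δ (by exact_mod_cast hδ)
    refine le_trans (lintegral_mono fun x => ?_) (hn.trans ?_)
    · rw [← EReal.exp_coe]
      exact EReal.exp_monotone (hle n x)
    · rw [ENNReal.ofReal_add zero_le_one δ.coe_nonneg]; simp
  have hreg : IsRegular φ μ := ⟨hae, hui, (hexp1.trans_lt ENNReal.one_lt_top).ne⟩
  refine ⟨φ, hφ, ?_⟩
  rw [omega_eq_coe hφ hreg, EReal.coe_le_coe_iff, realOmega]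
  have h1 : ∫ x, expFun φ x ≤ 1 := by
    rw [← ofReal_integral_expFun hφ hreg.lintegral_ne_top] at hexp1
    exact ENNReal.ofReal_le_one.1 hexp1
  have h2 : ∫ x, (χ 0 x - (φ x).toReal) ∂μ ≤ ∫ x, χ 0 x ∂μ - c := by
    calc ∫ x, (χ 0 x - (φ x).toReal) ∂μ ≤ ∫ x, (⨆ n, f n x).toReal ∂μ :=
          integral_mono_ae hdi hSi (hbounds.mono fun x hx => hx.2)
      _ = (∫⁻ x, ⨆ n, f n x ∂μ).toReal :=
          integral_toReal hSm.aemeasurable (ae_lt_top hSm hSfin)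
      _ ≤ _ := ENNReal.toReal_le_of_le_ofReal (sub_nonneg.2 (hc 0)) hS
  rw [integral_sub (hi 0) hui] at h2
  linarith

/-- Fatou's lemma applied to the uniform mass bound for Lipschitz majorants of slope `n + 1`. -/
theorem lintegral_exp_le_of_tendsto_lipReg {φ : ℕ → ℝ → EReal} {B : ℝ}
    (hφ : ∀ k, φ k ∈ concaveClass) (h1 : ∀ k, ∫⁻ x, EReal.exp (φ k x) = 1)
    (hH : ∀ k, ∀ x ∈ effDom (φ k), (φ k x).toReal ≤ B) (n : ℕ) {χ : ℝ → ℝ}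
    (hχ : ∀ x, Tendsto (fun k => lipReg (n + 1 : ℝ≥0) (φ k) x) atTop (𝓝 (χ x))) :
    ∫⁻ x, ENNReal.ofReal (Real.exp (χ x)) ≤
      ENNReal.ofReal (1 + 2 * (Real.exp B * expAbsConst) * (1 / ((n : ℝ) + 1))) := by
  have hlim : ∀ x, Tendsto (fun k => ENNReal.ofReal (Real.exp (lipReg (n + 1 : ℝ≥0) (φ k) x))) atTop
      (𝓝 (ENNReal.ofReal (Real.exp (χ x)))) := fun x =>
    (ENNReal.continuous_ofReal.comp Real.continuous_exp).continuousAt.tendsto.comp (hχ x)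
  have hle : ∀ k, ∫⁻ x, ENNReal.ofReal (Real.exp (lipReg (n + 1 : ℝ≥0) (φ k) x)) ≤
      ENNReal.ofReal (1 + 2 * (Real.exp B * expAbsConst) * (1 / ((n : ℝ) + 1))) := by
    intro k
    have h3 := expAbsConst_nonneg
    refine (lintegral_exp_lipReg_le (hφ _) (hH _) (by positivity)).trans ?_
    rw [h1, ENNReal.ofReal_add zero_le_one (by positivity), ENNReal.ofReal_one]
    refine add_le_add le_rfl (ENNReal.ofReal_le_ofReal (le_of_eq ?_))
    push_cast
    ring
  calc ∫⁻ x, ENNReal.ofReal (Real.exp (χ x))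
      = ∫⁻ x, liminf (fun k => ENNReal.ofReal (Real.exp (lipReg (n + 1 : ℝ≥0) (φ k) x))) atTop :=
        lintegral_congr fun x => (hlim x).liminf_eq.symm
    _ ≤ liminf (fun k => ∫⁻ x, ENNReal.ofReal (Real.exp (lipReg (n + 1 : ℝ≥0) (φ k) x))) atTop :=
        lintegral_liminf_le fun k => (Real.continuous_exp.comp
          (lipschitzWith_lipReg (hφ k) (hH k)).continuous).measurable.ennreal_ofReal
    _ ≤ liminf (fun _ : ℕ =>
          ENNReal.ofReal (1 + 2 * (Real.exp B * expAbsConst) * (1 / ((n : ℝ) + 1)))) atTop :=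
        liminf_le_liminf (Eventually.of_forall hle)
    _ = _ := liminf_const _

/-- Upper semicontinuity of the maximal criterion along tight sequences. -/
theorem W1Conv.exists_omega_ge {μ : ℕ → Measure ℝ} {μ₀ : Measure ℝ} (h : W1Conv μ μ₀)
    {φ : ℕ → ℝ → EReal} {B : ℝ} (hB : 0 < B) (hφ : ∀ k, φ k ∈ concaveClass)
    (h1 : ∀ k, ∫⁻ x, EReal.exp (φ k x) = 1) (hT : ∀ k, Tight B (φ k)) {c : ℕ → ℝ} {c₀ : ℝ}
    (hc : Tendsto c atTop (𝓝 c₀)) (hω : ∀ k, (c k : EReal) ≤ omega (φ k) (μ k)) :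
    ∃ φ₀ ∈ concaveClass, (c₀ : EReal) ≤ omega φ₀ μ₀ := by
  have := h.prob
  have := h.prob_lim
  have hH := fun k => (hT k).toReal_le hB
  set G : ℕ → ℕ → ℝ → ℝ := fun n k => lipReg (n + 1 : ℝ≥0) (φ k)
  have hGL : ∀ n k : ℕ, LipschitzWith (n + 1) (G n k) := fun n k =>
    lipschitzWith_lipReg (hφ k) (hH k)
  -- Tychonoff over the countable set of pairs (slope, rational point) replaces a diagonal argument:
  -- one subsequence works for all slopes at once, and equi-Lipschitz continuity extends convergence
  -- from the rationals to the line.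
  have hcomp : IsCompact (Set.pi Set.univ fun p : ℕ × ℚ =>
      Set.Icc (-B - ((p.1 + 1 : ℝ≥0) : ℝ) * (|(p.2 : ℝ)| + B)) B) :=
    isCompact_univ_pi fun p => isCompact_Icc
  have hmem : ∀ k, (fun p : ℕ × ℚ => G p.1 k (p.2 : ℝ)) ∈ Set.pi Set.univ fun p : ℕ × ℚ =>
      Set.Icc (-B - ((p.1 + 1 : ℝ≥0) : ℝ) * (|(p.2 : ℝ)| + B)) B := fun k =>
    Set.mem_univ_pi.2 fun p => abs_lipReg_bounds hB (hφ k) (hT k) (p.1 + 1 : ℝ≥0) p.2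
  obtain ⟨a, -, σ, hσ, ha⟩ := hcomp.tendsto_subseq hmem
  rw [tendsto_pi_nhds] at ha
  have hex : ∀ n x, ∃ l, Tendsto (fun k => G n (σ k) x) atTop (𝓝 l) := fun n x =>
    exists_tendsto_of_lipschitz (fun k => hGL n (σ k)) (fun q => ⟨_, ha (n, q)⟩) x
  choose χ hχ using hex
  -- The added `1` is the mass of `exp (φ k)`; it is subtracted again because the limit has mass at
  -- most one.
  have hc' : ∀ n, c₀ + 1 ≤ ∫ x, χ n x ∂μ₀ := by
    intro n
    refine le_of_tendsto_of_tendsto' ((hc.comp hσ.tendsto_atTop).add_const 1)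
      ((h.comp hσ.tendsto_atTop).tendsto_integral (fun k => hGL n (σ k)) (hχ n)) fun k => ?_
    have hk := hω (σ k)
    have hreg : IsRegular (φ (σ k)) (μ (σ k)) :=
      IsRegular.of_omega_ne_bot (hφ _) ((EReal.bot_lt_coe _).trans_le hk).ne'
    rw [omega_eq_coe (hφ _) hreg, EReal.coe_le_coe_iff, realOmega,
      integral_expFun_eq_one (hφ _) (h1 _)] at hk
    have : ∫ x, (φ (σ k) x).toReal ∂μ (σ k) ≤ ∫ x, G n (σ k) x ∂μ (σ k) := by
      refine integral_mono_ae hreg.integrable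
        (integrable_of_lipschitz (h.integrable_id _) (hGL n _)) ?_
      filter_upwards [hreg.ae_ne_bot] with x hx using le_lipReg_self (hH _) hx
    simp only [Function.comp]
    linarith
  have hexp : ∀ n, ∫⁻ x, ENNReal.ofReal (Real.exp (χ n x)) ≤
      ENNReal.ofReal (1 + 2 * (Real.exp B * expAbsConst) * (1 / ((n : ℝ) + 1))) := fun n =>
    lintegral_exp_le_of_tendsto_lipReg (fun k => hφ (σ k)) (fun k => h1 (σ k))
      (fun k => hH (σ k)) n (hχ n)
  have hcon : ∀ n, ConcaveOn ℝ Set.univ (χ n) := fun n =>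
    ⟨convex_univ, fun x _ y _ a b ha hb hab =>
      le_of_tendsto_of_tendsto' (((hχ n x).const_mul a).add ((hχ n y).const_mul b)) (hχ n _)
        fun k => (concaveOn_lipReg (hφ _) (hH _)).2 (Set.mem_univ x) (Set.mem_univ y) ha hb hab⟩
  have hanti : ∀ x, Antitone fun n => χ n x := fun x n m hnm =>
    le_of_tendsto_of_tendsto' (hχ m x) (hχ n x) fun k =>
      lipReg_anti (hφ _) (hH _) (by gcongr) x
  have hδ : ∀ δ > 0, ∃ n, ∫⁻ x, ENNReal.ofReal (Real.exp (χ n x)) ≤ ENNReal.ofReal (1 + δ) := by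
    intro δ hδ
    have ht := (tendsto_one_div_add_atTop_nhds_zero_nat (𝕜 := ℝ)).const_mul
      (2 * (Real.exp B * expAbsConst))
    rw [mul_zero] at ht
    obtain ⟨n, hn⟩ := (ht.eventually (gt_mem_nhds hδ)).exists
    exact ⟨n, (hexp n).trans (ENNReal.ofReal_le_ofReal (by linarith))⟩
  obtain ⟨φ₀, hφ₀, hle⟩ := iInf_lipschitz_mem (μ := μ₀) h.integrable_id_lim (χ := χ)
    (fun n => lipschitzWith_of_tendsto (fun k => hGL n (σ k)) (hχ n)) hcon hanti hc' hδ
  exact ⟨φ₀, hφ₀, by simpa only [add_sub_cancel_right] using hle⟩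

/-! ### Normalization and existence of projections. -/

/-- `φ` maximizes the criterion over the class, that is, `exp φ` is the log-concave projection
of `μ`. -/
def IsProj (φ : ℝ → EReal) (μ : Measure ℝ) : Prop :=
  φ ∈ concaveClass ∧ ∀ ψ ∈ concaveClass, omega ψ μ ≤ omega φ μ

theorem exists_lt_mem_effDom {φ : ℝ → EReal} {μ : Measure ℝ} [IsProbabilityMeasure μ]
    (hN : Nondeg μ) (h : ∀ᵐ x ∂μ, φ x ≠ ⊥) : ∃ p ∈ effDom φ, ∃ q ∈ effDom φ, p < q := by
  by_contra! hcon
  obtain ⟨p, hp⟩ := h.exists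
  have hsub : ∀ x ∈ effDom φ, x = p := fun x hx => le_antisymm (hcon p hp x hx) (hcon x hx p hp)
  obtain ⟨c, h1, h2⟩ := hN
  have hae : ∀ᵐ x ∂μ, x = p := h.mono fun x hx => hsub x hx
  rw [integral_congr_ae (g := fun _ => max (p - c) 0) (hae.mono fun x hx => by simp [hx])] at h1
  rw [integral_congr_ae (g := fun _ => max (c - p) 0) (hae.mono fun x hx => by simp [hx])] at h2
  simp only [integral_const, probReal_univ, one_smul, lt_max_iff, lt_self_iff_false, or_false]
    at h1 h2
  linarith

theorem effDom_add_coe (φ : ℝ → EReal) (r : ℝ → ℝ) :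
    effDom (fun x => φ x + (r x : EReal)) = effDom φ := by
  rw [effDom_add]
  simp [effDom]

theorem toReal_add_coe {φ : ℝ → EReal} (hφ : φ ∈ concaveClass) {x : ℝ} (hx : x ∈ effDom φ)
    (r : ℝ) : (φ x + (r : EReal)).toReal = (φ x).toReal + r := by
  rw [← coe_toReal_of_mem hφ hx, ← EReal.coe_add, EReal.toReal_coe, EReal.toReal_coe]

theorem add_coe_mem_concaveClass {φ : ℝ → EReal} (hφ : φ ∈ concaveClass) {r : ℝ → ℝ}
    (hr : Continuous r) (hc : ConcaveOn ℝ Set.univ r) :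
    (fun x => φ x + (r x : EReal)) ∈ concaveClass := by
  refine add_mem_concaveClass hφ (coe_mem_concaveClass hr hc) ?_
  rw [← effDom_add, effDom_add_coe]
  exact hφ.2.1

/-- Replacing a member of the class by the corresponding log-density increases the criterion,
strictly unless it is a log-density already. -/
theorem exists_normalized {φ : ℝ → EReal} (hφ : φ ∈ concaveClass) {μ : Measure ℝ}
    [IsProbabilityMeasure μ] (hN : Nondeg μ) (hω : omega φ μ ≠ ⊥) :
    ∃ ψ ∈ concaveClass, ∫⁻ x, EReal.exp (ψ x) = 1 ∧ omega ψ μ ≠ ⊥ ∧ omega φ μ ≤ omega ψ μ ∧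
      (omega ψ μ ≤ omega φ μ → ∫⁻ x, EReal.exp (φ x) = 1) := by
  have hreg := IsRegular.of_omega_ne_bot hφ hω
  obtain ⟨p, hp, q, hq, hpq⟩ := exists_lt_mem_effDom hN hreg.ae_ne_bot
  have hpos := lintegral_exp_pos hφ hp hq hpq
  have hI := ofReal_integral_expFun hφ hreg.lintegral_ne_top
  set I := ∫ x, expFun φ x
  have hI0 : 0 < I := by
    rw [← hI] at hpos
    simpa using hpos
  -- Subtracting `log I` changes the criterion by `I - 1 - log I`, which is nonnegative and vanishes
  -- only at `I = 1`.
  set ψ : ℝ → EReal := fun x => φ x + ((-Real.log I : ℝ) : EReal)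
  have hψ : ψ ∈ concaveClass :=
    add_coe_mem_concaveClass hφ continuous_const (concaveOn_const _ convex_univ)
  have hψ1 : ∫⁻ x, EReal.exp (ψ x) = 1 := by
    simp only [ψ, EReal.exp_add, EReal.exp_coe]
    rw [lintegral_mul_const' _ _ ENNReal.ofReal_ne_top, ← hI, ← ENNReal.ofReal_mul hI0.le,
      Real.exp_neg, Real.exp_log hI0, mul_inv_cancel₀ hI0.ne', ENNReal.ofReal_one]
  have hae : (fun x => (φ x).toReal + -Real.log I) =ᵐ[μ] fun x => (ψ x).toReal := by
    filter_upwards [hreg.ae_ne_bot] with x hx using (toReal_add_coe hφ hx _).symm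
  have hregψ : IsRegular ψ μ := by
    refine ⟨?_, (hreg.integrable.add (integrable_const _)).congr hae, by simp [hψ1]⟩
    filter_upwards [hreg.ae_ne_bot] with x hx
    have : x ∈ effDom ψ := by rw [effDom_add_coe]; exact hx
    exact this
  have hreal : realOmega ψ μ = ∫ x, (φ x).toReal ∂μ - Real.log I - 1 := by
    rw [realOmega, integral_expFun_eq_one hψ hψ1, ← integral_congr_ae hae,
      integral_add hreg.integrable (integrable_const _)]
    simp [sub_eq_add_neg]
  refine ⟨ψ, hψ, hψ1, ?_, ?_, ?_⟩
  · rw [omega_eq_coe hψ hregψ]; exact EReal.coe_ne_bot _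
  · rw [omega_eq_coe hψ hregψ, omega_eq_coe hφ hreg, EReal.coe_le_coe_iff, hreal, realOmega]
    have := Real.log_le_sub_one_of_pos hI0
    linarith
  · rw [omega_eq_coe hψ hregψ, omega_eq_coe hφ hreg, EReal.coe_le_coe_iff, hreal, realOmega]
    intro hle
    by_contra hne
    have hI1 : I ≠ 1 := fun h => hne (by rw [← hI, h, ENNReal.ofReal_one])
    have := Real.log_lt_sub_one_of_pos hI0 hI1
    linarith

theorem concaveOn_neg_abs_sub (c : ℝ) : ConcaveOn ℝ Set.univ fun x : ℝ => -|x - c| := by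
  refine ⟨convex_univ, fun x _ y _ a b ha hb hab => ?_⟩
  simp only [smul_eq_mul]
  have e : a * x + b * y - c = a * (x - c) + b * (y - c) := by linear_combination c * hab
  rw [e]
  have := abs_add_le (a * (x - c)) (b * (y - c))
  rw [abs_mul, abs_mul, abs_of_nonneg ha, abs_of_nonneg hb] at this
  linarith

theorem exists_omega_ne_bot {μ : Measure ℝ} [IsProbabilityMeasure μ]
    (hμ : Integrable (fun x : ℝ => x) μ) : ∃ φ ∈ concaveClass, omega φ μ ≠ ⊥ := by
  have hmem := coe_mem_concaveClass (g := fun x : ℝ => -|x - 0|) (by fun_prop)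
    (concaveOn_neg_abs_sub 0)
  refine ⟨_, hmem, ?_⟩
  have hreg : IsRegular (fun x : ℝ => ((-|x - 0| : ℝ) : EReal)) μ := by
    refine ⟨Eventually.of_forall fun x => EReal.coe_ne_bot _, ?_, ?_⟩
    · simp only [EReal.toReal_coe, sub_zero]
      exact hμ.abs.neg
    · simp only [EReal.exp_coe, sub_zero]
      simpa only [neg_mul, one_mul] using
        (integrable_exp_neg_mul_abs (β := 1) one_pos).lintegral_lt_top.ne
  rw [omega_eq_coe hmem hreg]
  exact EReal.coe_ne_bot _

/-- Existence of the log-concave projection. -/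
theorem exists_isProj {μ : Measure ℝ} [IsProbabilityMeasure μ]
    (hμ : Integrable (fun x : ℝ => x) μ) (hN : Nondeg μ) : ∃ φ, IsProj φ μ := by
  -- Only log-densities need to compete. A maximizing sequence of them is tight, and upper
  -- semicontinuity along the constant sequence of measures gives the maximizer.
  set V : Set ℝ := {r | ∃ φ ∈ concaveClass, ∫⁻ x, EReal.exp (φ x) = 1 ∧ (r : EReal) ≤ omega φ μ}
  have hW := W1Conv.const hμ
  have hmemV : ∀ φ ∈ concaveClass, omega φ μ ≠ ⊥ → ∃ r ∈ V, omega φ μ ≤ (r : EReal) := by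
    intro φ hφ hω
    obtain ⟨ψ, hψ, hψ1, hψω, hle, -⟩ := exists_normalized hφ hN hω
    have := omega_eq_coe hψ (IsRegular.of_omega_ne_bot hψ hψω)
    exact ⟨realOmega ψ μ, ⟨ψ, hψ, hψ1, this.ge⟩, this ▸ hle⟩
  have hVne : V.Nonempty := by
    obtain ⟨φ, hφ, hω⟩ := exists_omega_ne_bot hμ
    obtain ⟨r, hr, -⟩ := hmemV φ hφ hω
    exact ⟨r, hr⟩
  have hVbdd : BddAbove V := by
    obtain ⟨B, hB, hT⟩ := hW.exists_tight hN le_rfl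
    obtain ⟨k, hk⟩ := hT.exists
    refine ⟨B, ?_⟩
    rintro r ⟨φ, hφ, hφ1, hr⟩
    rcases le_total r 0 with h0 | h0
    · exact h0.trans hB.le
    have hTφ := hk φ hφ hφ1 (le_trans (EReal.coe_le_coe_iff.2 (by rwa [neg_zero])) hr)
    have hreg := IsRegular.of_omega_ne_bot hφ ((EReal.bot_lt_coe _).trans_le hr).ne'
    rw [omega_eq_coe hφ hreg, EReal.coe_le_coe_iff, realOmega, integral_expFun_eq_one hφ hφ1] at hr
    have : ∫ x, (φ x).toReal ∂μ ≤ ∫ _, B ∂μ := integral_mono_ae hreg.integrable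
      (integrable_const _) (hreg.ae_ne_bot.mono fun x hx => hTφ.toReal_le hB x hx)
    simp only [integral_const, probReal_univ, one_smul] at this
    linarith
  obtain ⟨r, -, hr, hrV⟩ := exists_seq_tendsto_sSup hVne hVbdd
  choose φ hφ hφ1 hrφ using hrV
  obtain ⟨N, hN0, hNr⟩ : ∃ N : ℝ, 0 ≤ N ∧ ∀ k, -N ≤ r k := by
    obtain ⟨b, hb⟩ := hr.bddBelow_range
    refine ⟨|b|, abs_nonneg b, fun k => ?_⟩
    exact (neg_abs_le b).trans (hb ⟨k, rfl⟩)
  obtain ⟨B, hB, hT⟩ := hW.exists_tight hN hN0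
  obtain ⟨k₀, hk₀⟩ := hT.exists
  obtain ⟨φ₀, hφ₀, hle⟩ := hW.exists_omega_ge hB hφ hφ1
    (fun k => hk₀ (φ k) (hφ k) (hφ1 k) (le_trans (EReal.coe_le_coe_iff.2 (hNr k)) (hrφ k))) hr hrφ
  refine ⟨φ₀, hφ₀, fun ψ hψ => ?_⟩
  by_cases hω : omega ψ μ = ⊥
  · simp [hω]
  obtain ⟨s, hs, hψs⟩ := hmemV ψ hψ hω
  exact (hψs.trans (EReal.coe_le_coe_iff.2 (le_csSup hVbdd hs))).trans hle

section IsProj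

variable {φ : ℝ → EReal} {μ : Measure ℝ}

theorem IsProj.isRegular [IsProbabilityMeasure μ] (h : IsProj φ μ)
    (hμ : Integrable (fun x : ℝ => x) μ) : IsRegular φ μ := by
  obtain ⟨ψ, hψ, hω⟩ := exists_omega_ne_bot hμ
  exact IsRegular.of_omega_ne_bot h.1 ((bot_lt_iff_ne_bot.2 hω).trans_le (h.2 ψ hψ)).ne'

theorem IsProj.lintegral_exp [IsProbabilityMeasure μ] (h : IsProj φ μ)
    (hμ : Integrable (fun x : ℝ => x) μ) (hN : Nondeg μ) : ∫⁻ x, EReal.exp (φ x) = 1 := by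
  have hω : omega φ μ ≠ ⊥ := by
    rw [omega_eq_coe h.1 (h.isRegular hμ)]; exact EReal.coe_ne_bot _
  obtain ⟨ψ, hψ, -, -, -, himp⟩ := exists_normalized h.1 hN hω
  exact himp (h.2 ψ hψ)

end IsProj

/-! ### Midpoints, Hellinger distance and strong concavity of the criterion. -/

/-- The midpoint of two extended-real functions. -/
def midpt (φ ψ : ℝ → EReal) (x : ℝ) : EReal := ((1 / 2 : ℝ) : EReal) * (φ x + ψ x)

theorem effDom_midpt (φ ψ : ℝ → EReal) : effDom (midpt φ ψ) = effDom φ ∩ effDom ψ := by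
  rw [← effDom_add]
  exact effDom_half fun x => φ x + ψ x

theorem midpt_mem {φ ψ : ℝ → EReal} (hφ : φ ∈ concaveClass) (hψ : ψ ∈ concaveClass)
    (h : (effDom φ ∩ effDom ψ).Nonempty) : midpt φ ψ ∈ concaveClass :=
  half_mem_concaveClass (add_mem_concaveClass hφ hψ h)

theorem toReal_midpt {φ ψ : ℝ → EReal} (hφ : φ ∈ concaveClass) (hψ : ψ ∈ concaveClass) {x : ℝ}
    (hx : x ∈ effDom φ ∩ effDom ψ) :
    (midpt φ ψ x).toReal = ((φ x).toReal + (ψ x).toReal) / 2 := by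
  rw [midpt, ← coe_toReal_of_mem hφ hx.1, ← coe_toReal_of_mem hψ hx.2, ← EReal.coe_add,
    ← EReal.coe_mul]
  simp only [EReal.toReal_coe]
  ring

theorem expFun_midpt {φ ψ : ℝ → EReal} (hφ : φ ∈ concaveClass) (hψ : ψ ∈ concaveClass)
    (h : (effDom φ ∩ effDom ψ).Nonempty) (x : ℝ) :
    expFun (midpt φ ψ) x = √(expFun φ x) * √(expFun ψ x) := by
  by_cases hx : x ∈ effDom φ ∩ effDom ψ
  · rw [expFun_of_mem (midpt_mem hφ hψ h) (by rwa [effDom_midpt]), toReal_midpt hφ hψ hx,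
      expFun_of_mem hφ hx.1, expFun_of_mem hψ hx.2, Real.sqrt_eq_rpow, Real.sqrt_eq_rpow,
      ← Real.exp_mul, ← Real.exp_mul, ← Real.exp_add]
    ring_nf
  · have h1 : midpt φ ψ x = ⊥ := by
      by_contra hne
      have : x ∈ effDom (midpt φ ψ) := hne
      rw [effDom_midpt] at this
      exact hx this
    rw [expFun_of_bot h1]
    rcases not_and_or.1 hx with h2 | h2
    · rw [expFun_of_bot (φ := φ) (by simpa [effDom] using h2)]; simp
    · rw [expFun_of_bot (φ := ψ) (by simpa [effDom] using h2)]; simp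

/-- The linear part of the criterion averages exactly. The exponential of the midpoint is the
geometric mean of the two densities, and the arithmetic mean minus the geometric mean is half of
`(√f - √g) ^ 2`. -/
theorem IsRegular.midpt {φ ψ : ℝ → EReal} (hφ : φ ∈ concaveClass) (hψ : ψ ∈ concaveClass)
    {μ : Measure ℝ} [IsProbabilityMeasure μ] (h1 : IsRegular φ μ) (h2 : IsRegular ψ μ) :
    (effDom φ ∩ effDom ψ).Nonempty ∧ IsRegular (midpt φ ψ) μ ∧
      Integrable (fun x => (√(expFun φ x) - √(expFun ψ x)) ^ 2) ∧
      realOmega (LogConcaveLocation.midpt φ ψ) μ = (realOmega φ μ + realOmega ψ μ) / 2 +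
        (∫ x, (√(expFun φ x) - √(expFun ψ x)) ^ 2) / 2 := by
  have hae : ∀ᵐ x ∂μ, x ∈ effDom φ ∩ effDom ψ := h1.ae_ne_bot.and h2.ae_ne_bot
  have hne : (effDom φ ∩ effDom ψ).Nonempty := hae.exists
  have hm := midpt_mem hφ hψ hne
  have hi1 := integrable_expFun hφ h1.lintegral_ne_top
  have hi2 := integrable_expFun hψ h2.lintegral_ne_top
  have hexp := expFun_midpt hφ hψ hne
  have hsq : ∀ x, (√(expFun φ x) - √(expFun ψ x)) ^ 2 =
      expFun φ x + expFun ψ x - 2 * expFun (LogConcaveLocation.midpt φ ψ) x := fun x => by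
    rw [hexp, sub_sq, Real.sq_sqrt (expFun_nonneg _ _), Real.sq_sqrt (expFun_nonneg _ _)]
    ring
  have him : Integrable (expFun (LogConcaveLocation.midpt φ ψ)) := by
    refine (hi1.add hi2).mono' (measurable_expFun hm).aestronglyMeasurable
      (Eventually.of_forall fun x => ?_)
    rw [Real.norm_of_nonneg (expFun_nonneg _ _)]
    have := hsq x
    have h0 := expFun_nonneg (LogConcaveLocation.midpt φ ψ) x
    simp only [Pi.add_apply]
    nlinarith [sq_nonneg (√(expFun φ x) - √(expFun ψ x))]
  have haeu : (fun x => ((φ x).toReal + (ψ x).toReal) / 2) =ᵐ[μ]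
      fun x => (LogConcaveLocation.midpt φ ψ x).toReal :=
    hae.mono fun x hx => (toReal_midpt hφ hψ hx).symm
  have hreg : IsRegular (LogConcaveLocation.midpt φ ψ) μ := by
    refine ⟨hae.mono fun x hx => ?_, ((h1.integrable.add h2.integrable).div_const 2).congr haeu, ?_⟩
    · rw [← effDom_midpt] at hx
      exact hx
    · have := him.lintegral_lt_top.ne
      simpa only [ofReal_expFun hm] using this
  refine ⟨hne, hreg, ?_, ?_⟩
  · simp only [hsq]
    exact (hi1.add hi2).sub (him.const_mul 2)
  · simp only [hsq]
    have e := integral_sub (hi1.add hi2) (him.const_mul 2)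
    have e2 := integral_add hi1 hi2
    have e3 := integral_add h1.integrable h2.integrable
    simp only [Pi.add_apply] at e e2 e3
    rw [realOmega, realOmega, realOmega, ← integral_congr_ae haeu, integral_div, e, e2, e3,
      integral_const_mul]
    ring

/-- The squared Hellinger distance to the projection is controlled by the criterion. -/
theorem IsProj.integral_sq_sqrt_sub_le {φ ψ : ℝ → EReal} {μ : Measure ℝ} [IsProbabilityMeasure μ]
    (h : IsProj φ μ) (hψ : ψ ∈ concaveClass) (h1 : IsRegular φ μ) (h2 : IsRegular ψ μ) :
    ∫ x, (√(expFun φ x) - √(expFun ψ x)) ^ 2 ≤ realOmega φ μ - realOmega ψ μ := by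
  obtain ⟨hne, hreg, -, heq⟩ := IsRegular.midpt h.1 hψ h1 h2
  have hm := midpt_mem h.1 hψ hne
  have hle := h.2 _ hm
  rw [omega_eq_coe hm hreg, omega_eq_coe h.1 h1, EReal.coe_le_coe_iff, heq] at hle
  linarith

/-- Factor `a - b` through square roots and apply the weighted AM-GM inequality. Integrated, this
pointwise bound turns Hellinger closeness into L¹ closeness without Cauchy–Schwarz. -/
theorem abs_sub_le_sq_sqrt_sub {a b : ℝ} (ha : 0 ≤ a) (hb : 0 ≤ b) {t : ℝ} (ht : 0 < t) :
    |a - b| ≤ (√a - √b) ^ 2 / (2 * t) + t * (a + b) := by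
  have e : a - b = (√a - √b) * (√a + √b) := by
    ring_nf; rw [Real.sq_sqrt ha, Real.sq_sqrt hb]
  rw [e, abs_mul, abs_of_nonneg (add_nonneg (Real.sqrt_nonneg a) (Real.sqrt_nonneg b))]
  have h1 : (√a + √b) ^ 2 ≤ 2 * (a + b) := by
    nlinarith [sq_nonneg (√a - √b), Real.sq_sqrt ha, Real.sq_sqrt hb]
  have h2 : |√a - √b| * (√a + √b) ≤ |√a - √b| ^ 2 / (2 * t) + t * ((√a + √b) ^ 2 / 2) := by
    have : 0 ≤ (|√a - √b| - t * (√a + √b)) ^ 2 / (2 * t) := by positivity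
    have e2 : (|√a - √b| - t * (√a + √b)) ^ 2 / (2 * t) = |√a - √b| ^ 2 / (2 * t) +
      t * ((√a + √b) ^ 2 / 2) - |√a - √b| * (√a + √b) := by field_simp; ring
    linarith
  rw [sq_abs] at h2
  nlinarith

theorem isRegular_coe {g : ℝ → ℝ} {K : ℝ≥0} (hg : LipschitzWith K g)
    (hexp : ∫⁻ x, ENNReal.ofReal (Real.exp (g x)) ≠ ⊤) {μ : Measure ℝ} [IsProbabilityMeasure μ]
    (hμ : Integrable (fun x : ℝ => x) μ) : IsRegular (fun x => (g x : EReal)) μ :=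
  ⟨Eventually.of_forall fun _ => EReal.coe_ne_bot _,
    by simpa only [EReal.toReal_coe] using integrable_of_lipschitz hμ hg,
    by simpa only [EReal.exp_coe] using hexp⟩

theorem realOmega_coe (g : ℝ → ℝ) (μ : Measure ℝ) :
    realOmega (fun x => (g x : EReal)) μ = ∫ x, g x ∂μ - ∫ x, Real.exp (g x) := by
  simp only [realOmega, EReal.toReal_coe, expFun_coe]

theorem IsProj.realOmega_le {φ ψ : ℝ → EReal} {μ : Measure ℝ} [IsProbabilityMeasure μ]
    (h : IsProj φ μ) (hμ : Integrable (fun x : ℝ => x) μ) (hψ : ψ ∈ concaveClass)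
    (hreg : IsRegular ψ μ) : realOmega ψ μ ≤ realOmega φ μ := by
  have := h.2 ψ hψ
  rwa [omega_eq_coe hψ hreg, omega_eq_coe h.1 (h.isRegular hμ), EReal.coe_le_coe_iff] at this

/-! ### Continuity of the projection in L¹. -/

section Continuity

variable {μ : ℕ → Measure ℝ} {μ₀ : Measure ℝ} {φ : ℕ → ℝ → EReal} {φ₀ : ℝ → EReal}

/-- Every projection does at least as well as the fixed competitor `-|x|`, whose criterion
converges. This is the lower bound that tightness requires. -/
theorem W1Conv.eventually_tight (h : W1Conv μ μ₀) (hN : Nondeg μ₀)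
    (hφ : ∀ᶠ k in atTop, IsProj (φ k) (μ k)) : ∃ B, 0 < B ∧ ∀ᶠ k in atTop, Tight B (φ k) := by
  have := h.prob
  have := h.prob_lim
  have hlip : LipschitzWith 1 fun x : ℝ => -|x - 0| := (lipschitzWith_abs_sub 0).neg
  have hfin : ∫⁻ x : ℝ, ENNReal.ofReal (Real.exp (-|x - 0|)) ≠ ⊤ := by
    simpa only [neg_mul, one_mul, sub_zero] using
      (integrable_exp_neg_mul_abs (β := 1) one_pos).lintegral_lt_top.ne
  have hmem := coe_mem_concaveClass hlip.continuous (concaveOn_neg_abs_sub 0)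
  have hlim := (h.tendsto _ _ hlip).sub_const (∫ x, Real.exp (-|x - 0|))
  set l := ∫ x, -|x - 0| ∂μ₀ - ∫ x : ℝ, Real.exp (-|x - 0|)
  obtain ⟨B, hB, hT⟩ := h.exists_tight hN (M := |l - 1|) (abs_nonneg _)
  refine ⟨B, hB, ?_⟩
  filter_upwards [hT, hφ, hlim.eventually (lt_mem_nhds (sub_one_lt l)), h.eventually_nondeg hN]
    with k h1 h2 h3 h4
  refine h1 _ h2.1 (h2.lintegral_exp (h.integrable_id k) h4) ?_
  have h5 := h2.realOmega_le (h.integrable_id k) hmem (isRegular_coe hlip hfin (h.integrable_id k))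
  rw [realOmega_coe] at h5
  rw [omega_eq_coe h2.1 (h2.isRegular (h.integrable_id k)), EReal.coe_le_coe_iff]
  have := neg_abs_le (l - 1)
  linarith

/-- Otherwise a tight subsequence would produce, in the limit, a function whose criterion at `μ₀`
exceeds the maximum by `ε`. -/
theorem W1Conv.eventually_realOmega_le (h : W1Conv μ μ₀) (hN : Nondeg μ₀)
    (hφ : ∀ᶠ k in atTop, IsProj (φ k) (μ k)) (h₀ : IsProj φ₀ μ₀) {ε : ℝ} (hε : 0 < ε) :
    ∀ᶠ k in atTop, realOmega (φ k) (μ k) ≤ realOmega φ₀ μ₀ + ε := by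
  have := h.prob
  have := h.prob_lim
  by_contra hcon
  rw [not_eventually] at hcon
  obtain ⟨B, hB, hT⟩ := h.eventually_tight hN hφ
  obtain ⟨σ, hσ, hP⟩ := extraction_of_frequently_atTop
    (hcon.and_eventually (hφ.and (hT.and (h.eventually_nondeg hN))))
  obtain ⟨ψ, hψ, hle⟩ := (h.comp hσ.tendsto_atTop).exists_omega_ge hB
    (fun k => (hP k).2.1.1)
    (fun k => (hP k).2.1.lintegral_exp (h.integrable_id _) (hP k).2.2.2)
    (fun k => (hP k).2.2.1) (c := fun _ => realOmega φ₀ μ₀ + ε) tendsto_const_nhds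
    (fun k => by
      rw [omega_eq_coe (hP k).2.1.1 ((hP k).2.1.isRegular (h.integrable_id _)),
        EReal.coe_le_coe_iff]
      exact (not_le.1 (hP k).1).le)
  have := hle.trans (h₀.2 ψ hψ)
  rw [omega_eq_coe h₀.1 (h₀.isRegular h.integrable_id_lim), EReal.coe_le_coe_iff] at this
  linarith

/-- Continuity of the log-concave projection in `L₁`. -/
theorem W1Conv.tendsto_integral_abs_sub (h : W1Conv μ μ₀) (hN : Nondeg μ₀)
    (hφ : ∀ᶠ k in atTop, IsProj (φ k) (μ k)) (h₀ : IsProj φ₀ μ₀) :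
    Tendsto (fun k => ∫ x, |expFun (φ k) x - expFun φ₀ x|) atTop (𝓝 0) := by
  have := h.prob
  have := h.prob_lim
  have hreg₀ := h₀.isRegular h.integrable_id_lim
  have h1₀ := h₀.lintegral_exp h.integrable_id_lim hN
  have hf₀ := integrable_expFun h₀.1 hreg₀.lintegral_ne_top
  obtain ⟨H, hH⟩ := exists_upper_bound h₀.1 hreg₀.lintegral_ne_top
  rw [Metric.tendsto_nhds]
  intro ε hε
  set t := min 1 (ε / 7)
  have ht : 0 < t := by positivity
  have ht1 : t ≤ 1 := min_le_left _ _
  have htε : t ≤ ε / 7 := min_le_right _ _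
  have hlimL := (tendsto_one_div_add_atTop_nhds_zero_nat (𝕜 := ℝ)).const_mul
    (2 * (Real.exp H * expAbsConst))
  rw [mul_zero] at hlimL
  obtain ⟨n, hn⟩ := (hlimL.eventually (gt_mem_nhds (show 0 < t ^ 2 by positivity))).exists
  set L : ℝ≥0 := n + 1
  -- The projection itself need not be integrable for `μ k`, as its domain may miss mass of `μ k`.
  -- Its Lipschitz majorant is integrable and loses at most `t ^ 2` in the criterion at `μ₀`.
  set g := lipReg L φ₀
  have hg : LipschitzWith L g := lipschitzWith_lipReg h₀.1 hH
  have hgm := coe_mem_concaveClass hg.continuous (concaveOn_lipReg h₀.1 hH)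
  have hmass : ∫⁻ x, ENNReal.ofReal (Real.exp (g x)) ≤ ENNReal.ofReal (1 + t ^ 2) := by
    refine (lintegral_exp_lipReg_le h₀.1 hH (by positivity)).trans ?_
    rw [h1₀, ENNReal.ofReal_add zero_le_one (by positivity), ENNReal.ofReal_one]
    refine add_le_add le_rfl (ENNReal.ofReal_le_ofReal (le_trans (le_of_eq ?_) hn.le))
    simp only [L]
    push_cast
    ring
  have hfin : ∫⁻ x, ENNReal.ofReal (Real.exp (g x)) ≠ ⊤ :=
    (hmass.trans_lt ENNReal.ofReal_lt_top).ne
  have hgi : Integrable fun x => Real.exp (g x) := by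
    refine ⟨(Real.continuous_exp.comp hg.continuous).aestronglyMeasurable, ?_⟩
    rw [hasFiniteIntegral_iff_ofReal (Eventually.of_forall fun x => (Real.exp_pos _).le)]
    exact hfin.lt_top
  have hgI : ∫ x, Real.exp (g x) ≤ 1 + t ^ 2 := by
    rw [← ofReal_integral_eq_lintegral_ofReal hgi
      (Eventually.of_forall fun x => (Real.exp_pos _).le)] at hmass
    exact (ENNReal.ofReal_le_ofReal_iff (by positivity)).1 hmass
  have hreg : ∀ (ν : Measure ℝ) [IsProbabilityMeasure ν], Integrable (fun x : ℝ => x) ν →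
      IsRegular (fun x => (g x : EReal)) ν := fun ν _ hν => isRegular_coe hg hfin hν
  have hJg : realOmega φ₀ μ₀ - t ^ 2 ≤ realOmega (fun x => (g x : EReal)) μ₀ := by
    rw [realOmega_coe, realOmega, integral_expFun_eq_one h₀.1 h1₀]
    have : ∫ x, (φ₀ x).toReal ∂μ₀ ≤ ∫ x, g x ∂μ₀ := by
      refine integral_mono_ae hreg₀.integrable
        (integrable_of_lipschitz h.integrable_id_lim hg) ?_
      filter_upwards [hreg₀.ae_ne_bot] with x hx using le_lipReg_self hH hx
    linarith
  have hJlim : Tendsto (fun k => realOmega (fun x => (g x : EReal)) (μ k)) atTop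
      (𝓝 (realOmega (fun x => (g x : EReal)) μ₀)) := by
    simp only [realOmega_coe]
    exact (h.tendsto _ _ hg).sub_const _
  have hdom : ∀ x, expFun φ₀ x ≤ Real.exp (g x) := fun x => by
    by_cases hx : x ∈ effDom φ₀
    · rw [expFun_of_mem h₀.1 hx]
      exact Real.exp_le_exp.2 (le_lipReg_self hH hx)
    · rw [expFun_of_bot (by simpa [effDom] using hx)]
      exact (Real.exp_pos _).le
  have hdist0 : ∫ x, |Real.exp (g x) - expFun φ₀ x| ≤ t ^ 2 := by
    rw [integral_congr_ae (Eventually.of_forall fun x => abs_of_nonneg (sub_nonneg.2 (hdom x))),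
      integral_sub hgi hf₀, integral_expFun_eq_one h₀.1 h1₀]
    linarith
  filter_upwards [hφ, h.eventually_nondeg hN,
    h.eventually_realOmega_le hN hφ h₀ (show 0 < t ^ 2 by positivity),
    hJlim.eventually (lt_mem_nhds (show _ - t ^ 2 < _ from sub_lt_self _ (by positivity)))]
    with k k1 k2 k3 k4
  have hregk := k1.isRegular (h.integrable_id k)
  have h1k := k1.lintegral_exp (h.integrable_id k) k2
  have hfk := integrable_expFun k1.1 hregk.lintegral_ne_top
  have hIk := integral_expFun_eq_one k1.1 h1k
  have hregg := hreg (μ k) (h.integrable_id k)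
  -- At `μ k` the projection is at most `t ^ 2` above the limiting maximum and `g` at most `2 * t ^
  -- 2` below it, so the squared Hellinger distance is at most `3 * t ^ 2`.
  have hell := k1.integral_sq_sqrt_sub_le hgm hregk hregg
  have helli := (IsRegular.midpt k1.1 hgm hregk hregg).2.2.1
  simp only [expFun_coe] at hell helli
  have hdist1 : ∫ x, |expFun (φ k) x - Real.exp (g x)| ≤ 3 * t ^ 2 / (2 * t) + t * (2 + t ^ 2) := by
    calc ∫ x, |expFun (φ k) x - Real.exp (g x)|
        ≤ ∫ x, ((√(expFun (φ k) x) - √(Real.exp (g x))) ^ 2 / (2 * t) +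
            t * (expFun (φ k) x + Real.exp (g x))) :=
          integral_mono (hfk.sub hgi).abs ((helli.div_const _).add ((hfk.add hgi).const_mul t))
            fun x => abs_sub_le_sq_sqrt_sub (expFun_nonneg _ _) (Real.exp_pos _).le ht
      _ = (∫ x, (√(expFun (φ k) x) - √(Real.exp (g x))) ^ 2) / (2 * t) +
            t * (1 + ∫ x, Real.exp (g x)) := by
          have hs : Integrable fun x => expFun (φ k) x + Real.exp (g x) := hfk.add hgi
          rw [integral_add (helli.div_const _) (hs.const_mul t), integral_div,
            integral_const_mul, integral_add hfk hgi, hIk]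
      _ ≤ _ := by
          refine add_le_add (div_le_div_of_nonneg_right ?_ (by positivity))
            (mul_le_mul_of_nonneg_left ?_ ht.le) <;> linarith
  have e : 3 * t ^ 2 / (2 * t) = 3 / 2 * t := by field_simp
  rw [Real.dist_eq, sub_zero, abs_of_nonneg (integral_nonneg fun _ => abs_nonneg _)]
  calc ∫ x, |expFun (φ k) x - expFun φ₀ x|
      ≤ ∫ x, (|expFun (φ k) x - Real.exp (g x)| + |Real.exp (g x) - expFun φ₀ x|) :=
        integral_mono (hfk.sub hf₀).abs ((hfk.sub hgi).abs.add (hgi.sub hf₀).abs)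
          fun x => abs_sub_le _ _ _
    _ = _ := integral_add (hfk.sub hgi).abs (hgi.sub hf₀).abs
    _ ≤ 3 / 2 * t + t * (2 + t ^ 2) + t ^ 2 := by linarith
    _ < ε := by nlinarith [mul_le_one₀ ht1 ht.le ht1]

end Continuity

/-! ### Weighted convergence and moment inequalities. -/

section Moments

theorem Tight.expFun_le {φ : ℝ → EReal} (hφ : φ ∈ concaveClass) {B : ℝ} (hT : Tight B φ) (x : ℝ) :
    expFun φ x ≤ Real.exp B * Real.exp (-B⁻¹ * |x|) := by
  by_cases hx : x ∈ effDom φ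
  · rw [expFun_of_mem hφ hx, ← Real.exp_add]
    refine Real.exp_le_exp.2 ((hT.le_envelope x hx).trans (le_of_eq ?_))
    ring
  · rw [expFun_of_bot (by simpa [effDom] using hx)]
    positivity

theorem Tight.integrable {φ : ℝ → EReal} (hφ : φ ∈ concaveClass) {B : ℝ} (hB : 0 < B)
    (hT : Tight B φ) : Integrable fun x => (1 + x ^ 2) ^ 2 * expFun φ x := by
  refine ((integrable_sq_one_add_sq_mul_exp (inv_pos.2 hB)).const_mul (Real.exp B)).mono'
    ((by fun_prop : Measurable fun x : ℝ => (1 + x ^ 2) ^ 2).mul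
      (measurable_expFun hφ)).aestronglyMeasurable (Eventually.of_forall fun x => ?_)
  rw [Real.norm_of_nonneg (mul_nonneg (by positivity) (expFun_nonneg _ _)), mul_left_comm]
  have := hT.expFun_le hφ x
  gcongr

/-- Polynomial weights of degree at most two are dominated. -/
theorem integrable_of_abs_le {f w : ℝ → ℝ} (hf : Integrable fun x => (1 + x ^ 2) ^ 2 * f x)
    (hf0 : ∀ x, 0 ≤ f x) (hfm : Measurable f) (hw : Measurable w) {C : ℝ}
    (h : ∀ x, |w x| ≤ C * (1 + x ^ 2) ^ 2) : Integrable fun x => w x * f x := by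
  refine (hf.const_mul C).mono' (hw.mul hfm).aestronglyMeasurable (Eventually.of_forall fun x => ?_)
  rw [Real.norm_eq_abs, abs_mul, abs_of_nonneg (hf0 x), ← mul_assoc]
  exact mul_le_mul_of_nonneg_right (h x) (hf0 x)

variable {μ : ℕ → Measure ℝ} {μ₀ : Measure ℝ} {φ : ℕ → ℝ → EReal} {φ₀ : ℝ → EReal}

theorem IsProj.exists_tight [IsProbabilityMeasure μ₀] (h : IsProj φ₀ μ₀)
    (hμ : Integrable (fun x : ℝ => x) μ₀) (hN : Nondeg μ₀) : ∃ B, 0 < B ∧ Tight B φ₀ := by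
  obtain ⟨B, hB, hT⟩ := (W1Conv.const hμ).eventually_tight hN
    (φ := fun _ => φ₀) (Eventually.of_forall fun _ => h)
  exact ⟨B, hB, hT.exists.choose_spec⟩

theorem IsProj.integrable_weighted [IsProbabilityMeasure μ₀] (h : IsProj φ₀ μ₀)
    (hμ : Integrable (fun x : ℝ => x) μ₀) (hN : Nondeg μ₀) :
    Integrable fun x => (1 + x ^ 2) ^ 2 * expFun φ₀ x := by
  obtain ⟨B, hB, hT⟩ := h.exists_tight hμ hN
  exact hT.integrable h.1 hB

/-- Continuity of the log-concave projection with a quadratic weight. -/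
theorem W1Conv.tendsto_integral_weighted (h : W1Conv μ μ₀) (hN : Nondeg μ₀)
    (hφ : ∀ᶠ k in atTop, IsProj (φ k) (μ k)) (h₀ : IsProj φ₀ μ₀) :
    Tendsto (fun k => ∫ x, (1 + x ^ 2) * |expFun (φ k) x - expFun φ₀ x|) atTop (𝓝 0) := by
  have := h.prob
  have := h.prob_lim
  obtain ⟨B, hB, hT⟩ := h.eventually_tight hN hφ
  obtain ⟨B₀, hB₀, hT₀⟩ := h₀.exists_tight h.integrable_id_lim hN
  set E : ℝ → ℝ := fun x => (1 + x ^ 2) ^ 2 * (Real.exp B * Real.exp (-B⁻¹ * |x|)) +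
    (1 + x ^ 2) ^ 2 * (Real.exp B₀ * Real.exp (-B₀⁻¹ * |x|))
  have hE : Integrable E := by
    have h1 := (integrable_sq_one_add_sq_mul_exp (inv_pos.2 hB)).const_mul (Real.exp B)
    have h2 := (integrable_sq_one_add_sq_mul_exp (inv_pos.2 hB₀)).const_mul (Real.exp B₀)
    refine (h1.add h2).congr (Eventually.of_forall fun x => ?_)
    simp only [Pi.add_apply, E]
    ring
  have hE0 : 0 ≤ ∫ x, E x := integral_nonneg fun x => by simp only [E]; positivity
  have hlim := h.tendsto_integral_abs_sub hN hφ h₀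
  rw [Metric.tendsto_nhds]
  intro ε hε
  -- The weight satisfies `1 + x ^ 2 ≤ l + (1 + x ^ 2) ^ 2 / l`: the first term is handled by
  -- unweighted convergence, the second by the common envelope `E`, made small by this choice of
  -- `l`.
  set l := 2 * (∫ x, E x) / ε + 1
  have hl : 0 < l := by positivity
  filter_upwards [hT, hφ, hlim.eventually (gt_mem_nhds (show 0 < ε / (2 * l) by positivity))]
    with k k1 k2 k3
  have hdom : ∀ x, (1 + x ^ 2) ^ 2 * |expFun (φ k) x - expFun φ₀ x| ≤ E x := fun x => by
    simp only [E]
    rw [← mul_add]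
    have h1 := k1.expFun_le k2.1 x
    have h2 := hT₀.expFun_le h₀.1 x
    have h3 := expFun_nonneg (φ k) x
    have h4 := expFun_nonneg φ₀ x
    gcongr
    rw [abs_le]
    constructor <;> linarith
  have hfk := integrable_expFun k2.1 (k2.isRegular (h.integrable_id k)).lintegral_ne_top
  have hf₀ := integrable_expFun h₀.1 (h₀.isRegular h.integrable_id_lim).lintegral_ne_top
  rw [Real.dist_eq, sub_zero,
    abs_of_nonneg (integral_nonneg fun x => mul_nonneg (by positivity) (abs_nonneg _))]
  calc ∫ x, (1 + x ^ 2) * |expFun (φ k) x - expFun φ₀ x|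
      ≤ ∫ x, (l * |expFun (φ k) x - expFun φ₀ x| + l⁻¹ * E x) := by
        refine integral_mono_of_nonneg
          (Eventually.of_forall fun x => mul_nonneg (by positivity) (abs_nonneg _))
          (((hfk.sub hf₀).abs.const_mul l).add (hE.const_mul _)) (Eventually.of_forall fun x => ?_)
        simp only
        refine le_trans ?_ (add_le_add le_rfl
          (mul_le_mul_of_nonneg_left (hdom x) (inv_pos.2 hl).le))
        rw [← mul_assoc, ← add_mul]
        refine mul_le_mul_of_nonneg_right ?_ (abs_nonneg _)
        rw [inv_mul_eq_div, ← sub_le_iff_le_add', le_div_iff₀ hl]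
        nlinarith [sq_nonneg (l - (1 + x ^ 2)), sq_nonneg x]
    _ = l * (∫ x, |expFun (φ k) x - expFun φ₀ x|) + l⁻¹ * ∫ x, E x := by
        have hs : Integrable fun x => |expFun (φ k) x - expFun φ₀ x| := (hfk.sub hf₀).abs
        rw [integral_add (hs.const_mul l) (hE.const_mul _), integral_const_mul,
          integral_const_mul]
    _ < l * (ε / (2 * l)) + ε / 2 := by
        have : l⁻¹ * ∫ x, E x ≤ ε / 2 := by
          rw [inv_mul_le_iff₀ hl]
          have e : l * (ε / 2) = (∫ x, E x) + ε / 2 := by simp only [l]; field_simp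
          linarith
        have := mul_lt_mul_of_pos_left k3 hl
        linarith
    _ = ε := by field_simp; norm_num

theorem W1Conv.tendsto_integral_mul (h : W1Conv μ μ₀) (hN : Nondeg μ₀)
    (hφ : ∀ᶠ k in atTop, IsProj (φ k) (μ k)) (h₀ : IsProj φ₀ μ₀) {w : ℝ → ℝ} (hw : Measurable w)
    (hle : ∀ x, |w x| ≤ 1 + x ^ 2) :
    Tendsto (fun k => ∫ x, w x * expFun (φ k) x) atTop (𝓝 (∫ x, w x * expFun φ₀ x)) := by
  have := h.prob
  have := h.prob_lim
  have hle' : ∀ x, |w x| ≤ 1 * (1 + x ^ 2) ^ 2 := fun x => by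
    have := hle x
    nlinarith [sq_nonneg x, sq_nonneg (x ^ 2)]
  have hlim := h.tendsto_integral_weighted hN hφ h₀
  rw [tendsto_iff_dist_tendsto_zero]
  refine squeeze_zero' (Eventually.of_forall fun _ => dist_nonneg) ?_ hlim
  filter_upwards [hφ, h.eventually_nondeg hN] with k k1 k2
  have i1 := k1.integrable_weighted (h.integrable_id k) k2
  have i2 := h₀.integrable_weighted h.integrable_id_lim hN
  have j1 := integrable_of_abs_le i1 (expFun_nonneg _) (measurable_expFun k1.1) hw hle'
  have j2 := integrable_of_abs_le i2 (expFun_nonneg _) (measurable_expFun h₀.1) hw hle'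
  rw [Real.dist_eq, ← integral_sub j1 j2]
  have hw2 : ∀ x : ℝ, |1 + x ^ 2| ≤ 1 * (1 + x ^ 2) ^ 2 := fun x => by
    rw [abs_of_nonneg (by positivity)]
    nlinarith [sq_nonneg x, sq_nonneg (x ^ 2)]
  have m1 := integrable_of_abs_le i1 (expFun_nonneg _) (measurable_expFun k1.1)
    (w := fun x => 1 + x ^ 2) (by fun_prop) hw2
  have m2 := integrable_of_abs_le i2 (expFun_nonneg _) (measurable_expFun h₀.1)
    (w := fun x => 1 + x ^ 2) (by fun_prop) hw2
  have e : ∀ x : ℝ, |(1 + x ^ 2) * expFun (φ k) x - (1 + x ^ 2) * expFun φ₀ x| =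
      (1 + x ^ 2) * |expFun (φ k) x - expFun φ₀ x| := fun x => by
    rw [← mul_sub, abs_mul, abs_of_nonneg (by positivity)]
  refine abs_integral_le_integral_abs.trans (integral_mono (j1.sub j2).abs ?_ fun x => ?_)
  · exact (m1.sub m2).abs.congr (Eventually.of_forall e)
  · simp only
    rw [← mul_sub, abs_mul]
    exact mul_le_mul_of_nonneg_right (hle x) (abs_nonneg _)

theorem W1Conv.tendsto_densityVariance (h : W1Conv μ μ₀) (hN : Nondeg μ₀)
    (hφ : ∀ᶠ k in atTop, IsProj (φ k) (μ k)) (h₀ : IsProj φ₀ μ₀) :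
    Tendsto (fun k => densityVariance (expFun (φ k))) atTop (𝓝 (densityVariance (expFun φ₀))) := by
  refine (h.tendsto_integral_mul hN hφ h₀ (w := fun x => x ^ 2) (by fun_prop) fun x => ?_).sub
    ((h.tendsto_integral_mul hN hφ h₀ (w := fun x => x) (by fun_prop) fun x => ?_).pow 2)
  · rw [abs_of_nonneg (by positivity)]; linarith
  · rw [abs_le]; constructor <;> nlinarith [sq_nonneg (x + 1), sq_nonneg (x - 1)]

theorem concaveOn_neg_mul_sq {t : ℝ} (ht : 0 ≤ t) (c : ℝ) :
    ConcaveOn ℝ Set.univ fun x : ℝ => -(t * (x - c) ^ 2) := by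
  refine ⟨convex_univ, fun x _ y _ a b ha hb hab => ?_⟩
  simp only [smul_eq_mul]
  obtain rfl : b = 1 - a := by linarith
  have e : -(t * (a * x + (1 - a) * y - c) ^ 2) = a * -(t * (x - c) ^ 2) +
      (1 - a) * -(t * (y - c) ^ 2) + t * (a * (1 - a) * (x - y) ^ 2) := by ring
  rw [e]
  have : 0 ≤ t * (a * (1 - a) * (x - y) ^ 2) := by positivity
  linarith

/-- Second moments about any point do not increase under log-concave projection. -/
theorem IsProj.integral_sq_le [IsProbabilityMeasure μ₀] (h : IsProj φ₀ μ₀)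
    (hμ : Integrable (fun x : ℝ => x) μ₀) (hN : Nondeg μ₀)
    (hμ2 : Integrable (fun x : ℝ => x ^ 2) μ₀) (c : ℝ) :
    Integrable (fun x => (x - c) ^ 2 * expFun φ₀ x) ∧
      ∫ x, (x - c) ^ 2 * expFun φ₀ x ≤ ∫ x, (x - c) ^ 2 ∂μ₀ := by
  have hw := h.integrable_weighted hμ hN
  have hreg := h.isRegular hμ
  have hm := measurable_expFun h.1
  have hi0 := integrable_expFun h.1 hreg.lintegral_ne_top
  have hb : ∀ x : ℝ, (x - c) ^ 2 ≤ 2 * (1 + c ^ 2) * (1 + x ^ 2) := fun x => by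
    nlinarith [sq_nonneg (x + c), mul_nonneg (sq_nonneg x) (sq_nonneg c)]
  have hi2 : Integrable fun x => (x - c) ^ 2 * expFun φ₀ x := by
    refine integrable_of_abs_le hw (expFun_nonneg _) hm (by fun_prop) (C := 2 * (1 + c ^ 2))
      fun x => ?_
    rw [abs_of_nonneg (sq_nonneg _)]
    refine (hb x).trans (mul_le_mul_of_nonneg_left ?_ (by positivity))
    nlinarith [sq_nonneg x, sq_nonneg (x ^ 2)]
  have hi4 : Integrable fun x => ((x - c) ^ 2) ^ 2 * expFun φ₀ x := by
    refine integrable_of_abs_le hw (expFun_nonneg _) hm (by fun_prop) (C := (2 * (1 + c ^ 2)) ^ 2)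
      fun x => ?_
    rw [abs_of_nonneg (sq_nonneg _), ← mul_pow]
    exact pow_le_pow_left₀ (sq_nonneg _) (hb x) 2
  have hμc : Integrable (fun x : ℝ => (x - c) ^ 2) μ₀ := by
    have := (hμ2.sub (hμ.const_mul (2 * c))).add (integrable_const (c ^ 2))
    refine this.congr (Eventually.of_forall fun x => ?_)
    simp only [Pi.add_apply, Pi.sub_apply]
    ring
  refine ⟨hi2, ?_⟩
  set D := ∫ x, ((x - c) ^ 2) ^ 2 * expFun φ₀ x
  -- Perturb the log-density by the concave function `-t * (x - c) ^ 2`. Optimality, together with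
  -- `exp (-y) ≤ 1 - y + y ^ 2` for `y ≥ 0`, gives the inequality up to `t * D`, where `D` is a
  -- finite fourth moment; then `t` tends to zero.
  have key : ∀ t : ℝ, 0 < t →
      ∫ x, (x - c) ^ 2 * expFun φ₀ x ≤ ∫ x, (x - c) ^ 2 ∂μ₀ + t * D := by
    intro t ht
    set r : ℝ → ℝ := fun x => -(t * (x - c) ^ 2)
    set ψ : ℝ → EReal := fun x => φ₀ x + (r x : EReal)
    have hψ : ψ ∈ concaveClass := add_coe_mem_concaveClass h.1 (by fun_prop)
      (concaveOn_neg_mul_sq ht.le c)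
    have hexp : ∀ x, expFun ψ x = expFun φ₀ x * Real.exp (r x) := fun x => by
      simp only [expFun, ψ, EReal.exp_add, EReal.exp_coe, ENNReal.toReal_mul,
        ENNReal.toReal_ofReal (Real.exp_pos _).le]
    have hle : ∀ x, expFun ψ x ≤ expFun φ₀ x - t * ((x - c) ^ 2 * expFun φ₀ x) +
        t ^ 2 * (((x - c) ^ 2) ^ 2 * expFun φ₀ x) := fun x => by
      have hy : 0 ≤ t * (x - c) ^ 2 := by positivity
      have h1 : Real.exp (r x) ≤ 1 - t * (x - c) ^ 2 + (t * (x - c) ^ 2) ^ 2 := by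
        simp only [r]
        rw [Real.exp_neg]
        set y := t * (x - c) ^ 2
        have h2 := Real.add_one_le_exp y
        rw [inv_le_iff_one_le_mul₀ (Real.exp_pos _)]
        have h3 : 0 ≤ 1 - y + y ^ 2 := by nlinarith [sq_nonneg (y - 1)]
        have h4 : (1 - y + y ^ 2) * (y + 1) ≤ (1 - y + y ^ 2) * Real.exp y := by gcongr
        nlinarith [pow_nonneg hy 3]
      rw [hexp]
      have := mul_le_mul_of_nonneg_left h1 (expFun_nonneg φ₀ x)
      nlinarith
    have hψi : Integrable (expFun ψ) := by
      refine hi0.mono' (measurable_expFun hψ).aestronglyMeasurable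
        (Eventually.of_forall fun x => ?_)
      rw [Real.norm_of_nonneg (expFun_nonneg _ _), hexp]
      refine mul_le_of_le_one_right (expFun_nonneg _ _) (Real.exp_le_one_iff.2 ?_)
      simp only [r]
      have : 0 ≤ t * (x - c) ^ 2 := by positivity
      linarith
    have hae : (fun x => (φ₀ x).toReal + r x) =ᵐ[μ₀] fun x => (ψ x).toReal := by
      filter_upwards [hreg.ae_ne_bot] with x hx using (toReal_add_coe h.1 hx _).symm
    have hri : Integrable r μ₀ := (hμc.const_mul t).neg
    have hregψ : IsRegular ψ μ₀ := by
      refine ⟨?_, (hreg.integrable.add hri).congr hae, ?_⟩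
      · filter_upwards [hreg.ae_ne_bot] with x hx
        have : x ∈ effDom ψ := by rw [effDom_add_coe]; exact hx
        exact this
      · have := hψi.lintegral_lt_top.ne
        simpa only [ofReal_expFun hψ] using this
    have hJ := h.realOmega_le hμ hψ hregψ
    rw [realOmega, realOmega, ← integral_congr_ae hae, integral_add hreg.integrable hri] at hJ
    have hr : ∫ x, r x ∂μ₀ = -(t * ∫ x, (x - c) ^ 2 ∂μ₀) := by
      simp only [r]; rw [integral_neg, integral_const_mul]
    have hI : ∫ x, expFun ψ x ≤ (∫ x, expFun φ₀ x) - t * (∫ x, (x - c) ^ 2 * expFun φ₀ x) +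
        t ^ 2 * D := by
      have i1 := hi0.sub (hi2.const_mul t)
      refine (integral_mono hψi (i1.add (hi4.const_mul (t ^ 2))) hle).trans (le_of_eq ?_)
      rw [integral_add' i1 (hi4.const_mul (t ^ 2)), integral_sub' hi0 (hi2.const_mul t),
        integral_const_mul, integral_const_mul]
    rw [hr] at hJ
    have : t * (∫ x, (x - c) ^ 2 * expFun φ₀ x) ≤ t * (∫ x, (x - c) ^ 2 ∂μ₀ + t * D) := by
      nlinarith
    exact le_of_mul_le_mul_left this ht
  have hlim : Tendsto (fun t : ℝ => ∫ x, (x - c) ^ 2 ∂μ₀ + t * D) (𝓝[>] 0)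
      (𝓝 (∫ x, (x - c) ^ 2 ∂μ₀ + 0 * D)) := by
    have : Continuous fun t : ℝ => ∫ x, (x - c) ^ 2 ∂μ₀ + t * D := by fun_prop
    exact this.continuousAt.tendsto.mono_left nhdsWithin_le_nhds
  rw [zero_mul, add_zero] at hlim
  exact ge_of_tendsto hlim (eventually_nhdsWithin_of_forall fun t ht => key t ht)

end Moments

/-! ### Chosen maximizers are projections. -/

theorem argmaxOn_spec {S : Set (ℝ → EReal)} {J : (ℝ → EReal) → EReal} {φ : ℝ → EReal}
    (hφ : φ ∈ S) (hmax : ∀ ψ ∈ S, J ψ ≤ J φ) :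
    argmaxOn S J ∈ S ∧ ∀ ψ ∈ S, J ψ ≤ J (argmaxOn S J) := by
  have h : ∃ φ, φ ∈ S ∧ IsMaxOn J S φ := ⟨φ, hφ, isMaxOn_iff.2 hmax⟩
  rw [argmaxOn, dif_pos h]
  exact ⟨h.choose_spec.1, isMaxOn_iff.1 h.choose_spec.2⟩

theorem omega_add_one {φ : ℝ → EReal} {μ : Measure ℝ} (h : ∫⁻ x, EReal.exp (φ x) = 1) :
    omega φ μ + ((1 : ℝ) : EReal) = extIntegral φ μ := by
  rw [omega, h, EReal.coe_ennreal_one, ← EReal.coe_one, EReal.sub_add_cancel]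

section Identify

variable {μ : Measure ℝ} [IsProbabilityMeasure μ]

theorem isProj_logProjection (hμ : Integrable (fun x : ℝ => x) μ) (hN : Nondeg μ) :
    IsProj (logProjection μ) μ := by
  obtain ⟨φ, hφ⟩ := exists_isProj hμ hN
  exact argmaxOn_spec hφ.1 hφ.2

/-- The maximum likelihood log-density is a log-concave projection. -/
theorem isProj_argmaxOn_logDensities (hμ : Integrable (fun x : ℝ => x) μ) (hN : Nondeg μ) :
    IsProj (argmaxOn logDensities fun φ => extIntegral φ μ) μ := by
  obtain ⟨φ, hφ⟩ := exists_isProj hμ hN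
  have hφ1 := hφ.lintegral_exp hμ hN
  -- On log-densities the criterion is the normalized log-likelihood minus one, and the
  -- unconstrained projection is itself a log-density.
  obtain ⟨h1, h2⟩ := argmaxOn_spec (S := logDensities) (J := fun φ => extIntegral φ μ)
    ⟨hφ.1, hφ1⟩ fun ψ hψ => by
      rw [← omega_add_one hψ.2, ← omega_add_one hφ1]
      exact add_le_add (hφ.2 ψ hψ.1) le_rfl
  set χ := argmaxOn logDensities fun φ => extIntegral φ μ
  have h3 : extIntegral φ μ ≤ extIntegral χ μ := h2 φ ⟨hφ.1, hφ1⟩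
  refine ⟨h1.1, fun ψ hψ => (hφ.2 ψ hψ).trans ?_⟩
  have e : ∀ {η : ℝ → EReal}, ∫⁻ x, EReal.exp (η x) = 1 →
      omega η μ = extIntegral η μ - ((1 : ℝ) : EReal) := fun h => by
    rw [omega, h, EReal.coe_ennreal_one, EReal.coe_one]
  rw [e hφ1, e h1.2]
  exact EReal.sub_le_sub h3 le_rfl

end Identify

/-! ### Translations, reflections and symmetrization. -/

/-- The image of a measure under `y ↦ s * (y - θ)`. -/
def shiftMeas (s θ : ℝ) (μ : Measure ℝ) : Measure ℝ := μ.map fun y => s * (y - θ)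

theorem measurable_shift (s θ : ℝ) : Measurable fun y : ℝ => s * (y - θ) := by fun_prop

theorem lintegral_shiftMeas {s θ : ℝ} {μ : Measure ℝ} {f : ℝ → ℝ≥0∞} (hf : Measurable f) :
    ∫⁻ x, f x ∂shiftMeas s θ μ = ∫⁻ y, f (s * (y - θ)) ∂μ :=
  lintegral_map hf (measurable_shift s θ)

theorem integral_shiftMeas {s θ : ℝ} {μ : Measure ℝ} {f : ℝ → ℝ} (hf : Measurable f) :
    ∫ x, f x ∂shiftMeas s θ μ = ∫ y, f (s * (y - θ)) ∂μ :=
  integral_map (measurable_shift s θ).aemeasurable hf.aestronglyMeasurable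

instance (s θ : ℝ) (μ : Measure ℝ) [IsProbabilityMeasure μ] :
    IsProbabilityMeasure (shiftMeas s θ μ) :=
  Measure.isProbabilityMeasure_map (measurable_shift s θ).aemeasurable

theorem integrable_id_shiftMeas {s θ : ℝ} {μ : Measure ℝ} [IsProbabilityMeasure μ]
    (h : Integrable (fun x : ℝ => x) μ) : Integrable (fun x : ℝ => x) (shiftMeas s θ μ) := by
  refine (integrable_map_measure (by fun_prop) (measurable_shift s θ).aemeasurable).2 ?_
  exact (h.sub (integrable_const θ)).const_mul s

/-- Choose `c` to be the mean, so that the two hinge integrals agree. If they vanished, both hinges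
would be zero almost everywhere and `μ` would sit at `c`. -/
theorem nondeg_of_not_ae_eq {μ : Measure ℝ} [IsProbabilityMeasure μ]
    (h : Integrable (fun x : ℝ => x) μ) (hne : ∀ c : ℝ, ¬ ∀ᵐ x ∂μ, x = c) : Nondeg μ := by
  set c := ∫ x, x ∂μ
  have i1 := integrable_of_lipschitz h (lipschitzWith_posPart_sub c)
  have i2 := integrable_of_lipschitz h (lipschitzWith_posPart_sub' c)
  have hdiff : ∫ x, max (x - c) 0 ∂μ - ∫ x, max (c - x) 0 ∂μ = 0 := by
    rw [← integral_sub i1 i2]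
    have e : ∀ x : ℝ, max (x - c) 0 - max (c - x) 0 = x - c := fun x => by
      rcases le_total x c with hx | hx
      · rw [max_eq_right (by linarith), max_eq_left (by linarith)]; ring
      · rw [max_eq_left (by linarith), max_eq_right (by linarith)]; ring
    simp only [e]
    rw [integral_sub h (integrable_const c)]
    simp [c]
  have hpos : 0 < ∫ x, max (x - c) 0 ∂μ := by
    refine (integral_nonneg fun x : ℝ => le_max_right (x - c) 0).lt_of_ne fun h0 => hne c ?_
    have n1 : (0 : ℝ → ℝ) ≤ fun x => max (x - c) 0 := fun x => le_max_right _ _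
    have n2 : (0 : ℝ → ℝ) ≤ fun x => max (c - x) 0 := fun x => le_max_right _ _
    have z1 := (integral_eq_zero_iff_of_nonneg n1 i1).1 h0.symm
    have z2 := (integral_eq_zero_iff_of_nonneg n2 i2).1 (by linarith)
    filter_upwards [z1, z2] with x h1 h2
    simp only [Pi.zero_apply, max_eq_right_iff] at h1 h2
    linarith
  exact ⟨c, hpos, by linarith⟩

theorem Nondeg.not_ae_eq {μ : Measure ℝ} [IsProbabilityMeasure μ] (h : Nondeg μ) (c : ℝ) :
    ¬ ∀ᵐ x ∂μ, x = c := by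
  intro hae
  obtain ⟨d, h1, h2⟩ := h
  rw [integral_congr_ae (g := fun _ => max (c - d) 0) (hae.mono fun x hx => by simp [hx])] at h1
  rw [integral_congr_ae (g := fun _ => max (d - c) 0) (hae.mono fun x hx => by simp [hx])] at h2
  simp only [integral_const, probReal_univ, one_smul, lt_max_iff, lt_self_iff_false, or_false]
    at h1 h2
  linarith

theorem Nondeg.shiftMeas {s θ : ℝ} (hs : s = 1 ∨ s = -1) {μ : Measure ℝ} [IsProbabilityMeasure μ]
    (h : Integrable (fun x : ℝ => x) μ) (hN : Nondeg μ) : Nondeg (shiftMeas s θ μ) := by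
  refine nondeg_of_not_ae_eq (integrable_id_shiftMeas h) fun c hc => hN.not_ae_eq (s * c + θ) ?_
  have := ae_of_ae_map (measurable_shift s θ).aemeasurable hc
  filter_upwards [this] with x hx
  rcases hs with rfl | rfl <;> linarith

theorem lintegral_comp_affine {s : ℝ} (hs : s = 1 ∨ s = -1) (t : ℝ) (f : ℝ → ℝ≥0∞) :
    ∫⁻ x, f (s * x + t) = ∫⁻ x, f x := by
  rcases hs with rfl | rfl
  · simpa only [one_mul] using lintegral_add_right_eq_self f t
  · have := lintegral_sub_left_eq_self (μ := volume) f t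
    simpa only [neg_mul, one_mul, neg_add_eq_sub] using this

theorem omega_comp_affine {φ : ℝ → EReal} (hφ : Measurable φ) {s : ℝ} (hs : s = 1 ∨ s = -1)
    (t : ℝ) (μ : Measure ℝ) : omega (fun x => φ (s * x + t)) (shiftMeas s t μ) = omega φ μ := by
  have e : ∀ y : ℝ, s * (s * (y - t)) + t = y := fun y => by
    rcases hs with rfl | rfl <;> ring
  have hm : Measurable fun x : ℝ => s * x + t := by fun_prop
  unfold omega extIntegral
  rw [lintegral_shiftMeas (f := fun x => (φ (s * x + t)).toENNReal)
      (hφ.comp hm).ereal_toENNReal,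
    lintegral_shiftMeas (f := fun x => (-φ (s * x + t)).toENNReal)
      (hφ.comp hm).neg.ereal_toENNReal,
    lintegral_comp_affine hs t fun x => EReal.exp (φ x)]
  simp only [e]

/-- Equivariance of the log-concave projection under isometries of the line. -/
theorem IsProj.comp_affine {φ : ℝ → EReal} {μ : Measure ℝ} (h : IsProj φ μ) {s : ℝ}
    (hs : s = 1 ∨ s = -1) (t : ℝ) : IsProj (fun x => φ (s * x + t)) (shiftMeas s t μ) := by
  have hs0 : s ≠ 0 := by rcases hs with rfl | rfl <;> norm_num
  refine ⟨comp_affine_mem_concaveClass h.1 hs0 t, fun ψ hψ => ?_⟩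
  rw [omega_comp_affine (measurable_of_mem h.1) hs]
  have hψ' := comp_affine_mem_concaveClass hψ hs0 (-(s * t))
  have e := omega_comp_affine (measurable_of_mem hψ') hs t μ
  have e2 : ∀ x : ℝ, s * (s * x + t) + -(s * t) = x := fun x => by
    rcases hs with rfl | rfl <;> ring
  simp only [e2] at e
  rw [e]
  exact h.2 _ hψ'

/-- The shift is moved into the integrand, where varying `θ k` gives an equi-Lipschitz, pointwise
convergent family; joint convergence does the rest. -/
theorem W1Conv.shiftMeas {μ : ℕ → Measure ℝ} {μ₀ : Measure ℝ} (h : W1Conv μ μ₀) {θ : ℕ → ℝ}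
    {θ₀ : ℝ} (hθ : Tendsto θ atTop (𝓝 θ₀)) (s : ℝ) :
    W1Conv (fun k => shiftMeas s (θ k) (μ k)) (shiftMeas s θ₀ μ₀) := by
  have := h.prob
  have := h.prob_lim
  refine ⟨fun k => inferInstance, inferInstance,
    fun k => integrable_id_shiftMeas (h.integrable_id k),
    integrable_id_shiftMeas h.integrable_id_lim, fun K g hg => ?_⟩
  simp only [integral_shiftMeas hg.continuous.measurable]
  have hlip : ∀ t : ℝ, LipschitzWith (K * ‖s‖₊) fun y => g (s * (y - t)) := fun t => by
    refine hg.comp (LipschitzWith.of_dist_le_mul fun x y => le_of_eq ?_)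
    rw [Real.dist_eq, Real.dist_eq, ← mul_sub, abs_mul]
    simp
  refine h.tendsto_integral (fun k => hlip (θ k)) fun y => ?_
  exact (hg.continuous.tendsto _).comp ((tendsto_const_nhds.sub hθ).const_mul s)

/-- The average of the two images of a measure under `y ↦ y - θ` and `y ↦ θ - y`. -/
def symMeas (θ : ℝ) (μ : Measure ℝ) : Measure ℝ :=
  (2 : ℝ≥0∞)⁻¹ • (shiftMeas 1 θ μ + shiftMeas (-1) θ μ)

instance (θ : ℝ) (μ : Measure ℝ) [IsProbabilityMeasure μ] :
    IsProbabilityMeasure (symMeas θ μ) := ⟨by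
  simp only [symMeas, Measure.smul_apply, Measure.add_apply, measure_univ, smul_eq_mul]
  rw [one_add_one_eq_two]
  exact ENNReal.inv_mul_cancel two_ne_zero ENNReal.ofNat_ne_top⟩

theorem lintegral_symMeas {θ : ℝ} {μ : Measure ℝ} {f : ℝ → ℝ≥0∞} (hf : Measurable f) :
    ∫⁻ x, f x ∂symMeas θ μ =
      2⁻¹ * (∫⁻ y, f (1 * (y - θ)) ∂μ + ∫⁻ y, f (-1 * (y - θ)) ∂μ) := by
  rw [symMeas, lintegral_smul_measure, lintegral_add_measure, lintegral_shiftMeas hf,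
    lintegral_shiftMeas hf, smul_eq_mul]

theorem W1Conv.symMeas {μ : ℕ → Measure ℝ} {μ₀ : Measure ℝ} (h : W1Conv μ μ₀) {θ : ℕ → ℝ}
    {θ₀ : ℝ} (hθ : Tendsto θ atTop (𝓝 θ₀))
    (hsym : LogConcaveLocation.shiftMeas (-1) θ₀ μ₀ = LogConcaveLocation.shiftMeas 1 θ₀ μ₀) :
    W1Conv (fun k => symMeas (θ k) (μ k)) (LogConcaveLocation.shiftMeas 1 θ₀ μ₀) := by
  have := h.prob
  have := h.prob_lim
  have h1 := h.shiftMeas hθ 1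
  have h2 := h.shiftMeas hθ (-1)
  rw [hsym] at h2
  refine ⟨fun k => inferInstance, inferInstance, fun k => ?_,
    integrable_id_shiftMeas h.integrable_id_lim, fun K g hg => ?_⟩
  · exact ((h1.integrable_id k).add_measure (h2.integrable_id k)).smul_measure
      (ENNReal.inv_ne_top.2 two_ne_zero)
  · have e : ∀ k, ∫ x, g x ∂LogConcaveLocation.symMeas (θ k) (μ k) =
        (2 : ℝ)⁻¹ * (∫ x, g x ∂LogConcaveLocation.shiftMeas 1 (θ k) (μ k) +
          ∫ x, g x ∂LogConcaveLocation.shiftMeas (-1) (θ k) (μ k)) := fun k => by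
      rw [LogConcaveLocation.symMeas, integral_smul_measure, integral_add_measure
        (integrable_of_lipschitz (h1.integrable_id k) hg)
        (integrable_of_lipschitz (h2.integrable_id k) hg)]
      simp
    simp only [e]
    have := ((h1.tendsto K g hg).add (h2.tendsto K g hg)).const_mul (2 : ℝ)⁻¹
    convert this using 2
    ring

theorem integrable_id_symMeas {θ : ℝ} {μ : Measure ℝ} [IsProbabilityMeasure μ]
    (h : Integrable (fun x : ℝ => x) μ) : Integrable (fun x : ℝ => x) (symMeas θ μ) :=
  ((integrable_id_shiftMeas h).add_measure (integrable_id_shiftMeas h)).smul_measure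
      (ENNReal.inv_ne_top.2 two_ne_zero)

/-- An even function has the same integral against both images in the symmetrization, and Lebesgue
measure ignores the translation by `θ`. -/
theorem Psi_eq_omega {θ : ℝ} {ψ : ℝ → EReal} (hψ : ψ ∈ symmetricConcaveClass 0) (μ : Measure ℝ) :
    Psi θ ψ μ = omega ψ (symMeas θ μ) := by
  have hm := measurable_of_mem hψ.1
  have heven : ∀ y : ℝ, ψ (-1 * (y - θ)) = ψ (1 * (y - θ)) := fun y => by
    have := hψ.2 (1 * (y - θ))
    rw [zero_add, zero_sub] at this
    rw [this]
    congr 1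
    ring
  have htwo : ∀ a : ℝ≥0∞, 2⁻¹ * (a + a) = a := fun a => by
    rw [← two_mul, ← mul_assoc, ENNReal.inv_mul_cancel two_ne_zero ENNReal.ofNat_ne_top, one_mul]
  unfold Psi omega extIntegral
  rw [lintegral_symMeas hm.ereal_toENNReal,
    lintegral_symMeas (f := fun x => (-ψ x).toENNReal) hm.neg.ereal_toENNReal,
    lintegral_sub_right_eq_self (fun x => EReal.exp (ψ x)) θ]
  simp only [heven, htwo, one_mul]

theorem shiftMeas_neg_symMeas (θ : ℝ) (μ : Measure ℝ) :
    shiftMeas (-1) 0 (symMeas θ μ) = symMeas θ μ := by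
  refine Measure.ext_of_lintegral _ fun f hf => ?_
  rw [lintegral_shiftMeas hf, lintegral_symMeas (f := fun x => f (-1 * (x - 0))) (by fun_prop),
    lintegral_symMeas hf, add_comm]
  congr! 5 <;> ring

/-- The partial maximum likelihood log-density is the log-concave projection of the symmetrized
measure. -/
theorem isProj_argmaxOn_symmetricConcaveClass {θ : ℝ} {μ : Measure ℝ} [IsProbabilityMeasure μ]
    (hμ : Integrable (fun x : ℝ => x) μ) (hN : Nondeg (symMeas θ μ)) :
    IsProj (argmaxOn (symmetricConcaveClass 0) fun ψ => Psi θ ψ μ) (symMeas θ μ) := by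
  set ν := symMeas θ μ
  have hν : Integrable (fun x : ℝ => x) ν := integrable_id_symMeas hμ
  obtain ⟨φ, hφ⟩ := exists_isProj hν hN
  -- Since `ν` is reflection invariant, the reflected projection is again one. Their midpoint is
  -- even and no worse, so restricting to even functions does not lower the maximum.
  have hφ' := hφ.comp_affine (s := -1) (Or.inr rfl) 0
  rw [shiftMeas_neg_symMeas] at hφ'
  obtain ⟨hne, hreg, -, hmid⟩ := IsRegular.midpt hφ.1 hφ'.1 (hφ.isRegular hν) (hφ'.isRegular hν)
  have hm := midpt_mem hφ.1 hφ'.1 hne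
  have hmS : midpt φ (fun x => φ (-1 * x + 0)) ∈ symmetricConcaveClass 0 := by
    refine ⟨hm, fun x => ?_⟩
    simp only [midpt]
    rw [add_comm (φ (0 - x))]
    congr 3 <;> ring
  have hmax : omega φ ν ≤ omega (midpt φ fun x => φ (-1 * x + 0)) ν := by
    have h1 := hφ'.realOmega_le hν hφ.1 (hφ.isRegular hν)
    have h2 : 0 ≤ ∫ x, (√(expFun φ x) - √(expFun (fun x => φ (-1 * x + 0)) x)) ^ 2 :=
      integral_nonneg fun _ => sq_nonneg _
    rw [omega_eq_coe hm hreg, omega_eq_coe hφ.1 (hφ.isRegular hν), EReal.coe_le_coe_iff, hmid]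
    linarith
  obtain ⟨h1, h2⟩ := argmaxOn_spec (J := fun ψ => Psi θ ψ μ) hmS fun ψ hψ => by
    rw [Psi_eq_omega hψ, Psi_eq_omega hmS]
    exact (hφ.2 ψ hψ.1).trans hmax
  refine ⟨h1.1, fun ψ hψ => (hφ.2 ψ hψ).trans (hmax.trans ?_)⟩
  have := h2 _ hmS
  rwa [Psi_eq_omega hmS, Psi_eq_omega h1] at this

/-! ### Laws with a density and their symmetry. -/

section LawOf

variable {f : ℝ → ℝ}

theorem isProbabilityMeasure_lawOf (hf : f ∈ densities) : IsProbabilityMeasure (lawOf f) :=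
  ⟨by rw [lawOf, withDensity_apply _ MeasurableSet.univ, Measure.restrict_univ, hf.2.2]⟩

theorem integrable_lawOf_iff (hf : f ∈ densities) {g : ℝ → ℝ} :
    Integrable g (lawOf f) ↔ Integrable fun x => g x * f x := by
  rw [lawOf, integrable_withDensity_iff_integrable_smul' hf.1.ennreal_ofReal
    (Eventually.of_forall fun _ => ENNReal.ofReal_lt_top)]
  refine integrable_congr (Eventually.of_forall fun x => ?_)
  simp [ENNReal.toReal_ofReal (hf.2.1 x), mul_comm]

theorem integral_lawOf (hf : f ∈ densities) (g : ℝ → ℝ) :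
    ∫ x, g x ∂lawOf f = ∫ x, g x * f x := by
  rw [lawOf, integral_withDensity_eq_integral_toReal_smul hf.1.ennreal_ofReal
    (Eventually.of_forall fun _ => ENNReal.ofReal_lt_top)]
  refine integral_congr_ae (Eventually.of_forall fun x => ?_)
  simp [ENNReal.toReal_ofReal (hf.2.1 x), mul_comm]

theorem integrable_id_lawOf (hf : f ∈ densities) (h : Integrable fun x => |x| * f x) :
    Integrable (fun x : ℝ => x) (lawOf f) := by
  have := (integrable_lawOf_iff hf (g := fun x => |x|)).2 h
  exact this.mono' (by fun_prop) (Eventually.of_forall fun x => le_rfl)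

theorem nondeg_lawOf (hf : f ∈ densities) (h : Integrable fun x => |x| * f x) :
    Nondeg (lawOf f) := by
  have := isProbabilityMeasure_lawOf hf
  refine nondeg_of_not_ae_eq (integrable_id_lawOf hf h) fun c hc => ?_
  have h1 : lawOf f {c} = 1 := by
    rw [← prob_compl_eq_zero_iff (measurableSet_singleton c)]
    exact hc
  have h2 : lawOf f {c} = 0 :=
    withDensity_absolutelyContinuous volume _ (Real.volume_singleton)
  rw [h2] at h1
  exact zero_ne_one h1

/-- The law of a symmetric density is invariant under reflection. -/
theorem shiftMeas_neg_lawOf {θ : ℝ} (hf : f ∈ symmetricDensities θ) :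
    shiftMeas (-1) (2 * θ) (lawOf f) = lawOf f := by
  have hm := hf.1.1.ennreal_ofReal
  refine Measure.ext_of_lintegral _ fun g hg => ?_
  rw [lintegral_shiftMeas hg, lawOf,
    lintegral_withDensity_eq_lintegral_mul _ hm (g := fun y => g (-1 * (y - 2 * θ)))
      (hg.comp (measurable_shift (-1) (2 * θ))),
    lintegral_withDensity_eq_lintegral_mul _ hm hg,
    ← lintegral_comp_affine (s := -1) (Or.inr rfl) (2 * θ)]
  refine lintegral_congr fun x => ?_
  have h1 : f (-1 * x + 2 * θ) = f x := by
    have := hf.2 (θ - x)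
    rwa [sub_sub_cancel, show θ + (θ - x) = -1 * x + 2 * θ by ring] at this
  simp only [Pi.mul_apply]
  rw [h1, show -1 * (-1 * x + 2 * θ - 2 * θ) = x by ring]

theorem shiftMeas_comp_reflect (θ : ℝ) (μ : Measure ℝ) :
    shiftMeas 1 θ (shiftMeas (-1) (2 * θ) μ) = shiftMeas (-1) θ μ := by
  refine Measure.ext_of_lintegral _ fun g hg => ?_
  rw [lintegral_shiftMeas hg, lintegral_shiftMeas hg,
    lintegral_shiftMeas (f := fun y => g (1 * (y - θ))) (by fun_prop)]
  refine lintegral_congr fun x => ?_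
  congr 1
  ring

theorem shiftMeas_neg_eq_of_symmetric {θ : ℝ} (hf : f ∈ symmetricDensities θ) :
    shiftMeas (-1) θ (lawOf f) = shiftMeas 1 θ (lawOf f) := by
  rw [← shiftMeas_comp_reflect, shiftMeas_neg_lawOf hf]

end LawOf

/-! ### The L¹ distance. -/

section L1

theorem L1dist_eq_lintegral (f g : ℝ → ℝ) : L1dist f g = ∫⁻ x, ‖f x - g x‖ₑ := by
  rw [L1dist, eLpNorm_one_eq_lintegral_enorm]
  rfl

theorem L1dist_eq_ofReal {f g : ℝ → ℝ} (hf : Integrable f) (hg : Integrable g) :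
    L1dist f g = ENNReal.ofReal (∫ x, |f x - g x|) := by
  rw [L1dist_eq_lintegral]
  exact (ofReal_integral_norm_eq_lintegral_enorm (hf.sub hg)).symm

theorem L1dist_le_of_abs_le {f g a b : ℝ → ℝ} (ha : Measurable a) (hg : Measurable g)
    (h : ∀ x, |f x - g x| ≤ |a x - g x| + |b x - g x|) :
    L1dist f g ≤ L1dist a g + L1dist b g := by
  simp only [L1dist_eq_lintegral]
  rw [← lintegral_add_left (by fun_prop)]
  refine lintegral_mono fun x => ?_
  simp only [Real.enorm_eq_ofReal_abs]
  rw [← ENNReal.ofReal_add (abs_nonneg _) (abs_nonneg _)]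
  exact ENNReal.ofReal_le_ofReal (h x)

theorem tendsto_zero_of_le_add {u v w : ℕ → ℝ≥0∞} (hv : Tendsto v atTop (𝓝 0))
    (hw : Tendsto w atTop (𝓝 0)) (h : ∀ᶠ k in atTop, u k ≤ v k + w k) :
    Tendsto u atTop (𝓝 0) := by
  have hvw := hv.add hw
  rw [add_zero] at hvw
  exact tendsto_of_tendsto_of_tendsto_of_le_of_le' tendsto_const_nhds hvw
    (Eventually.of_forall fun _ => zero_le) h

theorem W1Conv.tendsto_L1dist {μ : ℕ → Measure ℝ} {μ₀ : Measure ℝ} {φ : ℕ → ℝ → EReal}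
    {φ₀ : ℝ → EReal} (h : W1Conv μ μ₀) (hN : Nondeg μ₀)
    (hφ : ∀ᶠ k in atTop, IsProj (φ k) (μ k)) (h₀ : IsProj φ₀ μ₀) :
    Tendsto (fun k => L1dist (expFun (φ k)) (expFun φ₀)) atTop (𝓝 0) := by
  have := h.prob
  have := h.prob_lim
  have hlim := ENNReal.tendsto_ofReal (h.tendsto_integral_abs_sub hN hφ h₀)
  rw [ENNReal.ofReal_zero] at hlim
  refine hlim.congr' ?_
  filter_upwards [hφ] with k hk
  rw [L1dist_eq_ofReal
    (integrable_expFun hk.1 (hk.isRegular (h.integrable_id k)).lintegral_ne_top)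
    (integrable_expFun h₀.1 (h₀.isRegular h.integrable_id_lim).lintegral_ne_top)]

/-- The geometric mean lies between `a` and `b`, so its distance to `g` is at most the larger of
their distances. -/
theorem abs_sqrt_mul_sub_le {a b : ℝ} (ha : 0 ≤ a) (hb : 0 ≤ b) (g : ℝ) :
    |√(a * b) - g| ≤ |a - g| + |b - g| := by
  have hmul : √(a * b) * √(a * b) = a * b := Real.mul_self_sqrt (mul_nonneg ha hb)
  have h0 := Real.sqrt_nonneg (a * b)
  have hmin : min a b ≤ √(a * b) := Real.le_sqrt_of_sq_le (by
    rcases le_total a b with h | h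
    · rw [min_eq_left h]; nlinarith
    · rw [min_eq_right h]; nlinarith)
  have hmax : √(a * b) ≤ max a b := Real.sqrt_le_iff.2 ⟨le_max_of_le_left ha, by
    rcases le_total a b with h | h
    · rw [max_eq_right h]; nlinarith
    · rw [max_eq_left h]; nlinarith⟩
  rcases le_total a b with h | h
  · rw [min_eq_left h] at hmin
    rw [max_eq_right h] at hmax
    rw [abs_le]
    constructor
    · linarith [neg_abs_le (a - g), abs_nonneg (b - g)]
    · linarith [le_abs_self (b - g), abs_nonneg (a - g)]
  · rw [min_eq_right h] at hmin
    rw [max_eq_left h] at hmax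
    rw [abs_le]
    constructor
    · linarith [neg_abs_le (b - g), abs_nonneg (a - g)]
    · linarith [le_abs_self (a - g), abs_nonneg (b - g)]

/-- Normalizing a nonnegative function close to a density at most doubles the distance. -/
theorem L1dist_normalize_le {h g : ℝ → ℝ} (hh : Integrable h) (hg : Integrable g)
    (hh0 : ∀ x, 0 ≤ h x) (hg1 : ∫ x, g x = 1) (hlt : L1dist h g < 1) :
    L1dist (fun x => (∫ z, h z)⁻¹ * h x) g ≤ L1dist h g + L1dist h g := by
  rw [L1dist_eq_ofReal hh hg] at hlt ⊢
  rw [L1dist_eq_ofReal (hh.const_mul _) hg,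
    ← ENNReal.ofReal_add (integral_nonneg fun _ => abs_nonneg _)
      (integral_nonneg fun _ => abs_nonneg _)]
  refine ENNReal.ofReal_le_ofReal ?_
  rw [ENNReal.ofReal_lt_one] at hlt
  set I := ∫ z, h z
  have hI : |I - 1| ≤ ∫ x, |h x - g x| := by
    rw [← hg1, ← integral_sub hh hg]
    exact abs_integral_le_integral_abs
  have hIpos : 0 < I := by
    have := neg_abs_le (I - 1)
    linarith
  have hs : Integrable fun x => |h x - g x| := (hh.sub hg).abs
  calc ∫ x, |I⁻¹ * h x - g x| ≤ ∫ x, (|I⁻¹ - 1| * h x + |h x - g x|) := by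
        refine integral_mono ((hh.const_mul _).sub hg).abs ((hh.const_mul _).add hs) fun x => ?_
        have : I⁻¹ * h x - g x = (I⁻¹ - 1) * h x + (h x - g x) := by ring
        simp only
        rw [this]
        refine (abs_add_le _ _).trans (le_of_eq ?_)
        rw [abs_mul, abs_of_nonneg (hh0 x)]
    _ = |I⁻¹ - 1| * I + ∫ x, |h x - g x| := by
        rw [integral_add (hh.const_mul _) hs, integral_const_mul]
    _ ≤ _ := by
        have : |I⁻¹ - 1| * I = |I - 1| := by
          rw [← abs_of_pos hIpos, ← abs_mul, abs_of_pos hIpos, abs_sub_comm I 1]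
          congr 1
          field_simp
        rw [this]
        linarith

end L1

/-! ### Deterministic consistency of the three unsmoothed estimators. -/

section Estimators

variable {f₀ : ℝ → ℝ} {θ₀ : ℝ} {n : ℕ → ℕ} {x : ℕ → ℕ → ℝ} {θ : ℕ → ℝ}

/-- The maximum likelihood log-density. -/
def logMLE (n : ℕ) (x : ℕ → ℝ) : ℝ → EReal :=
  argmaxOn logDensities fun φ => extIntegral φ (empiricalMeasure n x)

theorem Tight.exists_abs_expFun_le {B : ℝ} {φ : ℝ → EReal} (h : Tight B φ)
    (hφ : φ ∈ concaveClass) (hB : 0 < B) : ∃ C, ∀ z, |expFun φ z| ≤ C := by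
  refine ⟨Real.exp B, fun z => ?_⟩
  have h2 : Real.exp (-B⁻¹ * |z|) ≤ 1 := by
    rw [Real.exp_le_one_iff, neg_mul, neg_nonpos]
    positivity
  rw [abs_of_nonneg (expFun_nonneg φ z)]
  exact (h.expFun_le hφ z).trans (mul_le_of_le_one_right (Real.exp_pos B).le h2)

theorem eventually_isProj_logMLE {μ₀ : Measure ℝ}
    (h : W1Conv (fun k => empiricalMeasure (n k) (x k)) μ₀) (hN : Nondeg μ₀) :
    ∀ᶠ k in atTop, IsProj (logMLE (n k) (x k)) (empiricalMeasure (n k) (x k)) := by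
  have := h.prob
  filter_upwards [h.eventually_nondeg hN] with k hk
  exact isProj_argmaxOn_logDensities (h.integrable_id k) hk

variable (hf₀ : f₀ ∈ symmetricDensities θ₀) (hm : Integrable fun x => |x| * f₀ x)
  (hW : W1Conv (fun k => empiricalMeasure (n k) (x k)) (lawOf f₀))
  (hθ : Tendsto θ atTop (𝓝 θ₀))

include hf₀ hm

theorem isProj_logProjection_lawOf : IsProj (logProjection (lawOf f₀)) (lawOf f₀) := by
  have := isProbabilityMeasure_lawOf hf₀.1
  exact isProj_logProjection (integrable_id_lawOf hf₀.1 hm) (nondeg_lawOf hf₀.1 hm)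

theorem isProj_centred :
    IsProj (fun x => logProjection (lawOf f₀) (x + θ₀)) (shiftMeas 1 θ₀ (lawOf f₀)) := by
  have := (isProj_logProjection_lawOf hf₀ hm).comp_affine (s := 1) (Or.inl rfl) θ₀
  simpa only [one_mul] using this

theorem nondeg_shiftMeas_lawOf : Nondeg (shiftMeas 1 θ₀ (lawOf f₀)) := by
  have := isProbabilityMeasure_lawOf hf₀.1
  exact (nondeg_lawOf hf₀.1 hm).shiftMeas (Or.inl rfl) (integrable_id_lawOf hf₀.1 hm)

include hW hθ

/-- The recentred or reflected MLE is a projection of the correspondingly moved empirical measure.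
For `s = -1` the limit law is the same by symmetry of the density, so both halves of a symmetrized
estimator share one limit. -/
theorem tendsto_L1dist_mle_shift {s : ℝ} (hs : s = 1 ∨ s = -1) :
    Tendsto (fun k => L1dist (fun z => mle (n k) (x k) (s * z + θ k)) (centredProj f₀ θ₀))
      atTop (𝓝 0) := by
  have hlim := hW.shiftMeas hθ s
  have hsym : shiftMeas s θ₀ (lawOf f₀) = shiftMeas 1 θ₀ (lawOf f₀) := by
    rcases hs with rfl | rfl
    · rfl
    · exact shiftMeas_neg_eq_of_symmetric hf₀
  rw [hsym] at hlim
  refine hlim.tendsto_L1dist (nondeg_shiftMeas_lawOf hf₀ hm) ?_ (isProj_centred hf₀ hm)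
  filter_upwards [eventually_isProj_logMLE hW (nondeg_lawOf hf₀.1 hm)] with k hk
  exact hk.comp_affine hs (θ k)

omit hθ in
theorem eventually_mle_regular : ∀ᶠ k in atTop, Measurable (mle (n k) (x k)) ∧
    Integrable (mle (n k) (x k)) ∧ ∃ C, ∀ z, |mle (n k) (x k) z| ≤ C := by
  have := hW.prob
  filter_upwards [eventually_isProj_logMLE hW (nondeg_lawOf hf₀.1 hm),
    hW.eventually_nondeg (nondeg_lawOf hf₀.1 hm)] with k hk hN
  refine ⟨measurable_expFun hk.1, integrable_expFun hk.1
    (hk.isRegular (hW.integrable_id k)).lintegral_ne_top, ?_⟩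
  obtain ⟨B, hB, hT⟩ := hk.exists_tight (hW.integrable_id k) hN
  exact hT.exists_abs_expFun_le hk.1 hB

theorem tendsto_L1dist_symEstimator :
    Tendsto (fun k => L1dist (symEstimator (n k) (x k) (θ k)) (centredProj f₀ θ₀))
      atTop (𝓝 0) := by
  have hg : Measurable (centredProj f₀ θ₀) := measurable_expFun (isProj_centred hf₀ hm).1
  refine tendsto_zero_of_le_add (tendsto_L1dist_mle_shift hf₀ hm hW hθ (Or.inl rfl))
    (tendsto_L1dist_mle_shift hf₀ hm hW hθ (Or.inr rfl)) ?_
  filter_upwards [eventually_mle_regular hf₀ hm hW] with k hk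
  refine L1dist_le_of_abs_le (hk.1.comp (by fun_prop)) hg fun z => ?_
  rw [symEstimator, show θ k + z = 1 * z + θ k by ring, show θ k - z = -1 * z + θ k by ring]
  set a := mle (n k) (x k) (1 * z + θ k)
  set b := mle (n k) (x k) (-1 * z + θ k)
  set g := centredProj f₀ θ₀ z
  have e : 1 / 2 * (a + b) - g = (a - g) / 2 + (b - g) / 2 := by ring
  rw [e]
  refine (abs_add_le _ _).trans ?_
  rw [abs_div, abs_div, abs_two]
  linarith [abs_nonneg (a - g), abs_nonneg (b - g)]

theorem tendsto_L1dist_partialMLE :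
    Tendsto (fun k => L1dist (partialMLE (n k) (x k) (θ k)) (centredProj f₀ θ₀))
      atTop (𝓝 0) := by
  have hlim := hW.symMeas hθ (shiftMeas_neg_eq_of_symmetric hf₀)
  have := hW.prob
  refine hlim.tendsto_L1dist (nondeg_shiftMeas_lawOf hf₀ hm) ?_ (isProj_centred hf₀ hm)
  filter_upwards [hlim.eventually_nondeg (nondeg_shiftMeas_lawOf hf₀ hm)] with k hk
  exact isProj_argmaxOn_symmetricConcaveClass (hW.integrable_id k) hk

omit hW hθ in
theorem integrable_centredProj : Integrable (centredProj f₀ θ₀) ∧ ∫ z, centredProj f₀ θ₀ z = 1 := by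
  have := isProbabilityMeasure_lawOf hf₀.1
  have h1 := isProj_centred hf₀ hm
  have h2 := integrable_id_shiftMeas (s := 1) (θ := θ₀) (integrable_id_lawOf hf₀.1 hm)
  exact ⟨integrable_expFun h1.1 (h1.isRegular h2).lintegral_ne_top,
    integral_expFun_eq_one h1.1 (h1.lintegral_exp h2 (nondeg_shiftMeas_lawOf hf₀ hm))⟩

theorem tendsto_L1dist_geoEstimator :
    Tendsto (fun k => L1dist (geoEstimator (n k) (x k) (θ k)) (centredProj f₀ θ₀))
      atTop (𝓝 0) := by
  have hg : Measurable (centredProj f₀ θ₀) := measurable_expFun (isProj_centred hf₀ hm).1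
  obtain ⟨hgi, hg1⟩ := integrable_centredProj hf₀ hm
  have hgeo : Tendsto (fun k => L1dist
      (fun z => √(mle (n k) (x k) (θ k + z) * mle (n k) (x k) (θ k - z))) (centredProj f₀ θ₀))
      atTop (𝓝 0) := by
    refine tendsto_zero_of_le_add (tendsto_L1dist_mle_shift hf₀ hm hW hθ (Or.inl rfl))
      (tendsto_L1dist_mle_shift hf₀ hm hW hθ (Or.inr rfl)) ?_
    filter_upwards [eventually_mle_regular hf₀ hm hW] with k hk
    refine L1dist_le_of_abs_le (hk.1.comp (by fun_prop)) hg fun z => ?_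
    rw [show θ k + z = 1 * z + θ k by ring, show θ k - z = -1 * z + θ k by ring]
    exact abs_sqrt_mul_sub_le (expFun_nonneg _ _) (expFun_nonneg _ _) _
  refine tendsto_zero_of_le_add hgeo hgeo ?_
  filter_upwards [eventually_mle_regular hf₀ hm hW,
    hgeo.eventually (gt_mem_nhds zero_lt_one)] with k hk hlt
  refine L1dist_normalize_le ?_ hgi (fun z => Real.sqrt_nonneg _) hg1 hlt
  have ha : Integrable fun z => mle (n k) (x k) (θ k + z) := hk.2.1.comp_add_left (θ k)
  have hb : Integrable fun z => mle (n k) (x k) (θ k - z) := hk.2.1.comp_sub_left (θ k)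
  refine (ha.add hb).mono' ?_ (Eventually.of_forall fun z => ?_)
  · exact ((hk.1.comp (measurable_const_add _)).mul
      (hk.1.comp (measurable_const_sub _))).sqrt.aestronglyMeasurable
  · rw [Real.norm_of_nonneg (Real.sqrt_nonneg _)]
    have h1 : 0 ≤ mle (n k) (x k) (θ k + z) := expFun_nonneg _ _
    have h2 : 0 ≤ mle (n k) (x k) (θ k - z) := expFun_nonneg _ _
    have := abs_sqrt_mul_sub_le h1 h2 0
    simp only [sub_zero, abs_of_nonneg h1, abs_of_nonneg h2] at this
    exact (le_abs_self _).trans this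

end Estimators

/-! ### Gaussian convolution. -/

section Smoothing

/-- The convolution of `f` with the centred Gaussian distribution of standard deviation `b`. -/
def gaussConv (b : ℝ) (f : ℝ → ℝ) (z : ℝ) : ℝ := ∫ s, f (z - b * s) ∂gaussianReal 0 1

theorem gaussConv_eq_integral_gaussianPDFReal {b : ℝ} (hb : 0 < b) (f : ℝ → ℝ) (z : ℝ) :
    (1 / b) * ∫ t, f (z - t) * gaussianPDFReal 0 1 (t / b) = gaussConv b f z := by
  rw [gaussConv, integral_gaussianReal_eq_integral_smul one_ne_zero]
  have := Measure.integral_comp_mul_left (fun t => f (z - t) * gaussianPDFReal 0 1 (t / b)) b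
  rw [abs_of_pos (inv_pos.2 hb), smul_eq_mul, ← one_div] at this
  rw [← this]
  refine integral_congr_ae (Eventually.of_forall fun s => ?_)
  simp [mul_div_cancel_left₀ s hb.ne', mul_comm]

theorem gaussConv_sqrt {f : ℝ → ℝ} (hf : Measurable f) (v : ℝ) (z : ℝ) :
    gaussConv √v f z = ∫ t, f (z - t) ∂gaussianReal 0 v.toNNReal := by
  have hv : gaussianReal 0 v.toNNReal = (gaussianReal 0 1).map (√v * ·) := by
    rw [gaussianReal_map_const_mul, mul_zero, mul_one]
    congr 1
    ext
    simp only [Real.coe_toNNReal']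
    rcases le_total 0 v with h | h
    · rw [max_eq_left h]; exact (Real.sq_sqrt h).symm
    -- For nonpositive `v` both truncations give zero, that is, a point mass.
    · rw [max_eq_right h, NNReal.coe_mk, Real.sqrt_eq_zero_of_nonpos h, zero_pow two_ne_zero]
  rw [hv]
  exact (integral_map (f := fun t => f (z - t)) (by fun_prop)
    (hf.comp (measurable_const_sub z)).aestronglyMeasurable).symm

/-- Change the function first and the bandwidth second, then apply Tonelli: for fixed `s`,
translation invariance turns the two pieces into the distance of `f` to `g` and of `g` to a
translate of itself. -/
theorem L1dist_gaussConv_le {f g : ℝ → ℝ} (hf : Measurable f) (hg : Measurable g) {C : ℝ}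
    (hfC : ∀ z, |f z| ≤ C) (hgC : ∀ z, |g z| ≤ C) (b b' : ℝ) :
    L1dist (gaussConv b f) (gaussConv b' g) ≤
      L1dist f g + ∫⁻ s, L1dist (fun z => g (z + (b' - b) * s)) g ∂gaussianReal 0 1 := by
  have hfi : ∀ z, Integrable (fun s => f (z - b * s)) (gaussianReal 0 1) := fun z =>
    Integrable.of_bound (Measurable.aestronglyMeasurable (by fun_prop)) C
      (Eventually.of_forall fun s => hfC _)
  have hgi : ∀ z, Integrable (fun s => g (z - b' * s)) (gaussianReal 0 1) := fun z =>
    Integrable.of_bound (Measurable.aestronglyMeasurable (by fun_prop)) C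
      (Eventually.of_forall fun s => hgC _)
  have hpt : ∀ z, ‖gaussConv b f z - gaussConv b' g z‖ₑ ≤ ∫⁻ s, (‖f (z - b * s) - g (z - b * s)‖ₑ +
      ‖g (z - b * s) - g (z - b' * s)‖ₑ) ∂gaussianReal 0 1 := fun z => by
    rw [gaussConv, gaussConv, ← integral_sub (hfi z) (hgi z)]
    refine (enorm_integral_le_lintegral_enorm _).trans (lintegral_mono fun s => ?_)
    rw [show f (z - b * s) - g (z - b' * s) =
      (f (z - b * s) - g (z - b * s)) + (g (z - b * s) - g (z - b' * s)) by ring]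
    exact enorm_add_le _ _
  have hshift : ∀ s, ∫⁻ z, (‖f (z - b * s) - g (z - b * s)‖ₑ +
      ‖g (z - b * s) - g (z - b' * s)‖ₑ) =
      L1dist f g + L1dist (fun z => g (z + (b' - b) * s)) g := fun s => by
    rw [lintegral_add_left (by fun_prop), L1dist_eq_lintegral, L1dist_eq_lintegral,
      lintegral_sub_right_eq_self (fun z => ‖f z - g z‖ₑ),
      ← lintegral_sub_right_eq_self (fun z => ‖g (z + (b' - b) * s) - g z‖ₑ) (b' * s)]
    congr 1
    refine lintegral_congr fun z => ?_
    rw [show z - b' * s + (b' - b) * s = z - b * s by ring]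
  rw [L1dist_eq_lintegral]
  refine (lintegral_mono hpt).trans ?_
  rw [lintegral_lintegral_swap (by fun_prop)]
  simp only [hshift]
  rw [lintegral_add_left measurable_const, lintegral_const, measure_univ, mul_one]

theorem measurable_L1dist_translate {g : ℝ → ℝ} (hg : Measurable g) (c : ℝ) :
    Measurable fun s : ℝ => L1dist (fun z => g (z + c * s)) g := by
  simp only [L1dist_eq_lintegral]
  exact Measurable.lintegral_prod_right' (f := fun p : ℝ × ℝ => ‖g (p.2 + c * p.1) - g p.2‖ₑ)
    (by fun_prop)

theorem L1dist_translate_le {g : ℝ → ℝ} (hg : Measurable g) (u : ℝ) :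
    L1dist (fun z => g (z + u)) g ≤ 2 * ∫⁻ z, ‖g z‖ₑ := by
  rw [L1dist_eq_lintegral]
  refine (lintegral_mono fun z => enorm_sub_le).trans ?_
  rw [lintegral_add_right _ (by fun_prop), lintegral_add_right_eq_self (fun z => ‖g z‖ₑ), two_mul]

/-- The bandwidth term tends to zero by dominated convergence in `s`, with L¹ continuity of
translation for each `s` and twice the norm of `g` as bound. A zero limiting bandwidth needs no
separate treatment. -/
theorem tendsto_L1dist_gaussConv {g : ℝ → ℝ} {f : ℕ → ℝ → ℝ} {b : ℕ → ℝ} {b₀ : ℝ}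
    (hg : Integrable g) (hgm : Measurable g) (hgC : ∃ C, ∀ z, |g z| ≤ C)
    (hf : ∀ᶠ k in atTop, Measurable (f k) ∧ ∃ C, ∀ z, |f k z| ≤ C)
    (hfg : Tendsto (fun k => L1dist (f k) g) atTop (𝓝 0)) (hb : Tendsto b atTop (𝓝 b₀))
    (htrans : ∀ u : ℕ → ℝ, Tendsto u atTop (𝓝 0) →
      Tendsto (fun k => L1dist (fun z => g (z + u k)) g) atTop (𝓝 0)) :
    Tendsto (fun k => L1dist (gaussConv (b k) (f k)) (gaussConv b₀ g)) atTop (𝓝 0) := by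
  have hlim : Tendsto (fun k => ∫⁻ s, L1dist (fun z => g (z + (b₀ - b k) * s)) g
      ∂gaussianReal 0 1) atTop (𝓝 0) := by
    have := tendsto_lintegral_of_dominated_convergence (μ := gaussianReal 0 1)
      (F := fun k s => L1dist (fun z => g (z + (b₀ - b k) * s)) g) (f := fun _ => 0)
      (fun _ => 2 * ∫⁻ z, ‖g z‖ₑ) (fun k => measurable_L1dist_translate hgm _)
      (fun k => Eventually.of_forall fun s => L1dist_translate_le hgm _) ?_
      (Eventually.of_forall fun s => htrans _ ?_)
    · simpa using this
    · rw [lintegral_const, measure_univ, mul_one]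
      exact ENNReal.mul_ne_top ENNReal.ofNat_ne_top hg.hasFiniteIntegral.ne
    · have := (tendsto_const_nhds (x := b₀)).sub hb |>.mul_const s
      simpa using this
  refine tendsto_zero_of_le_add hfg hlim ?_
  obtain ⟨C, hC⟩ := hgC
  filter_upwards [hf] with k hk
  obtain ⟨C', hC'⟩ := hk.2
  exact L1dist_gaussConv_le hk.1 hgm (C := max C C') (fun z => (hC' z).trans (le_max_right _ _))
    (fun z => (hC z).trans (le_max_left _ _)) _ _

end Smoothing

/-! ### Empirical measures. -/

section Empirical

theorem integral_empirical (n : ℕ) (x : ℕ → ℝ) (g : ℝ → ℝ) :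
    ∫ y, g y ∂empiricalMeasure n x = (∑ i ∈ Finset.range n, g (x i)) / n := by
  rw [empiricalMeasure, integral_smul_measure,
    integral_finsetSum_measure fun i _ => integrable_dirac (by simp)]
  simp [div_eq_inv_mul]

theorem integrable_empirical {n : ℕ} (hn : 0 < n) (x : ℕ → ℝ) (g : ℝ → ℝ) :
    Integrable g (empiricalMeasure n x) := by
  refine Integrable.smul_measure ?_ (by simp [hn.ne'])
  rw [integrable_finsetSum_measure]
  exact fun i _ => integrable_dirac (by simp)

theorem isProbabilityMeasure_empirical {n : ℕ} (hn : 0 < n) (x : ℕ → ℝ) :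
    IsProbabilityMeasure (empiricalMeasure n x) := by
  refine ⟨?_⟩
  simp only [empiricalMeasure, Measure.smul_apply, Measure.coe_finsetSum, Finset.sum_apply,
    measure_univ, Finset.sum_const, Finset.card_range, nsmul_eq_mul, mul_one, smul_eq_mul]
  exact ENNReal.inv_mul_cancel (by simp [hn.ne']) (ENNReal.natCast_ne_top n)

end Empirical

/-! ### Means and variances of projections. -/

section Variance

theorem integral_sub_sq {μ : Measure ℝ} [IsProbabilityMeasure μ]
    (h1 : Integrable (fun x : ℝ => x) μ) (h2 : Integrable (fun x : ℝ => x ^ 2) μ) (c : ℝ) :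
    ∫ x, (x - c) ^ 2 ∂μ = ∫ x, x ^ 2 ∂μ - 2 * c * ∫ x, x ∂μ + c ^ 2 := by
  have e : ∀ x : ℝ, (x - c) ^ 2 = (x ^ 2 - 2 * c * x) + c ^ 2 := fun x => by ring
  have h1' : Integrable (fun x : ℝ => 2 * c * x) μ := h1.const_mul _
  have h12 : Integrable (fun x : ℝ => x ^ 2 - 2 * c * x) μ := h2.sub h1'
  simp only [e]
  rw [integral_add h12 (integrable_const _), integral_sub h2 h1', integral_const_mul]
  simp

variable {μ : Measure ℝ} {φ : ℝ → EReal}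

theorem IsProj.mem_densities [IsProbabilityMeasure μ] (h : IsProj φ μ)
    (hμ : Integrable (fun x : ℝ => x) μ) (hN : Nondeg μ) : expFun φ ∈ densities :=
  ⟨measurable_expFun h.1, expFun_nonneg φ, by
    simp only [ofReal_expFun h.1, h.lintegral_exp hμ hN]⟩

theorem IsProj.integrable_mul [IsProbabilityMeasure μ] (h : IsProj φ μ)
    (hμ : Integrable (fun x : ℝ => x) μ) (hN : Nondeg μ) :
    Integrable (fun x => x * expFun φ x) ∧ Integrable fun x => x ^ 2 * expFun φ x := by
  have hw := h.integrable_weighted hμ hN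
  have hm := measurable_expFun h.1
  refine ⟨integrable_of_abs_le hw (expFun_nonneg φ) hm (w := fun x => x) (by fun_prop) (C := 1)
    fun x => ?_, integrable_of_abs_le hw (expFun_nonneg φ) hm (w := fun x => x ^ 2) (by fun_prop)
    (C := 1) fun x => ?_⟩
  · rw [abs_le]
    constructor <;> nlinarith [sq_nonneg (x + 1), sq_nonneg (x - 1), sq_nonneg (x ^ 2)]
  · rw [abs_of_nonneg (by positivity)]
    nlinarith [sq_nonneg (x ^ 2), sq_nonneg x]

theorem IsProj.densityVariance_le [IsProbabilityMeasure μ] (h : IsProj φ μ)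
    (hμ : Integrable (fun x : ℝ => x) μ) (hN : Nondeg μ)
    (hμ2 : Integrable (fun x : ℝ => x ^ 2) μ) (c : ℝ) :
    densityVariance (expFun φ) ≤ ∫ x, (x - c) ^ 2 ∂μ := by
  have hd := h.mem_densities hμ hN
  obtain ⟨hi1, hi2⟩ := h.integrable_mul hμ hN
  have := isProbabilityMeasure_lawOf hd
  have e := integral_sub_sq ((integrable_lawOf_iff hd).2 hi1) ((integrable_lawOf_iff hd).2 hi2) c
  rw [integral_lawOf hd, integral_lawOf hd, integral_lawOf hd] at e
  refine le_trans ?_ (h.integral_sq_le hμ hN hμ2 c).2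
  rw [e, densityVariance]
  nlinarith [sq_nonneg ((∫ x, x * expFun φ x) - c)]

/-- Log-concave projections of the same distribution have the same mean. -/
theorem IsProj.integral_mul_eq [IsProbabilityMeasure μ] {φ' : ℝ → EReal} (h : IsProj φ μ)
    (h' : IsProj φ' μ) (hμ : Integrable (fun x : ℝ => x) μ) (hN : Nondeg μ) :
    ∫ x, x * expFun φ x = ∫ x, x * expFun φ' x := by
  -- Continuity along the constant sequence `φ`, with `φ'` as the limit, acts as uniqueness.
  refine tendsto_nhds_unique tendsto_const_nhds
    ((W1Conv.const hμ).tendsto_integral_mul hN (φ := fun _ => φ) (Eventually.of_forall fun _ => h)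
      h' (w := fun x => x) (by fun_prop) fun x => ?_)
  rw [abs_le]
  constructor <;> nlinarith [sq_nonneg (x + 1), sq_nonneg (x - 1)]

theorem integral_id_eq_of_reflect [IsProbabilityMeasure μ] {θ : ℝ}
    (hμ : Integrable (fun x : ℝ => x) μ) (h : shiftMeas (-1) (2 * θ) μ = μ) : ∫ x, x ∂μ = θ := by
  have e : ∫ x, x ∂shiftMeas (-1) (2 * θ) μ = 2 * θ - ∫ x, x ∂μ := by
    rw [integral_shiftMeas (by fun_prop)]
    simp only [neg_mul, one_mul, neg_sub]
    rw [integral_sub (integrable_const _) hμ]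
    simp
  rw [h] at e
  linarith

/-- The reflected projection projects the same measure, so both have the same mean, and a mean fixed
by the reflection about `θ` is `θ`. -/
theorem IsProj.integral_mul_eq_of_reflect [IsProbabilityMeasure μ] {θ : ℝ} (hφ : IsProj φ μ)
    (hμ : Integrable (fun x : ℝ => x) μ) (hN : Nondeg μ)
    (h : shiftMeas (-1) (2 * θ) μ = μ) : ∫ x, x * expFun φ x = θ := by
  have h' := hφ.comp_affine (s := -1) (Or.inr rfl) (2 * θ)
  rw [h] at h'
  have e := hφ.integral_mul_eq h' hμ hN
  have hsub : ∫ x, x * expFun (fun x => φ (-1 * x + 2 * θ)) x =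
      ∫ x, (2 * θ - x) * expFun φ x := by
    rw [← integral_sub_left_eq_self (fun x => (2 * θ - x) * expFun φ x) volume (2 * θ)]
    refine integral_congr_ae (Eventually.of_forall fun x => ?_)
    simp only [expFun, sub_sub_cancel]
    rw [show -1 * x + 2 * θ = 2 * θ - x by ring]
  have h1 := integral_expFun_eq_one hφ.1 (hφ.lintegral_exp hμ hN)
  have hi : Integrable (expFun φ) := integrable_expFun hφ.1 (hφ.isRegular hμ).lintegral_ne_top
  simp only [sub_mul] at hsub
  rw [integral_sub (hi.const_mul _) (hφ.integrable_mul hμ hN).1, integral_const_mul, h1] at hsub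
  linarith

/-- The density and its projection have the common mean `θ₀`, so the gap between second moments is
the gap between variances, the form in which the sample bandwidth converges. -/
theorem limitVariance_nonneg_and_eq {f₀ : ℝ → ℝ} {θ₀ : ℝ} (hf₀ : f₀ ∈ symmetricDensities θ₀)
    (hm : Integrable fun x => |x| * f₀ x) (h2 : Integrable fun x => x ^ 2 * f₀ x) :
    0 ≤ limitVariance f₀ ∧ limitVariance f₀ =
      (∫ x, x ^ 2 ∂lawOf f₀) - (∫ x, x ∂lawOf f₀) ^ 2 - densityVariance (projDensity f₀) := by
  have := isProbabilityMeasure_lawOf hf₀.1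
  have hid := integrable_id_lawOf hf₀.1 hm
  have hN := nondeg_lawOf hf₀.1 hm
  have hp := isProj_logProjection_lawOf hf₀ hm
  have hr := shiftMeas_neg_lawOf hf₀
  have e : limitVariance f₀ = (∫ x, x ^ 2 ∂lawOf f₀) - ∫ x, x ^ 2 * projDensity f₀ x := by
    rw [limitVariance, integral_lawOf hf₀.1]
    simp only [mul_sub]
    exact integral_sub h2 (hp.integrable_mul hid hN).2
  have hle := (hp.integral_sq_le hid hN ((integrable_lawOf_iff hf₀.1).2 h2) 0).2
  simp only [sub_zero] at hle
  refine ⟨?_, ?_⟩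
  · rw [e]
    exact sub_nonneg.2 hle
  · rw [e, integral_id_eq_of_reflect hid hr, densityVariance, projDensity,
      hp.integral_mul_eq_of_reflect hid hN hr]
    ring

end Variance

/-! ### The data-driven bandwidth and the smoothed estimator. -/

section SmoothedEstimator

theorem sampleVariance_eq {n : ℕ} (hn : 0 < n) (x : ℕ → ℝ) :
    sampleVariance n x =
      (∫ y, (y - sampleMean n x) ^ 2 ∂empiricalMeasure n x) * (n / ((n : ℝ) - 1)) := by
  have : (n : ℝ) ≠ 0 := by positivity
  rw [integral_empirical, sampleVariance]
  field_simp

theorem sampleMean_eq (n : ℕ) (x : ℕ → ℝ) : sampleMean n x = ∫ y, y ∂empiricalMeasure n x := by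
  rw [integral_empirical, sampleMean]

theorem tendsto_sampleVariance {μ₀ : Measure ℝ} {n : ℕ → ℕ} {x : ℕ → ℕ → ℝ}
    (hn : Tendsto n atTop atTop)
    (h1 : Tendsto (fun k => ∫ y, y ∂empiricalMeasure (n k) (x k)) atTop (𝓝 (∫ y, y ∂μ₀)))
    (h2 : Tendsto (fun k => ∫ y, y ^ 2 ∂empiricalMeasure (n k) (x k)) atTop
      (𝓝 (∫ y, y ^ 2 ∂μ₀))) :
    Tendsto (fun k => sampleVariance (n k) (x k)) atTop
      (𝓝 ((∫ y, y ^ 2 ∂μ₀) - (∫ y, y ∂μ₀) ^ 2)) := by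
  have hr : Tendsto (fun k => (n k : ℝ) / ((n k : ℝ) - 1)) atTop (𝓝 1) := by
    have := (tendsto_natCast_div_add_atTop (𝕜 := ℝ) (-1)).comp hn
    simpa [Function.comp_def, ← sub_eq_add_neg] using this
  have := (h2.sub (h1.pow 2)).mul hr
  rw [mul_one] at this
  refine this.congr' ?_
  filter_upwards [hn.eventually_gt_atTop 0] with k hk
  have := isProbabilityMeasure_empirical hk (x k)
  rw [sampleVariance_eq hk, integral_sub_sq (integrable_empirical hk _ _)
    (integrable_empirical hk _ _), sampleMean_eq]
  ring

variable {f₀ : ℝ → ℝ} {θ₀ : ℝ} {n : ℕ → ℕ} {x : ℕ → ℕ → ℝ} {θ : ℕ → ℝ}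
  (hf₀ : f₀ ∈ symmetricDensities θ₀) (hm : Integrable fun x => |x| * f₀ x)
  (h2 : Integrable fun x => x ^ 2 * f₀ x)
  (hW : W1Conv (fun k => empiricalMeasure (n k) (x k)) (lawOf f₀)) (hn : Tendsto n atTop atTop)
  (hsq : Tendsto (fun k => ∫ y, y ^ 2 ∂empiricalMeasure (n k) (x k)) atTop
    (𝓝 (∫ y, y ^ 2 ∂lawOf f₀)))
  (hθ : Tendsto θ atTop (𝓝 θ₀))

include hf₀ hm hW hn

/-- The variance of the MLE is at most the empirical variance, and the divisor `n - 1` makes the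
sample variance strictly larger. Positivity is needed because the estimator divides by the
bandwidth. -/
theorem eventually_bandwidth_pos : ∀ᶠ k in atTop, 0 < bandwidth (n k) (x k) := by
  filter_upwards [eventually_isProj_logMLE hW (nondeg_lawOf hf₀.1 hm), hn.eventually_gt_atTop 1,
    hW.eventually_nondeg (nondeg_lawOf hf₀.1 hm)] with k hk hn1 hN
  have hn0 : 0 < n k := by omega
  have hn1' : (1 : ℝ) < n k := by exact_mod_cast hn1
  have := hW.prob k
  refine Real.sqrt_pos.2 (sub_pos.2 ?_)
  set c := sampleMean (n k) (x k)
  refine (hk.densityVariance_le (hW.integrable_id k) hN (integrable_empirical hn0 _ _)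
    c).trans_lt ?_
  have hpos : 0 < ∫ y, (y - c) ^ 2 ∂empiricalMeasure (n k) (x k) := by
    refine lt_of_le_of_ne (integral_nonneg fun y => sq_nonneg _) fun h0 => ?_
    have hz := (integral_eq_zero_iff_of_nonneg (fun y => sq_nonneg (y - c))
      (integrable_empirical hn0 _ _)).1 h0.symm
    refine hN.not_ae_eq c (hz.mono fun y hy => ?_)
    exact sub_eq_zero.1 (pow_eq_zero_iff two_ne_zero |>.1 hy)
  rw [sampleVariance_eq hn0]
  refine lt_mul_of_one_lt_right hpos ?_
  rw [one_lt_div (by linarith)]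
  linarith

include h2 hsq

theorem tendsto_bandwidth :
    Tendsto (fun k => bandwidth (n k) (x k)) atTop (𝓝 √(limitVariance f₀)) := by
  rw [(limitVariance_nonneg_and_eq hf₀ hm h2).2]
  have hmean : Tendsto (fun k => ∫ y, y ∂empiricalMeasure (n k) (x k)) atTop
      (𝓝 (∫ y, y ∂lawOf f₀)) := hW.tendsto 1 _ LipschitzWith.id
  exact ((tendsto_sampleVariance hn hmean hsq).sub (hW.tendsto_densityVariance
    (nondeg_lawOf hf₀.1 hm) (eventually_isProj_logMLE hW (nondeg_lawOf hf₀.1 hm))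
    (isProj_logProjection_lawOf hf₀ hm))).sqrt

omit h2 hsq hn hW in
-- A translate of the projection is the projection of a translated law, so L¹ continuity of
-- translation is a special case of continuity of the projection.
theorem tendsto_L1dist_translate_centredProj {u : ℕ → ℝ} (hu : Tendsto u atTop (𝓝 0)) :
    Tendsto (fun k => L1dist (fun z => centredProj f₀ θ₀ (z + u k)) (centredProj f₀ θ₀))
      atTop (𝓝 0) := by
  have := isProbabilityMeasure_lawOf hf₀.1
  have hu' : Tendsto (fun k => θ₀ + u k) atTop (𝓝 θ₀) := by simpa using hu.const_add θ₀
  have hp := isProj_logProjection_lawOf hf₀ hm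
  have h := ((W1Conv.const (integrable_id_lawOf hf₀.1 hm)).shiftMeas hu' 1).tendsto_L1dist
    (nondeg_shiftMeas_lawOf hf₀ hm)
    (Eventually.of_forall fun k => hp.comp_affine (Or.inl rfl) (θ₀ + u k)) (isProj_centred hf₀ hm)
  refine h.congr fun k => ?_
  congr 1
  funext z
  simp only [centredProj, expFun]
  rw [show 1 * z + (θ₀ + u k) = z + u k + θ₀ by ring]

include hθ

theorem tendsto_L1dist_smoothedSymEstimator :
    Tendsto (fun k => L1dist (smoothedSymEstimator (n k) (x k) (θ k)) (smoothedProj f₀ θ₀))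
      atTop (𝓝 0) := by
  have := isProbabilityMeasure_lawOf hf₀.1
  have hp := isProj_centred hf₀ hm
  have hg : Measurable (centredProj f₀ θ₀) := measurable_expFun hp.1
  have hgC : ∃ C, ∀ z, |centredProj f₀ θ₀ z| ≤ C := by
    obtain ⟨B, hB, hT⟩ := hp.exists_tight (integrable_id_shiftMeas (integrable_id_lawOf hf₀.1 hm))
      (nondeg_shiftMeas_lawOf hf₀ hm)
    exact hT.exists_abs_expFun_le hp.1 hB
  have hsym : ∀ᶠ k in atTop, Measurable (symEstimator (n k) (x k) (θ k)) ∧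
      ∃ C, ∀ z, |symEstimator (n k) (x k) (θ k) z| ≤ C := by
    filter_upwards [eventually_mle_regular hf₀ hm hW] with k hk
    obtain ⟨C, hC⟩ := hk.2.2
    refine ⟨((hk.1.comp (measurable_const_add _)).add
      (hk.1.comp (measurable_const_sub _))).const_mul _, C, fun z => ?_⟩
    rw [symEstimator, abs_mul, abs_of_pos (by norm_num : (0 : ℝ) < 1 / 2)]
    have := abs_add_le (mle (n k) (x k) (θ k + z)) (mle (n k) (x k) (θ k - z))
    linarith [hC (θ k + z), hC (θ k - z)]
  refine (tendsto_L1dist_gaussConv (integrable_centredProj hf₀ hm).1 hg hgC hsym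
    (tendsto_L1dist_symEstimator hf₀ hm hW hθ) (tendsto_bandwidth hf₀ hm h2 hW hn hsq)
    fun u hu => tendsto_L1dist_translate_centredProj hf₀ hm hu).congr' ?_
  filter_upwards [eventually_bandwidth_pos hf₀ hm hW hn] with k hk
  congr 1
  · funext z
    exact (gaussConv_eq_integral_gaussianPDFReal hk _ z).symm
  · funext z
    exact gaussConv_sqrt hg _ z

end SmoothedEstimator

/-! ### Countably many test functions that determine convergence. -/

section Discretization

/-- The indicator function of a cell of the grid of mesh `1 / (N + 1)`. -/
def cellTest (N : ℕ) (j : ℤ) : ℝ → ℝ := {x : ℝ | ⌊((N : ℝ) + 1) * x⌋ = j}.indicator 1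

/-- The tail of the absolute value. -/
def tailTest (N : ℕ) : ℝ → ℝ := {x : ℝ | (N : ℝ) ≤ |x|}.indicator fun x => |x|

/-- The cells near the origin. -/
def gridCells (N : ℕ) : Finset ℤ := Finset.Icc (-((N : ℤ) + 1) ^ 2) (((N : ℤ) + 1) ^ 2)

/-- The step function that agrees with `g` at the left end of the cells near the origin. -/
def stepApprox (N : ℕ) (g : ℝ → ℝ) (x : ℝ) : ℝ :=
  ∑ j ∈ gridCells N, g (j / ((N : ℝ) + 1)) * cellTest N j x

theorem measurable_cellTest (N : ℕ) (j : ℤ) : Measurable (cellTest N j) :=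
  measurable_one.indicator
    ((Int.measurable_floor.comp (measurable_const_mul _)) (measurableSet_singleton j))

theorem measurable_tailTest (N : ℕ) : Measurable (tailTest N) :=
  measurable_abs.indicator (measurableSet_le measurable_const measurable_abs)

theorem tailTest_nonneg (N : ℕ) (x : ℝ) : 0 ≤ tailTest N x :=
  Set.indicator_nonneg (fun _ _ => abs_nonneg _) x

theorem integrable_cellTest (μ : Measure ℝ) [IsFiniteMeasure μ] (N : ℕ) (j : ℤ) :
    Integrable (cellTest N j) μ := by
  refine Integrable.of_bound (measurable_cellTest N j).aestronglyMeasurable 1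
    (Eventually.of_forall fun x => ?_)
  simp only [cellTest, Set.indicator_apply, Pi.one_apply]
  split_ifs <;> simp

theorem integrable_tailTest {μ : Measure ℝ} (hμ : Integrable (fun x : ℝ => x) μ) (N : ℕ) :
    Integrable (tailTest N) μ :=
  hμ.abs.indicator (measurableSet_le measurable_const measurable_abs)

theorem stepApprox_eq (N : ℕ) (g : ℝ → ℝ) (x : ℝ) : stepApprox N g x =
    if ⌊((N : ℝ) + 1) * x⌋ ∈ gridCells N
      then g (⌊((N : ℝ) + 1) * x⌋ / ((N : ℝ) + 1)) else 0 := by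
  simp only [stepApprox, cellTest, Set.indicator_apply, Set.mem_ofPred_eq, Pi.one_apply, mul_ite,
    mul_one, mul_zero]
  rw [Finset.sum_ite_eq]

/-- Inside the grid the error is the Lipschitz constant times the mesh. A point outside it satisfies
`|x| ≥ N ≥ 1`, so the linear growth of `g` is absorbed by the tail function. -/
theorem abs_sub_stepApprox_le {g : ℝ → ℝ} {K : ℝ≥0} (hg : LipschitzWith K g) {N : ℕ} (hN : 1 ≤ N)
    (x : ℝ) :
    |g x - stepApprox N g x| ≤ K / ((N : ℝ) + 1) + (|g 0| + K) * tailTest N x := by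
  have hN1 : (1 : ℝ) ≤ N := by exact_mod_cast hN
  have hC : 0 ≤ |g 0| + K := by positivity
  have hfl := Int.floor_le (((N : ℝ) + 1) * x)
  have hlt := Int.lt_floor_add_one (((N : ℝ) + 1) * x)
  rw [stepApprox_eq]
  set m := ⌊((N : ℝ) + 1) * x⌋
  split_ifs with h
  · have h1 := hg.dist_le_mul x (m / ((N : ℝ) + 1))
    rw [Real.dist_eq, Real.dist_eq] at h1
    have h2 : |x - m / ((N : ℝ) + 1)| ≤ 1 / ((N : ℝ) + 1) := by
      rw [abs_of_nonneg (by rw [sub_nonneg, div_le_iff₀ (by positivity)]; linarith),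
        sub_le_iff_le_add, ← add_div, le_div_iff₀ (by positivity)]
      linarith
    have h3 := mul_le_mul_of_nonneg_left h2 K.2
    have h4 := mul_nonneg hC (tailTest_nonneg N x)
    have h5 : (K : ℝ) * (1 / ((N : ℝ) + 1)) = K / ((N : ℝ) + 1) := by ring
    have h6 : (K : ℝ) * |x - m / ((N : ℝ) + 1)| ≤ (K : ℝ) * (1 / ((N : ℝ) + 1)) := h3
    linarith
  · have hx : (N : ℝ) ≤ |x| := by
      by_contra! hlt'
      rw [abs_lt] at hlt'
      refine h (Finset.mem_Icc.2 ⟨?_, ?_⟩)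
      · refine Int.le_floor.2 ?_
        push_cast
        nlinarith
      · refine Int.cast_le (R := ℝ).1 (hfl.trans ?_)
        push_cast
        nlinarith
    have ht : tailTest N x = |x| := Set.indicator_of_mem (s := {x : ℝ | (N : ℝ) ≤ |x|}) hx _
    rw [sub_zero, ht]
    have h1 := lipschitz_abs_le hg x
    have h2 : 0 ≤ (K : ℝ) / ((N : ℝ) + 1) := by positivity
    nlinarith [abs_nonneg (g 0), hN1.trans hx]

theorem integrable_stepApprox (μ : Measure ℝ) [IsFiniteMeasure μ] (N : ℕ) (g : ℝ → ℝ) :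
    Integrable (stepApprox N g) μ :=
  integrable_finsetSum _ fun j _ => (integrable_cellTest μ N j).const_mul _

theorem abs_integral_sub_stepApprox_le {μ : Measure ℝ} [IsProbabilityMeasure μ]
    (hμ : Integrable (fun x : ℝ => x) μ) {g : ℝ → ℝ} {K : ℝ≥0} (hg : LipschitzWith K g) {N : ℕ}
    (hN : 1 ≤ N) : |∫ x, g x ∂μ - ∫ x, stepApprox N g x ∂μ| ≤
      K / ((N : ℝ) + 1) + (|g 0| + K) * ∫ x, tailTest N x ∂μ := by
  rw [← integral_sub (integrable_of_lipschitz hμ hg) (integrable_stepApprox μ N g)]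
  refine abs_integral_le_integral_abs.trans ?_
  have ht := (integrable_tailTest hμ N).const_mul (|g 0| + K)
  have e : K / ((N : ℝ) + 1) + (|g 0| + K) * ∫ x, tailTest N x ∂μ =
      ∫ x, (K / ((N : ℝ) + 1) + (|g 0| + K) * tailTest N x) ∂μ := by
    rw [integral_add (integrable_const _) ht, integral_const_mul]
    simp
  rw [e]
  exact integral_mono ((integrable_of_lipschitz hμ hg).sub (integrable_stepApprox μ N g)).abs
    ((integrable_const _).add ht) fun x => abs_sub_stepApprox_le hg hN x

theorem tendsto_integral_tailTest {μ : Measure ℝ} (hμ : Integrable (fun x : ℝ => x) μ) :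
    Tendsto (fun N => ∫ x, tailTest N x ∂μ) atTop (𝓝 0) := by
  have := tendsto_integral_of_dominated_convergence (μ := μ) (F := tailTest) (f := fun _ => 0)
    (fun x => |x|) (fun N => (measurable_tailTest N).aestronglyMeasurable) hμ.abs
    (fun N => Eventually.of_forall fun x => ?_) (Eventually.of_forall fun x => ?_)
  · simpa using this
  · rw [Real.norm_of_nonneg (tailTest_nonneg N x)]
    exact Set.indicator_le_self' (fun _ _ => abs_nonneg _) x
  · refine tendsto_const_nhds.congr' ?_
    filter_upwards [eventually_gt_atTop ⌈|x|⌉₊] with N hN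
    have : |x| < N := (Nat.le_ceil _).trans_lt (by exact_mod_cast hN)
    exact (Set.indicator_of_notMem (s := {x : ℝ | (N : ℝ) ≤ |x|}) (not_le.2 this) _).symm

/-- Convergence of the integrals of countably many test functions implies convergence of the
integrals of all Lipschitz functions. -/
theorem W1Conv.of_tests {μ : ℕ → Measure ℝ} {μ₀ : Measure ℝ} (hp : ∀ k, IsProbabilityMeasure (μ k))
    (hp₀ : IsProbabilityMeasure μ₀) (hi : ∀ k, Integrable (fun x : ℝ => x) (μ k))
    (hi₀ : Integrable (fun x : ℝ => x) μ₀)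
    (hcell : ∀ N j, Tendsto (fun k => ∫ x, cellTest N j x ∂μ k) atTop
      (𝓝 (∫ x, cellTest N j x ∂μ₀)))
    (htail : ∀ N, Tendsto (fun k => ∫ x, tailTest N x ∂μ k) atTop (𝓝 (∫ x, tailTest N x ∂μ₀))) :
    W1Conv μ μ₀ := by
  refine ⟨hp, hp₀, hi, hi₀, fun K g hg => ?_⟩
  set C := |g 0| + K
  have hstep : ∀ N, Tendsto (fun k => ∫ x, stepApprox N g x ∂μ k) atTop
      (𝓝 (∫ x, stepApprox N g x ∂μ₀)) := fun N => by
    have e : ∀ ν : Measure ℝ, IsProbabilityMeasure ν → ∫ x, stepApprox N g x ∂ν =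
        ∑ j ∈ gridCells N,
          g (j / ((N : ℝ) + 1)) * ∫ x, cellTest N j x ∂ν := fun ν hν => by
      simp only [stepApprox]
      rw [integral_finsetSum _ fun j _ => (integrable_cellTest ν N j).const_mul _]
      simp only [integral_const_mul]
    simp only [e _ (hp _), e _ hp₀]
    exact tendsto_finsetSum _ fun j _ => (hcell N j).const_mul _
  rw [Metric.tendsto_nhds]
  intro ε hε
  have hsmall : Tendsto (fun N : ℕ => 2 * (K / ((N : ℝ) + 1)) + 2 * (C * ∫ x, tailTest N x ∂μ₀))
      atTop (𝓝 0) := by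
    have h1 := ((tendsto_one_div_add_atTop_nhds_zero_nat (𝕜 := ℝ)).const_mul (K : ℝ)).const_mul 2
    have h2 := ((tendsto_integral_tailTest hi₀).const_mul C).const_mul 2
    simpa [div_eq_mul_inv] using h1.add h2
  obtain ⟨N, hNε, hN1⟩ := ((hsmall.eventually (gt_mem_nhds hε)).and (eventually_ge_atTop 1)).exists
  have hA : Tendsto (fun k => |∫ x, stepApprox N g x ∂μ k - ∫ x, stepApprox N g x ∂μ₀| +
      (2 * (K / ((N : ℝ) + 1)) + (C * ∫ x, tailTest N x ∂μ k + C * ∫ x, tailTest N x ∂μ₀))) atTop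
      (𝓝 (2 * (K / ((N : ℝ) + 1)) + 2 * (C * ∫ x, tailTest N x ∂μ₀))) := by
    have h1 := ((hstep N).sub_const (∫ x, stepApprox N g x ∂μ₀)).abs
    rw [sub_self, abs_zero] at h1
    have h2 := (((htail N).const_mul C).add_const (C * ∫ x, tailTest N x ∂μ₀)).const_add
      (2 * ((K : ℝ) / ((N : ℝ) + 1)))
    have h3 := h1.add h2
    rwa [zero_add, ← two_mul] at h3
  filter_upwards [hA.eventually (gt_mem_nhds hNε)] with k hk
  refine lt_of_le_of_lt ?_ hk
  have := hp k
  have a1 := abs_integral_sub_stepApprox_le (hi k) hg hN1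
  have a2 := abs_integral_sub_stepApprox_le hi₀ hg hN1
  rw [Real.dist_eq]
  have a3 := abs_sub_le (∫ x, g x ∂μ k) (∫ x, stepApprox N g x ∂μ k) (∫ x, g x ∂μ₀)
  have a4 := abs_sub_le (∫ x, stepApprox N g x ∂μ k) (∫ x, stepApprox N g x ∂μ₀) (∫ x, g x ∂μ₀)
  rw [abs_sub_comm] at a2
  linarith

end Discretization

/-! ### From deterministic continuity to stochastic convergence. -/

section Transfer

variable {Ω : Type*} [MeasurableSpace Ω] {P : Measure Ω} {μ₀ : Measure ℝ} {X : ℕ → Ω → ℝ}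

theorem ae_tendsto_integral_empirical (hXm : ∀ i, AEMeasurable (X i) P) (hX : iIndepFun X P)
    (hlaw : ∀ i, P.map (X i) = μ₀) {T : ℝ → ℝ} (hT : Measurable T) (hTi : Integrable T μ₀) :
    ∀ᵐ ω ∂P, Tendsto (fun n => ∫ y, T y ∂empiricalMeasure n fun i => X i ω) atTop
      (𝓝 (∫ y, T y ∂μ₀)) := by
  have hi : Integrable (T ∘ X 0) P :=
    (integrable_map_measure hT.aestronglyMeasurable (hXm 0)).1 (by rwa [hlaw])
  have e : ∫ ω, (T ∘ X 0) ω ∂P = ∫ y, T y ∂μ₀ := by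
    rw [← hlaw 0, integral_map (hXm 0) hT.aestronglyMeasurable]
    rfl
  have := strong_law_ae_real (fun i => T ∘ X i) hi
    (fun i j hij => (hX.comp (fun _ => T) fun _ => hT).indepFun hij)
    fun i => (IdentDistrib.mk (hXm i) (hXm 0) (by rw [hlaw, hlaw])).comp hT
  simp only [integral_empirical]
  rw [e] at this
  exact this

/-- A statistic depends continuously on the integrals of the test functions with respect to the
empirical measure and on the location parameter. -/
def ContinuousInTests {ι : Type*} (T : ι → ℝ → ℝ) (μ₀ : Measure ℝ) (θ₀ : ℝ)
    (D : ℕ → (ℕ → ℝ) → ℝ → ℝ≥0∞) : Prop :=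
  ∀ (n : ℕ → ℕ) (x : ℕ → ℕ → ℝ) (θ : ℕ → ℝ), (∀ k, 0 < n k) → Tendsto n atTop atTop →
    Tendsto θ atTop (𝓝 θ₀) →
    (∀ i, Tendsto (fun k => ∫ y, T i y ∂empiricalMeasure (n k) (x k)) atTop
      (𝓝 (∫ y, T i y ∂μ₀))) →
    Tendsto (fun k => D (n k) (x k) (θ k)) atTop (𝓝 0)

variable {ι : Type*} {T : ι → ℝ → ℝ} {θ₀ : ℝ} {D : ℕ → (ℕ → ℝ) → ℝ → ℝ≥0∞}
  {θbar : ℕ → Ω → ℝ}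

theorem ContinuousInTests.ae_tendsto [Countable ι] (hD : ContinuousInTests T μ₀ θ₀ D)
    (hT : ∀ i, Measurable (T i)) (hTi : ∀ i, Integrable (T i) μ₀)
    (hXm : ∀ i, AEMeasurable (X i) P) (hX : iIndepFun X P) (hlaw : ∀ i, P.map (X i) = μ₀)
    (hθ : ∀ᵐ ω ∂P, Tendsto (fun n => θbar n ω) atTop (𝓝 θ₀)) :
    ∀ᵐ ω ∂P, Tendsto (fun n => D n (fun i => X i ω) (θbar n ω)) atTop (𝓝 0) := by
  filter_upwards [hθ,
    ae_all_iff.2 fun i => ae_tendsto_integral_empirical hXm hX hlaw (hT i) (hTi i)] with ω h1 h2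
  refine (tendsto_add_atTop_iff_nat (f := fun n => D n (fun i => X i ω) (θbar n ω)) 1).1 ?_
  -- The index is shifted by one because the empirical measure of an empty sample is not a
  -- probability measure.
  exact hD (fun k => k + 1) (fun _ i => X i ω) (fun k => θbar (k + 1) ω) (fun k => k.succ_pos)
    (tendsto_add_atTop_nat 1) ((tendsto_add_atTop_iff_nat 1).2 h1)
    fun i => (tendsto_add_atTop_iff_nat 1).2 (h2 i)

/-- Finitely many test functions determine a statistic up to a given error, uniformly in large
samples. -/
theorem ContinuousInTests.exists_uniform {T : ℕ → ℝ → ℝ} (hD : ContinuousInTests T μ₀ θ₀ D)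
    {ε : ℝ≥0∞} (hε : 0 < ε) : ∃ (K : ℕ) (δ : ℝ), 0 < δ ∧ ∀ n x θ, K < n → dist θ θ₀ < δ →
      (∀ i < K, dist (∫ y, T i y ∂empiricalMeasure n x) (∫ y, T i y ∂μ₀) < δ) → D n x θ < ε := by
  by_contra! hbad
  have hδ : ∀ K : ℕ, (0 : ℝ) < 1 / ((K : ℝ) + 1) := fun K => by positivity
  -- Counterexamples at tolerance `1 / (K + 1)` with the first `K` tests form a sequence to which
  -- continuity applies, yet its error never falls below `ε`.
  choose n x θ hn hθ hT hDε using fun K : ℕ => hbad K (1 / ((K : ℝ) + 1)) (hδ K)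
  have hlim0 := tendsto_one_div_add_atTop_nhds_zero_nat (𝕜 := ℝ)
  have hlim := hD n x θ (fun K => (Nat.zero_le K).trans_lt (hn K))
    (tendsto_atTop_mono (fun K => (hn K).le) tendsto_id)
    (tendsto_iff_dist_tendsto_zero.2
      (squeeze_zero (fun _ => dist_nonneg) (fun K => (hθ K).le) hlim0))
    fun i => tendsto_iff_dist_tendsto_zero.2
      (squeeze_zero' (Eventually.of_forall fun _ => dist_nonneg)
        ((eventually_gt_atTop i).mono fun K hK => (hT K i hK).le) hlim0)
  obtain ⟨K, hK⟩ := (hlim.eventually (gt_mem_nhds hε)).exists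
  exact (hDε K).not_gt hK

/-- The event of a large error is contained in a finite union: either the location estimate or one
of finitely many empirical integrals is off by `δ`. Only monotonicity of `P` is used for the error
itself, so the estimators need not be measurable in the sample. -/
theorem ContinuousInTests.tendsToZeroInProb [IsProbabilityMeasure P] [Countable ι]
    [Nonempty ι] (hD : ContinuousInTests T μ₀ θ₀ D)
    (hT : ∀ i, Measurable (T i)) (hTi : ∀ i, Integrable (T i) μ₀)
    (hXm : ∀ i, AEMeasurable (X i) P) (hX : iIndepFun X P) (hlaw : ∀ i, P.map (X i) = μ₀)
    (hθ : TendstoInMeasure P θbar atTop fun _ => θ₀) :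
    TendsToZeroInProb P fun n ω => D n (fun i => X i ω) (θbar n ω) := by
  intro ε hε
  obtain ⟨e, he⟩ := exists_surjective_nat ι
  have hDe : ContinuousInTests (T ∘ e) μ₀ θ₀ D := fun n x θ hn0 hn hθ h =>
    hD n x θ hn0 hn hθ fun i => by
      obtain ⟨j, rfl⟩ := he i
      exact h j
  obtain ⟨K, δ, hδ, hK⟩ := hDe.exists_uniform hε
  set A : ℕ → ℕ → Set Ω := fun i n =>
    {ω | δ ≤ dist (∫ y, T (e i) y ∂empiricalMeasure n fun i => X i ω) (∫ y, T (e i) y ∂μ₀)}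
  have hA : ∀ i, Tendsto (fun n => P (A i n)) atTop (𝓝 0) := fun i => by
    have hmeas : ∀ n, AEStronglyMeasurable
        (fun ω => ∫ y, T (e i) y ∂empiricalMeasure n fun i => X i ω) P := fun n => by
      simp only [integral_empirical]
      have : AEMeasurable (fun ω => ∑ j ∈ Finset.range n, T (e i) (X j ω)) P :=
        Finset.aemeasurable_fun_sum _ fun j _ => (hT (e i)).comp_aemeasurable (hXm j)
      exact (this.div_const _).aestronglyMeasurable
    exact tendstoInMeasure_iff_dist.1 (tendstoInMeasure_of_tendsto_ae hmeas
      (ae_tendsto_integral_empirical hXm hX hlaw (hT (e i)) (hTi (e i)))) δ hδ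
  have hsum : Tendsto (fun n => P {ω | δ ≤ dist (θbar n ω) θ₀} + ∑ i ∈ Finset.range K, P (A i n))
      atTop (𝓝 0) := by
    simpa using (tendstoInMeasure_iff_dist.1 hθ δ hδ).add
      (tendsto_finsetSum (Finset.range K) fun i _ => hA i)
  refine tendsto_of_tendsto_of_tendsto_of_le_of_le' tendsto_const_nhds hsum
    (Eventually.of_forall fun _ => zero_le) ?_
  filter_upwards [eventually_gt_atTop K] with n hn
  calc P {ω | ε ≤ D n (fun i => X i ω) (θbar n ω)}
      ≤ P ({ω | δ ≤ dist (θbar n ω) θ₀} ∪ ⋃ i ∈ Finset.range K, A i n) := by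
        refine measure_mono fun ω hω => ?_
        by_contra hnot
        simp only [A, Set.mem_union, Set.mem_iUnion, Finset.mem_range, Set.mem_ofPred_eq, not_or,
          not_exists, not_le] at hnot
        exact (hK n _ _ hn hnot.1 hnot.2).not_ge hω
    _ ≤ _ := (measure_union_le _ _).trans
        (add_le_add_right (measure_biUnion_finset_le _ _) _)

end Transfer

/-! ### The test families and the estimators as continuous statistics. -/

section Tests

/-- Test functions that determine convergence to a distribution with a first moment. -/
def momentTests : (ℕ × ℤ) ⊕ ℕ → ℝ → ℝ :=
  Sum.elim (fun p => cellTest p.1 p.2) tailTest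

theorem measurable_momentTests (i : (ℕ × ℤ) ⊕ ℕ) : Measurable (momentTests i) := by
  rcases i with p | N
  exacts [measurable_cellTest _ _, measurable_tailTest _]

/-- The functions `momentTests` and the square. -/
def squareTests : Option ((ℕ × ℤ) ⊕ ℕ) → ℝ → ℝ := fun i => i.elim (fun x => x ^ 2) momentTests

theorem measurable_squareTests (i : Option ((ℕ × ℤ) ⊕ ℕ)) : Measurable (squareTests i) := by
  rcases i with _ | i
  exacts [measurable_id.pow_const 2, measurable_momentTests i]

theorem integrable_momentTests {μ : Measure ℝ} [IsProbabilityMeasure μ]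
    (h : Integrable (fun x : ℝ => x) μ) (i : (ℕ × ℤ) ⊕ ℕ) : Integrable (momentTests i) μ := by
  rcases i with p | N
  exacts [integrable_cellTest μ _ _, integrable_tailTest h _]

theorem W1Conv.of_momentTests {μ₀ : Measure ℝ} [hp : IsProbabilityMeasure μ₀]
    (h : Integrable (fun x : ℝ => x) μ₀) {n : ℕ → ℕ} {x : ℕ → ℕ → ℝ} (hn : ∀ k, 0 < n k)
    (hT : ∀ i, Tendsto (fun k => ∫ y, momentTests i y ∂empiricalMeasure (n k) (x k)) atTop
      (𝓝 (∫ y, momentTests i y ∂μ₀))) :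
    W1Conv (fun k => empiricalMeasure (n k) (x k)) μ₀ :=
  W1Conv.of_tests (fun k => isProbabilityMeasure_empirical (hn k) _) hp
    (fun k => integrable_empirical (hn k) _ _) h (fun N j => hT (Sum.inl (N, j)))
    fun N => hT (Sum.inr N)

variable {f₀ : ℝ → ℝ} {θ₀ : ℝ} (hf₀ : f₀ ∈ symmetricDensities θ₀)
  (hm : Integrable fun x => |x| * f₀ x)

include hf₀ hm

theorem continuousInTests_symEstimator : ContinuousInTests momentTests (lawOf f₀) θ₀
    fun n x θ => L1dist (symEstimator n x θ) (centredProj f₀ θ₀) := fun n x θ hn0 _ hθ hT => by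
  have := isProbabilityMeasure_lawOf hf₀.1
  exact tendsto_L1dist_symEstimator hf₀ hm
    (W1Conv.of_momentTests (integrable_id_lawOf hf₀.1 hm) hn0 hT) hθ

theorem continuousInTests_partialMLE : ContinuousInTests momentTests (lawOf f₀) θ₀
    fun n x θ => L1dist (partialMLE n x θ) (centredProj f₀ θ₀) := fun n x θ hn0 _ hθ hT => by
  have := isProbabilityMeasure_lawOf hf₀.1
  exact tendsto_L1dist_partialMLE hf₀ hm
    (W1Conv.of_momentTests (integrable_id_lawOf hf₀.1 hm) hn0 hT) hθ

theorem continuousInTests_geoEstimator : ContinuousInTests momentTests (lawOf f₀) θ₀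
    fun n x θ => L1dist (geoEstimator n x θ) (centredProj f₀ θ₀) := fun n x θ hn0 _ hθ hT => by
  have := isProbabilityMeasure_lawOf hf₀.1
  exact tendsto_L1dist_geoEstimator hf₀ hm
    (W1Conv.of_momentTests (integrable_id_lawOf hf₀.1 hm) hn0 hT) hθ

theorem continuousInTests_smoothedSymEstimator (h2 : Integrable fun x => x ^ 2 * f₀ x) :
    ContinuousInTests squareTests (lawOf f₀) θ₀
      fun n x θ => L1dist (smoothedSymEstimator n x θ) (smoothedProj f₀ θ₀) :=
    fun n x θ hn0 hn hθ hT => by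
  have := isProbabilityMeasure_lawOf hf₀.1
  exact tendsto_L1dist_smoothedSymEstimator hf₀ hm h2
    (W1Conv.of_momentTests (integrable_id_lawOf hf₀.1 hm) hn0 fun i => hT (some i)) hn
    (hT none) hθ

end Tests

end LogConcaveLocation

end

theorem mainTheorem10 {Ω : Type*} [MeasurableSpace Ω] (P : Measure Ω) [IsProbabilityMeasure P]
    (f₀ : ℝ → ℝ) (θ₀ : ℝ) (hf₀ : f₀ ∈ modelP1) (hθ₀ : f₀ ∈ symmetricDensities θ₀)
    (X : ℕ → Ω → ℝ) (hXm : ∀ i, AEMeasurable (X i) P) (hXindep : iIndepFun X P)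
    (hXlaw : ∀ i, P.map (X i) = lawOf f₀)
    (θbar : ℕ → Ω → ℝ) (hθbarm : ∀ n, AEMeasurable (θbar n) P)
    (hθbar : TendstoInMeasure P θbar atTop (fun _ => θ₀)) :
    -- convergence in probability
    (TendsToZeroInProb P
        (fun n ω => L1dist (symEstimator n (fun i => X i ω) (θbar n ω)) (centredProj f₀ θ₀)) ∧
      TendsToZeroInProb P
        (fun n ω => L1dist (partialMLE n (fun i => X i ω) (θbar n ω)) (centredProj f₀ θ₀)) ∧
      TendsToZeroInProb P
        (fun n ω => L1dist (geoEstimator n (fun i => X i ω) (θbar n ω)) (centredProj f₀ θ₀)) ∧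
      (Integrable (fun z => z ^ 2 * f₀ z) →
        0 ≤ limitVariance f₀ ∧
        TendsToZeroInProb P
          (fun n ω =>
            L1dist (smoothedSymEstimator n (fun i => X i ω) (θbar n ω)) (smoothedProj f₀ θ₀)))) ∧
    -- almost sure convergence
    ((∀ᵐ ω ∂P, Tendsto (fun n => θbar n ω) atTop (𝓝 θ₀)) →
      (∀ᵐ ω ∂P, Tendsto
        (fun n => L1dist (symEstimator n (fun i => X i ω) (θbar n ω)) (centredProj f₀ θ₀))
        atTop (𝓝 0)) ∧
      (∀ᵐ ω ∂P, Tendsto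
        (fun n => L1dist (partialMLE n (fun i => X i ω) (θbar n ω)) (centredProj f₀ θ₀))
        atTop (𝓝 0)) ∧
      (∀ᵐ ω ∂P, Tendsto
        (fun n => L1dist (geoEstimator n (fun i => X i ω) (θbar n ω)) (centredProj f₀ θ₀))
        atTop (𝓝 0)) ∧
      (Integrable (fun z => z ^ 2 * f₀ z) →
        ∀ᵐ ω ∂P, Tendsto
          (fun n =>
            L1dist (smoothedSymEstimator n (fun i => X i ω) (θbar n ω)) (smoothedProj f₀ θ₀))
          atTop (𝓝 0))) := by
  have hm := hf₀.2.2.2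
  have := isProbabilityMeasure_lawOf hθ₀.1
  have hTi := integrable_momentTests (integrable_id_lawOf hθ₀.1 hm)
  have hSi : Integrable (fun z => z ^ 2 * f₀ z) → ∀ i, Integrable (squareTests i) (lawOf f₀) := by
    rintro h2 (_ | i)
    exacts [(integrable_lawOf_iff hθ₀.1).2 h2, hTi i]
  have hsym := continuousInTests_symEstimator hθ₀ hm
  have hpart := continuousInTests_partialMLE hθ₀ hm
  have hgeo := continuousInTests_geoEstimator hθ₀ hm
  have hsm := continuousInTests_smoothedSymEstimator hθ₀ hm
  refine ⟨⟨?_, ?_, ?_, fun h2 => ⟨(limitVariance_nonneg_and_eq hθ₀ hm h2).1, ?_⟩⟩,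
    fun hae => ⟨?_, ?_, ?_, fun h2 => ?_⟩⟩
  · exact hsym.tendsToZeroInProb measurable_momentTests hTi hXm hXindep hXlaw hθbar
  · exact hpart.tendsToZeroInProb measurable_momentTests hTi hXm hXindep hXlaw hθbar
  · exact hgeo.tendsToZeroInProb measurable_momentTests hTi hXm hXindep hXlaw hθbar
  · exact (hsm h2).tendsToZeroInProb measurable_squareTests (hSi h2) hXm hXindep hXlaw hθbar
  · exact hsym.ae_tendsto measurable_momentTests hTi hXm hXindep hXlaw hae
  · exact hpart.ae_tendsto measurable_momentTests hTi hXm hXindep hXlaw hae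
  · exact hgeo.ae_tendsto measurable_momentTests hTi hXm hXindep hXlaw hae
  · exact (hsm h2).ae_tendsto measurable_squareTests (hSi h2) hXm hXindep hXlaw hae
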